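/- Let $Q=\mathbb T^2\smallsetminus\bigsqcup_{i=1}^D B_i$, $D\ge 1$, be a Sinai billiard table on $\mathbb T^2=\mathbb R^2/\mathbb Z^2$: the scatterers $B_i$ are pairwise disjoint, closed, strictly convex domains (each lifts to a convex body of the plane, and all $\mathbb Z^2$-translates of these lifts are pairwise disjoint), and their boundaries are $C^3$ with strictly positive curvature. Assume finite horizon: no billiard trajectory makes only tangential collisions, i.e. every straight line in $\mathbb R^2$ meets the interior of some lifted scatterer. Let $M=\bigsqcup_i M_i$, $M_i=\partial B_i\times[-\frac\pi2,\frac\pi2]$, with coordinates $(r,\varphi)$, where $r$ is arclength along $\partial B_i$ and $\varphi$ is the angle between the post-collisional velocity and the outer normal of $B_i$. Let $T:M\to M$ be the billiard map, which sends a collision to the next one (tangential collisions included). Let $\mathcal S_0=\{|\varphi|=\pi/2\}$, $\mathcal S_1=\mathcal S_0\cup T^{-1}\mathcal S_0$, and let $\mathcal M_0^1$ be the set of connected components of $M\smallsetminus\mathcal S_1$. A function $g:M\to\mathbb R$ is $\mathcal M_0^1$-continuous if it is bounded on $M$ and continuous on each element of $\mathcal M_0^1$; it is piecewise Hölder if for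 some $\alpha\in(0,1)$ it is $\alpha$-Hölder on each element of $\mathcal M_0^1$. Let $\mathcal P$ be the partition of $M$ into the maximal connected sets on which both $T$ and $T^{-1}$ are continuous, $\mathcal P_0^n=\bigvee_{i=0}^nT^{-i}\mathcal P$, and $S_ng=\sum_{i=0}^{n-1}g\circ T^i$. Put $$P_*(T,g)=\lim_{n\to\infty}\frac1n\log\sum_{A\in\mathcal P_0^n}\sup_A e^{S_ng}.$$ Let $d$ be the Euclidean distance in $(r,\varphi)$ on each $M_i$ ($r$ taken modulo the length of $\partial B_i$), with $d(x,y)=10D\max_i\operatorname{diam}M_i$ if $x,y$ lie in different $M_i$, and let $d_n(x,y)=\max_{0\le i\le n}d(T^ix,T^iy)$. A set $E\subset M$ is $(n,\varepsilon)$-separated if $d_n(x,y)>\varepsilon$ for all distinct $x,y\in E$; a set $F\subset M$ is $(n,\varepsilon)$-spanning if for each $x\in M$ there is $y\in F$ with $d_n(x,y)\le\varepsilon$. Bowen's pressures are $$P_{\rm sep}(T,g)=\lim_{\varepsilon\to0^+}\limsup_{n\to\infty}\frac1n\log\sup\Big\{\sum_{x\in E}e^{S_ng(x)}\;:\;E\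 (n,\varepsilon)\text{-separated}\Big\},$$ $$P_{\rm span}(T,g)=\lim_{\varepsilon\to0^+}\limsup_{n\to\infty}\frac1n\log\inf\Big\{\sum_{x\in F}e^{S_ng(x)}\;:\;F\ (n,\varepsilon)\text{-spanning}\Big\}.$$ Proposition. Let $g$ be $\mathcal M_0^1$-continuous. Then the limit $P_*(T,g)$ exists as a real number, $P_{\rm span}(T,g)\le P_*(T,g)$ and $P_{\rm sep}(T,g)\le P_*(T,g)$. If $P_*(T,g)-\sup_M g>0$, then $P_{\rm sep}(T,g)=P_*(T,g)$; if in addition $g$ is piecewise Hölder, then $P_{\rm span}(T,g)=P_*(T,g)$ as well. -/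

import Mathlib

open Filter Topology Set
open scoped ENNReal

noncomputable section

/-- A scatterer, lifted to the plane `ℝ² = ℂ`: a compact strictly convex body whose boundary is a
simple closed `C³` curve of strictly positive curvature. The boundary is parametrized
counterclockwise by arclength. -/
structure Scatterer where
  /-- the closed domain -/
  body : Set ℂ
  /-- the length of the boundary -/
  len : ℝ
  /-- the arclength parametrization of the boundary -/
  curve : ℝ → ℂ
  isCompact_body : IsCompact body
  strictConvex_body : StrictConvex ℝ body
  len_pos : 0 < len
  contDiff_curve : ContDiff ℝ 3 curve
  periodic_curve : Function.Periodic curve len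
  injOn_curve : InjOn curve (Ico 0 len)
  range_curve : range curve = frontier body
  norm_deriv_curve : ∀ s, ‖deriv curve s‖ = 1
  /-- the signed curvature `det (γ', γ'')` is positive -/
  curvature_pos : ∀ s, 0 < ((starRingEnd ℂ) (deriv curve s) * deriv (deriv curve) s).im

namespace Scatterer

theorem periodic_deriv_curve (S : Scatterer) : Function.Periodic (deriv S.curve) S.len := by
  intro s
  have h : (fun x => S.curve (x + S.len)) = S.curve := funext S.periodic_curve
  rw [← deriv_comp_add_const, h]

/-- The boundary point with arclength coordinate `r`. -/
def point (S : Scatterer) (r : AddCircle S.len) : ℂ := S.periodic_curve.lift r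

/-- The unit tangent vector of the boundary at `r`. -/
def tangent (S : Scatterer) (r : AddCircle S.len) : ℂ := S.periodic_deriv_curve.lift r

/-- The unit normal vector of the boundary at `r` that points out of the scatterer. -/
def normal (S : Scatterer) (r : AddCircle S.len) : ℂ := -Complex.I * S.tangent r

end Scatterer

/-- The vector of the lattice `ℤ²` with coordinates `m`. -/
def latticeVector (m : ℤ × ℤ) : ℂ := (m.1 : ℂ) + (m.2 : ℂ) * Complex.I

/-- A Sinai billiard table on the torus `ℝ² / ℤ²`: finitely many (at least one) scatterers that
are pairwise disjoint on the torus, i.e. whose lifts, with all their translates by `ℤ²`, are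
pairwise disjoint in the plane. -/
structure SinaiTable where
  /-- the number of scatterers -/
  D : ℕ
  D_pos : 0 < D
  /-- one lift of each scatterer -/
  scatterer : Fin D → Scatterer
  disjoint_scatterer : ∀ (i j : Fin D) (m : ℤ × ℤ), (i ≠ j ∨ m ≠ 0) →
    Disjoint (scatterer i).body ((fun z => z + latticeVector m) '' (scatterer j).body)

namespace SinaiTable

/-- Finite horizon: no trajectory makes only tangential collisions. A trajectory without a
non-tangential collision is a straight line that avoids the interiors of all scatterers, so this
says that each straight line meets the interior of some scatterer. -/
def FiniteHorizon (Q : SinaiTable) : Prop :=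
  ∀ q v : ℂ, v ≠ 0 →
    ∃ (t : ℝ) (i : Fin Q.D) (m : ℤ × ℤ),
      q + t * v - latticeVector m ∈ interior (Q.scatterer i).body

/-- The cylinder `M_i = ∂B_i × [-π/2, π/2]` in the coordinates `(r, φ)`, with its Euclidean metric
(`r` is taken modulo the length of `∂B_i`). -/
abbrev Cylinder (Q : SinaiTable) (i : Fin Q.D) : Type :=
  WithLp 2 (AddCircle (Q.scatterer i).len × Icc (-(Real.pi / 2)) (Real.pi / 2))

/-- The phase space `M` of the collision map: the disjoint union of the cylinders `M_i`. -/
abbrev PhaseSpace (Q : SinaiTable) : Type := Σ i : Fin Q.D, Q.Cylinder i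

instance (Q : SinaiTable) : Nonempty Q.PhaseSpace :=
  ⟨⟨⟨0, Q.D_pos⟩, WithLp.toLp 2 (0, ⟨0, by constructor <;> linarith [Real.pi_pos]⟩)⟩⟩

variable (Q : SinaiTable)

/-- The collision point of `x`, on the chosen lift of its scatterer. -/
def position (x : Q.PhaseSpace) : ℂ := (Q.scatterer x.1).point x.2.fst

/-- The unit normal at the collision point of `x`, pointing out of the scatterer. -/
def normal (x : Q.PhaseSpace) : ℂ := (Q.scatterer x.1).normal x.2.fst

/-- The angle `φ` of `x = (r, φ)`. -/
def angle (x : Q.PhaseSpace) : ℝ := (x.2.snd : ℝ)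

/-- The unit velocity just after the collision `x`: it makes the angle `φ` with the normal. -/
def velocity (x : Q.PhaseSpace) : ℂ := Complex.exp (Q.angle x * Complex.I) * Q.normal x

/-- `y` is the next collision after `x`: the particle that leaves `x` meets no scatterer before it
reaches (a translate of) the collision point of `y`, and there it is reflected specularly.
Tangential collisions count as collisions. -/
def IsNextCollision (x y : Q.PhaseSpace) : Prop :=
  ∃ (t : ℝ) (m : ℤ × ℤ), 0 < t ∧
    Q.position x + t * Q.velocity x = Q.position y + latticeVector m ∧
    (∀ s ∈ Ioo 0 t, ∀ (j : Fin Q.D) (k : ℤ × ℤ),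
      Q.position x + s * Q.velocity x - latticeVector k ∉ (Q.scatterer j).body) ∧
    Q.velocity y =
      Q.velocity x - ((2 * inner ℝ (Q.velocity x) (Q.normal y) : ℝ) : ℂ) * Q.normal y

open Classical in
/-- The billiard (collision) map `T`. For a table with finite horizon each point has exactly one
next collision, so that the second case does not occur. -/
def T (x : Q.PhaseSpace) : Q.PhaseSpace :=
  if h : ∃ y, Q.IsNextCollision x y then h.choose else x

/-- The inverse of the billiard map (which is a bijection for a table with finite horizon). -/
def Tinv : Q.PhaseSpace → Q.PhaseSpace := Function.invFun Q.T

/-- The set `S_0` of grazing collisions. -/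
def grazingSet : Set Q.PhaseSpace := {x | |Q.angle x| = Real.pi / 2}

/-- The singularity set `S_n = ⋃_{i=0}^n T^{-i} S_0`, `n ≥ 0`. -/
def singularSet (n : ℕ) : Set Q.PhaseSpace := ⋃ i ∈ Iic n, Q.T^[i] ⁻¹' Q.grazingSet

/-- `M_0^n`: the connected components of the complement of `S_n`. -/
def domains (n : ℕ) : Set (Set Q.PhaseSpace) :=
  {A | ∃ x ∈ (Q.singularSet n)ᶜ, A = connectedComponentIn (Q.singularSet n)ᶜ x}

/-- The partition `P` of the phase space into the maximal connected sets on which both `T` and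
`T⁻¹` are continuous. -/
def basePartition : Set (Set Q.PhaseSpace) :=
  {A | Maximal (fun C => IsConnected C ∧ ContinuousOn Q.T C ∧ ContinuousOn Q.Tinv C) A}

/-- The partition `P_0^n = ⋁_{i=0}^n T^{-i} P`. -/
def partition (n : ℕ) : Set (Set Q.PhaseSpace) :=
  {A | A.Nonempty ∧ ∃ a : ℕ → Set Q.PhaseSpace,
    (∀ i ∈ Iic n, a i ∈ Q.basePartition) ∧ A = ⋂ i ∈ Iic n, Q.T^[i] ⁻¹' a i}

/-- The distance `d`: Euclidean on each `M_i`, and `10 D max_i diam M_i` between different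
components. -/
def distance (x y : Q.PhaseSpace) : ℝ :=
  if h : x.1 = y.1 then dist (h ▸ x.2) y.2
  else 10 * (Q.D : ℝ) * ⨆ i : Fin Q.D, Metric.diam (univ : Set (Q.Cylinder i))

/-- The Bowen distance `d_n (x, y) = max_{0 ≤ i ≤ n} d (T^i x, T^i y)`. -/
def bowenDistance (n : ℕ) (x y : Q.PhaseSpace) : ℝ :=
  (Finset.range (n + 1)).sup' Finset.nonempty_range_add_one
    (fun i => Q.distance (Q.T^[i] x) (Q.T^[i] y))

/-- `(n, ε)`-separated sets. -/
def IsSeparated (n : ℕ) (ε : ℝ) (E : Set Q.PhaseSpace) : Prop :=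
  ∀ x ∈ E, ∀ y ∈ E, x ≠ y → ε < Q.bowenDistance n x y

/-- `(n, ε)`-spanning sets. -/
def IsSpanning (n : ℕ) (ε : ℝ) (F : Set Q.PhaseSpace) : Prop :=
  ∀ x, ∃ y ∈ F, Q.bowenDistance n x y ≤ ε

/-- `exp (S_n g (x))`, where `S_n g = ∑_{i < n} g ∘ T^i` is the Birkhoff sum. -/
def weight (g : Q.PhaseSpace → ℝ) (n : ℕ) (x : Q.PhaseSpace) : ℝ≥0∞ :=
  ENNReal.ofReal (Real.exp (birkhoffSum Q.T g n x))

/-- `(1/n) log ∑_{A ∈ P_0^n} sup_A exp (S_n g)`; the pressure `P_*(T, g)` is the limit of this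
sequence. -/
def pressureSeq (g : Q.PhaseSpace → ℝ) (n : ℕ) : EReal :=
  ENNReal.log (∑' A : Q.partition n, ⨆ x ∈ (A : Set Q.PhaseSpace), Q.weight g n x) / (n : EReal)

/-- The exponential growth rate of the weight of the largest `(n, ε)`-separated sets. -/
def sepRate (g : Q.PhaseSpace → ℝ) (ε : ℝ) : EReal :=
  limsup (fun n : ℕ =>
    ENNReal.log (⨆ (E : Set Q.PhaseSpace) (_ : Q.IsSeparated n ε E), ∑' x : E, Q.weight g n x) /
      (n : EReal)) atTop

/-- The exponential growth rate of the weight of the smallest `(n, ε)`-spanning sets. -/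
def spanRate (g : Q.PhaseSpace → ℝ) (ε : ℝ) : EReal :=
  limsup (fun n : ℕ =>
    ENNReal.log (⨅ (F : Set Q.PhaseSpace) (_ : Q.IsSpanning n ε F), ∑' x : F, Q.weight g n x) /
      (n : EReal)) atTop

/-- Bowen's pressure `P_sep(T, g)` defined with separated sets. The rate increases as `ε`
decreases, so that the supremum is the limit as `ε → 0` (see `tendsto_sepRate`). -/
def sepPressure (g : Q.PhaseSpace → ℝ) : EReal := ⨆ ε ∈ Ioi (0 : ℝ), Q.sepRate g ε

/-- Bowen's pressure `P_span(T, g)` defined with spanning sets. The rate increases as `ε`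
decreases, so that the supremum is the limit as `ε → 0` (see `tendsto_spanRate`). -/
def spanPressure (g : Q.PhaseSpace → ℝ) : EReal := ⨆ ε ∈ Ioi (0 : ℝ), Q.spanRate g ε

theorem antitone_sepRate (g : Q.PhaseSpace → ℝ) : Antitone (Q.sepRate g) := by
  intro ε ε' h
  refine limsup_le_limsup (Eventually.of_forall fun n => ?_)
  refine EReal.div_le_div_right_of_nonneg (by positivity) (ENNReal.log_monotone ?_)
  exact iSup_mono fun E => iSup_mono' fun hE =>
    ⟨fun x hx y hy hxy => h.trans_lt (hE x hx y hy hxy), le_rfl⟩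

theorem antitone_spanRate (g : Q.PhaseSpace → ℝ) : Antitone (Q.spanRate g) := by
  intro ε ε' h
  refine limsup_le_limsup (Eventually.of_forall fun n => ?_)
  refine EReal.div_le_div_right_of_nonneg (by positivity) (ENNReal.log_monotone ?_)
  exact iInf_mono fun F => iInf_mono' fun hF =>
    ⟨fun x => let ⟨y, hy, hxy⟩ := hF x; ⟨y, hy, hxy.trans h⟩, le_rfl⟩

theorem tendsto_sepRate (g : Q.PhaseSpace → ℝ) :
    Tendsto (Q.sepRate g) (𝓝[>] 0) (𝓝 (Q.sepPressure g)) := by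
  have h := ((Q.antitone_sepRate g).antitoneOn (Ioi 0)).tendsto_nhdsGT (OrderTop.bddAbove _)
  rwa [sSup_image] at h

theorem tendsto_spanRate (g : Q.PhaseSpace → ℝ) :
    Tendsto (Q.spanRate g) (𝓝[>] 0) (𝓝 (Q.spanPressure g)) := by
  have h := ((Q.antitone_spanRate g).antitoneOn (Ioi 0)).tendsto_nhdsGT (OrderTop.bddAbove _)
  rwa [sSup_image] at h

/-- `g` is `M_0^1`-continuous: bounded, and continuous on each element of `M_0^1`. -/
def IsPiecewiseContinuous (g : Q.PhaseSpace → ℝ) : Prop :=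
  (∃ C, ∀ x, |g x| ≤ C) ∧ ∀ A ∈ Q.domains 1, ContinuousOn g A

/-- `g` is `(M_0^1, α)`-Hölder: `α`-Hölder continuous on each element of `M_0^1`. -/
def IsPiecewiseHolder (α : ℝ) (g : Q.PhaseSpace → ℝ) : Prop :=
  ∀ A ∈ Q.domains 1, ∃ C, ∀ x ∈ A, ∀ y ∈ A, |g x - g y| ≤ C * Q.distance x y ^ α

end SinaiTable

end

noncomputable section

/-! Code a collision by its label, the translated scatterer that is hit next. Finite horizon leaves
finitely many labels, and on a connected set continuity of `T` amounts to constancy of the label.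
Hence the elements of the base partition are the connected components of the sets on which the
previous and the next label are fixed (`basePartition_eq`). The partition sums are
submultiplicative, and Fekete's lemma gives the limit P (`exists_pressure`).

The dynamics enters through one quantity, the pairing ⟨v - v', q - q'⟩ of two orbits that hit the
same obstacles. A flight raises it by the mean flight length times |v - v'|², and a reflection does
not lower it, because the scatterers are convex. A bounded two-sided sequence cannot grow like this
unless it vanishes, so two complete orbits with the same labels coincide. By compactness, orbit
segments with the same labels for a time 2k are close in the middle (`exists_expansive`). The
elements of the partition of length n + 2k, shifted by k, therefore have small Bowen diameter:
separated points occupy different elements, and one point per element spans. Both upper bounds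
follow.

For the lower bounds, Bowen-close orbits have the same labels and the same cells, except perhaps for
the cells at the two end times (`exists_cell_eq_of_bowenDistance`). Representatives of elements with
prescribed end cells are thus separated, and there are finitely many end cells; this gives
`le_sepPressure`. For a spanning set each representative is replaced by a close point of the set.
The Hölder bound controls the change of g at the times when neither orbit is in S_1. What remains
are the times adjacent to exactly grazing collisions. Two segments with the same labels that begin
and end with nearby grazing collisions coincide, again by the pairing (`eq_of_grazingClose`). So an
orbit with at least m + 2 inner grazing collisions is determined, up to a bounded choice and a
choice of time, by a segment of length at most n - m between the first two of them. The rest of the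
orbit contributes at most exp(sup g) per step; since sup g < P, orbits with a positive frequency of
grazing collisions are negligible (`le_spanPressure`).

All this needs the number of cells to be finite. Near a point of phase space the set with given
labels is cut out by graphs φ = c(r), the angles of the rays tangent to nearby obstacles. Forward
tangency graphs cross the level of the point downwards, backward ones upwards, and graphs of the
same kind are ordered on either side of the point according to the distances of the obstacles. This
makes the set locally connected (`exists_isPreconnected_wedge`), and compactness of the phase space
gives finiteness (`finite_range_cell`). -/

theorem inner_eq_re_im (w z : ℂ) : inner ℝ w z = w.re * z.re + w.im * z.im := by
  simp [Complex.inner, Complex.mul_re]; ring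

/-- The determinant of two vectors of the plane. -/
def cross (w z : ℂ) : ℝ := w.re * z.im - w.im * z.re

theorem exists_inner_eq (f : StrongDual ℝ ℂ) : ∃ m : ℂ, ∀ z, f z = inner ℝ m z :=
  ⟨(InnerProductSpace.toDual ℝ ℂ).symm f, fun z => by simp⟩

theorem sq_add_sq_of_norm_eq_one {z : ℂ} (h : ‖z‖ = 1) : z.re * z.re + z.im * z.im = 1 := by
  have := Complex.normSq_apply z
  rw [← this, Complex.normSq_eq_norm_sq, h, one_pow]

/-! ### Convex geometry of a single scatterer -/

namespace Scatterer

variable (S : Scatterer)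

/-- The outer unit normal at `S.curve s`. -/
def normalAt (s : ℝ) : ℂ := -Complex.I * deriv S.curve s

/-- The curvature at `S.curve s`. -/
def curvature (s : ℝ) : ℝ := ((starRingEnd ℂ) (deriv S.curve s) * deriv (deriv S.curve) s).im

theorem curvature_positive (s : ℝ) : 0 < S.curvature s := S.curvature_pos s

theorem contDiff_deriv : ContDiff ℝ 2 (deriv S.curve) :=
  ((contDiff_succ_iff_deriv (n := 2)).1 S.contDiff_curve).2.2

theorem hasStrictDerivAt_curve (s : ℝ) : HasStrictDerivAt S.curve (deriv S.curve s) s :=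
  S.contDiff_curve.contDiffAt.hasStrictDerivAt (by norm_num)

theorem hasDerivAt_curve (s : ℝ) : HasDerivAt S.curve (deriv S.curve s) s :=
  (S.hasStrictDerivAt_curve s).hasDerivAt

theorem hasStrictDerivAt_deriv (s : ℝ) :
    HasStrictDerivAt (deriv S.curve) (deriv (deriv S.curve) s) s :=
  S.contDiff_deriv.contDiffAt.hasStrictDerivAt (by norm_num)

theorem continuous_curve : Continuous S.curve := S.contDiff_curve.continuous

theorem continuous_deriv : Continuous (deriv S.curve) := S.contDiff_deriv.continuous

theorem continuous_normalAt : Continuous S.normalAt := continuous_const.mul S.continuous_deriv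

theorem deriv_sq (s : ℝ) : (deriv S.curve s).re * (deriv S.curve s).re +
    (deriv S.curve s).im * (deriv S.curve s).im = 1 :=
  sq_add_sq_of_norm_eq_one (S.norm_deriv_curve s)

theorem hasDerivAt_deriv_re (s : ℝ) :
    HasDerivAt (fun u => (deriv S.curve u).re) (deriv (deriv S.curve) s).re s :=
  Complex.reCLM.hasFDerivAt.comp_hasDerivAt s (S.hasStrictDerivAt_deriv s).hasDerivAt

theorem hasDerivAt_deriv_im (s : ℝ) :
    HasDerivAt (fun u => (deriv S.curve u).im) (deriv (deriv S.curve) s).im s :=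
  Complex.imCLM.hasFDerivAt.comp_hasDerivAt s (S.hasStrictDerivAt_deriv s).hasDerivAt

theorem hasDerivAt_curve_re (s : ℝ) :
    HasDerivAt (fun u => (S.curve u).re) (deriv S.curve s).re s :=
  Complex.reCLM.hasFDerivAt.comp_hasDerivAt s (S.hasDerivAt_curve s)

theorem hasDerivAt_curve_im (s : ℝ) :
    HasDerivAt (fun u => (S.curve u).im) (deriv S.curve s).im s :=
  Complex.imCLM.hasFDerivAt.comp_hasDerivAt s (S.hasDerivAt_curve s)

theorem deriv_inner_deriv_deriv (s : ℝ) :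
    (deriv S.curve s).re * (deriv (deriv S.curve) s).re +
      (deriv S.curve s).im * (deriv (deriv S.curve) s).im = 0 := by
  have h := ((S.hasDerivAt_deriv_re s).mul (S.hasDerivAt_deriv_re s)).add
    ((S.hasDerivAt_deriv_im s).mul (S.hasDerivAt_deriv_im s))
  have h2 : HasDerivAt (fun _ : ℝ => (1 : ℝ)) 0 s := hasDerivAt_const s 1
  have := h.unique (h2.congr_of_eventuallyEq (Eventually.of_forall fun u => S.deriv_sq u))
  linarith

theorem curvature_eq (s : ℝ) : S.curvature s =
    (deriv S.curve s).re * (deriv (deriv S.curve) s).im -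
      (deriv S.curve s).im * (deriv (deriv S.curve) s).re := by
  simp [curvature, Complex.mul_im]; ring

theorem deriv_deriv_re (s : ℝ) :
    (deriv (deriv S.curve) s).re = -S.curvature s * (deriv S.curve s).im := by
  rw [curvature_eq]
  linear_combination (-(deriv (deriv S.curve) s).re) * S.deriv_sq s +
    (deriv S.curve s).re * S.deriv_inner_deriv_deriv s

theorem deriv_deriv_im (s : ℝ) :
    (deriv (deriv S.curve) s).im = S.curvature s * (deriv S.curve s).re := by
  rw [curvature_eq]
  linear_combination (-(deriv (deriv S.curve) s).im) * S.deriv_sq s +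
    (deriv S.curve s).im * S.deriv_inner_deriv_deriv s

theorem normalAt_re (s : ℝ) : (S.normalAt s).re = (deriv S.curve s).im := by
  simp [normalAt]

theorem normalAt_im (s : ℝ) : (S.normalAt s).im = -(deriv S.curve s).re := by
  simp [normalAt]

theorem norm_normalAt (s : ℝ) : ‖S.normalAt s‖ = 1 := by
  simp [normalAt, S.norm_deriv_curve]

theorem normalAt_sq (s : ℝ) : (S.normalAt s).re * (S.normalAt s).re +
    (S.normalAt s).im * (S.normalAt s).im = 1 :=
  sq_add_sq_of_norm_eq_one (S.norm_normalAt s)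

theorem isClosed_body : IsClosed S.body := S.isCompact_body.isClosed

theorem convex_body : Convex ℝ S.body := S.strictConvex_body.convex

theorem curve_mem_frontier (s : ℝ) : S.curve s ∈ frontier S.body :=
  S.range_curve ▸ mem_range_self s

theorem curve_mem_body (s : ℝ) : S.curve s ∈ S.body :=
  S.isClosed_body.frontier_subset (S.curve_mem_frontier s)

theorem interior_nonempty : (interior S.body).Nonempty := by
  have h0 : S.curve 0 ≠ S.curve (S.len / 2) := fun h => by
    have := S.injOn_curve (by constructor <;> linarith [S.len_pos])
      (by constructor <;> linarith [S.len_pos]) h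
    linarith [S.len_pos]
  exact ⟨_, S.strictConvex_body (S.curve_mem_body 0) (S.curve_mem_body _) h0
    (a := 1 / 2) (b := 1 / 2) (by norm_num) (by norm_num) (by norm_num)⟩

theorem body_subset_closure_interior : S.body ⊆ closure (interior S.body) := by
  rw [S.convex_body.closure_interior_eq_closure_of_nonempty_interior S.interior_nonempty]
  exact subset_closure

/-- A supporting functional at a boundary point is a positive multiple of the outer normal. -/
theorem exists_eq_smul_normalAt {s : ℝ} {m : ℂ} (hm0 : m ≠ 0)
    (hm : ∀ z ∈ S.body, inner ℝ m (z - S.curve s) ≤ 0) :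
    ∃ c : ℝ, 0 < c ∧ m = (c : ℂ) * S.normalAt s := by
  have hm' : ∀ u, m.re * (S.curve u).re + m.im * (S.curve u).im ≤
      m.re * (S.curve s).re + m.im * (S.curve s).im := fun u => by
    have := hm _ (S.curve_mem_body u)
    rw [inner_eq_re_im] at this
    simp only [Complex.sub_re, Complex.sub_im] at this
    linarith
  set F : ℝ → ℝ := fun u => m.re * (S.curve u).re + m.im * (S.curve u).im with hF
  have hd : ∀ u, HasDerivAt F (m.re * (deriv S.curve u).re + m.im * (deriv S.curve u).im) u :=
    fun u => ((S.hasDerivAt_curve_re u).const_mul _).add ((S.hasDerivAt_curve_im u).const_mul _)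
  have hdF : deriv F = fun u => m.re * (deriv S.curve u).re + m.im * (deriv S.curve u).im :=
    funext fun u => (hd u).deriv
  have hmax : IsLocalMax F s := Eventually.of_forall hm'
  have h1 : m.re * (deriv S.curve s).re + m.im * (deriv S.curve s).im = 0 := by
    have := hmax.deriv_eq_zero; rwa [hdF] at this
  have h2 : deriv (deriv F) s =
      m.re * (deriv (deriv S.curve) s).re + m.im * (deriv (deriv S.curve) s).im := by
    rw [hdF]
    exact (((S.hasDerivAt_deriv_re s).const_mul _).add
      ((S.hasDerivAt_deriv_im s).const_mul _)).deriv
  rw [S.deriv_deriv_re, S.deriv_deriv_im] at h2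
  set c : ℝ := m.re * (deriv S.curve s).im - m.im * (deriv S.curve s).re with hc
  have hmc : m = (c : ℂ) * S.normalAt s := by
    apply Complex.ext
    · simp only [Complex.re_ofReal_mul, normalAt_re, hc]
      linear_combination (-m.re) * S.deriv_sq s + (deriv S.curve s).re * h1
    · simp only [Complex.im_ofReal_mul, normalAt_im, hc]
      linear_combination (-m.im) * S.deriv_sq s + (deriv S.curve s).im * h1
  refine ⟨c, ?_, hmc⟩
  by_contra hcn
  have hc0 : c ≠ 0 := fun h => hm0 (by rw [hmc, h]; simp)
  have hneg : c < 0 := lt_of_le_of_ne (not_lt.1 hcn) hc0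
  -- If c were negative, positive curvature would make the maximum s of F a local minimum as well,
  -- so F would be locally constant with vanishing second derivative.
  have hpos : 0 < deriv (deriv F) s := by
    have : deriv (deriv F) s = -c * S.curvature s := by rw [h2, hc]; ring
    rw [this]; exact mul_pos (by linarith) (S.curvature_positive s)
  have hmin : IsLocalMin F s := isLocalMin_of_deriv_deriv_pos hpos hmax.deriv_eq_zero
    (hd s).continuousAt
  have hconst : F =ᶠ[𝓝 s] fun _ => F s := by
    filter_upwards [hmax, hmin] with u h3 h4 using le_antisymm h3 h4
  have : deriv (deriv F) s = 0 := by
    rw [hconst.deriv.deriv_eq]; simp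
  linarith

/-- Hahn-Banach separates the boundary point from the interior, and the separating functional can
only be a positive multiple of the outer normal. -/
theorem inner_normalAt_le {s : ℝ} {z : ℂ} (hz : z ∈ S.body) :
    inner ℝ (S.normalAt s) (z - S.curve s) ≤ 0 := by
  obtain ⟨f, hf⟩ := geometric_hahn_banach_open_point S.convex_body.interior isOpen_interior
    (S.curve_mem_frontier s).2
  obtain ⟨m, hm⟩ := exists_inner_eq f
  have hle : ∀ w ∈ S.body, inner ℝ m (w - S.curve s) ≤ 0 := fun w hw => by
    have : f w ≤ f (S.curve s) :=
      closure_minimal (fun a ha => (hf a ha).le) (isClosed_le f.continuous continuous_const)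
        (S.body_subset_closure_interior hw)
    rw [inner_sub_right, ← hm, ← hm]; linarith
  have hm0 : m ≠ 0 := by
    rintro rfl
    obtain ⟨a, ha⟩ := S.interior_nonempty
    have := hf a ha
    simp [hm] at this
  obtain ⟨c, hc, rfl⟩ := S.exists_eq_smul_normalAt hm0 hle
  have := hle z hz
  rw [inner_eq_re_im] at this ⊢
  simp only [Complex.re_ofReal_mul, Complex.im_ofReal_mul] at this
  by_contra hcon
  have := mul_pos hc (not_le.1 hcon)
  nlinarith

/-- An interior point can be moved a little along the normal without leaving the body, so the weak
inequality has room to spare. -/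
theorem inner_normalAt_lt_of_interior {s : ℝ} {z : ℂ} (hz : z ∈ interior S.body) :
    inner ℝ (S.normalAt s) (z - S.curve s) < 0 := by
  have hc : Tendsto (fun ε : ℝ => z + ε * S.normalAt s) (𝓝[>] 0) (𝓝 z) := by
    have : Tendsto (fun ε : ℝ => z + ε * S.normalAt s) (𝓝 0) (𝓝 (z + (0 : ℝ) * S.normalAt s)) :=
      Continuous.tendsto (by fun_prop) 0
    simp only [Complex.ofReal_zero, zero_mul, add_zero] at this
    exact this.mono_left nhdsWithin_le_nhds
  obtain ⟨ε, h1, h2⟩ :=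
    ((hc.eventually (isOpen_interior.mem_nhds hz)).and self_mem_nhdsWithin).exists
  have h3 := S.inner_normalAt_le (s := s) (interior_subset h1)
  have h2 : (0 : ℝ) < ε := h2
  rw [inner_eq_re_im] at h3 ⊢
  simp only [Complex.sub_re, Complex.sub_im, Complex.add_re, Complex.add_im,
    Complex.re_ofReal_mul, Complex.im_ofReal_mul] at h3 ⊢
  nlinarith [S.normalAt_sq s]

/-- By strict convexity the midpoint of z and the boundary point is interior, where the inequality
is strict. -/
theorem inner_normalAt_lt {s : ℝ} {z : ℂ} (hz : z ∈ S.body) (hne : z ≠ S.curve s) :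
    inner ℝ (S.normalAt s) (z - S.curve s) < 0 := by
  have h := S.inner_normalAt_lt_of_interior (s := s) (S.strictConvex_body hz
    (S.curve_mem_body s) hne (a := 1 / 2) (b := 1 / 2) (by norm_num) (by norm_num) (by norm_num))
  rw [inner_eq_re_im] at h ⊢
  simp at h ⊢
  linarith

/-- A vector that points strictly to the inner side of the tangent line points into the body. -/
theorem exists_mem_interior_of_inner_neg {s : ℝ} {d : ℂ} (hd : inner ℝ (S.normalAt s) d < 0) :
    ∃ ε : ℝ, 0 < ε ∧ S.curve s + ε * d ∈ interior S.body := by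
  by_contra! hcon
  set R : Set ℂ := (fun ε : ℝ => S.curve s + ε * d) '' Ioi 0 with hR
  have hRc : Convex ℝ R := by
    rintro _ ⟨a, ha, rfl⟩ _ ⟨b, hb, rfl⟩ u v hu hv huv
    refine ⟨u * a + v * b, ?_, ?_⟩
    · exact (convex_Ioi (0 : ℝ)) ha hb hu hv huv
    · have : (u : ℂ) + v = 1 := by exact_mod_cast huv
      simp only [Complex.real_smul]; push_cast
      linear_combination (-S.curve s) * this
  have hdis : Disjoint (interior S.body) R := by
    rw [Set.disjoint_left]
    rintro _ h ⟨ε, hε, rfl⟩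
    exact hcon ε hε h
  -- A ray that avoids the interior would be separated from it by a functional that supports the
  -- body at the boundary point. Such a functional is a positive multiple of the normal, yet it
  -- would be nonnegative on d.
  obtain ⟨f, u, h1, h2⟩ := geometric_hahn_banach_open S.convex_body.interior isOpen_interior
    hRc hdis
  obtain ⟨m, hm⟩ := exists_inner_eq f
  have hbody : ∀ w ∈ S.body, f w ≤ u := fun w hw =>
    closure_minimal (fun a ha => (h1 a ha).le) (isClosed_le f.continuous continuous_const)
      (S.body_subset_closure_interior hw)
  have hray : ∀ ε : ℝ, 0 < ε → u ≤ f (S.curve s) + ε * f d := fun ε hε => by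
    have := h2 _ ⟨ε, hε, rfl⟩
    rwa [map_add, ← Complex.real_smul, map_smul, smul_eq_mul] at this
  have hu : u ≤ f (S.curve s) := by
    have : Tendsto (fun ε : ℝ => f (S.curve s) + ε * f d) (𝓝[>] 0)
        (𝓝 (f (S.curve s) + 0 * f d)) :=
      (Continuous.tendsto (by fun_prop) 0).mono_left nhdsWithin_le_nhds
    simp only [zero_mul, add_zero] at this
    exact ge_of_tendsto this (eventually_mem_nhdsWithin.mono fun ε hε => hray ε hε)
  have hus : f (S.curve s) = u := le_antisymm (hbody _ (S.curve_mem_body s)) hu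
  have hm0 : m ≠ 0 := by
    rintro rfl
    obtain ⟨a, ha⟩ := S.interior_nonempty
    have := h1 a ha
    simp [hm] at this hus
    linarith
  obtain ⟨c, hc, rfl⟩ := S.exists_eq_smul_normalAt (s := s) hm0 (fun w hw => by
    rw [inner_sub_right, ← hm, ← hm, hus]; linarith [hbody w hw])
  have h3 : 0 ≤ f d := by have := hray 1 one_pos; linarith
  rw [hm, inner_eq_re_im] at h3
  rw [inner_eq_re_im] at hd
  simp only [Complex.re_ofReal_mul, Complex.im_ofReal_mul] at h3
  nlinarith

theorem mem_interior_of_mem_of_ne {z w : ℂ} (hz : z ∈ S.body) (hw : w ∈ S.body) (hne : z ≠ w)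
    {a b : ℝ} (ha : 0 < a) (hb : 0 < b) (hab : a + b = 1) :
    (a : ℂ) * z + b * w ∈ interior S.body := by
  have := S.strictConvex_body hz hw hne ha hb hab
  rwa [Complex.real_smul, Complex.real_smul] at this

theorem continuous_point : Continuous S.point :=
  continuous_quot_lift _ S.continuous_curve

theorem continuous_tangent : Continuous S.tangent :=
  continuous_quot_lift _ S.continuous_deriv

theorem continuous_normal : Continuous S.normal := continuous_const.mul S.continuous_tangent

theorem point_injective : Function.Injective S.point := by
  have : Fact (0 < S.len) := ⟨S.len_pos⟩
  intro r r' h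
  obtain ⟨a, ha, rfl⟩ : ∃ a ∈ Ico 0 (0 + S.len), (a : AddCircle S.len) = r := by
    have := AddCircle.coe_image_Ico_eq S.len 0
    exact (this.symm ▸ mem_univ r : r ∈ _)
  obtain ⟨b, hb, rfl⟩ : ∃ b ∈ Ico 0 (0 + S.len), (b : AddCircle S.len) = r' := by
    have := AddCircle.coe_image_Ico_eq S.len 0
    exact (this.symm ▸ mem_univ r' : r' ∈ _)
  rw [zero_add] at ha hb
  rw [S.injOn_curve ha hb h]

theorem exists_coe (r : AddCircle S.len) : ∃ s : ℝ, (s : AddCircle S.len) = r :=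
  QuotientAddGroup.mk_surjective r

end Scatterer

/-! ### The lattice, phase space coordinates and time reversal -/

theorem latticeVector_add (m k : ℤ × ℤ) :
    latticeVector (m + k) = latticeVector m + latticeVector k := by
  simp [latticeVector]; ring

theorem latticeVector_zero : latticeVector 0 = 0 := by simp [latticeVector]

theorem latticeVector_neg (m : ℤ × ℤ) : latticeVector (-m) = -latticeVector m := by
  simp [latticeVector]; ring

theorem latticeVector_sub (m k : ℤ × ℤ) :
    latticeVector (m - k) = latticeVector m - latticeVector k := by
  simp [latticeVector]; ring

theorem latticeVector_re (m : ℤ × ℤ) : (latticeVector m).re = m.1 := by simp [latticeVector]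

theorem latticeVector_im (m : ℤ × ℤ) : (latticeVector m).im = m.2 := by simp [latticeVector]

theorem latticeVector_injective : Function.Injective latticeVector := by
  intro m k h
  have h1 := congrArg Complex.re h
  have h2 := congrArg Complex.im h
  simp only [latticeVector_re, latticeVector_im] at h1 h2
  exact Prod.ext (by exact_mod_cast h1) (by exact_mod_cast h2)

theorem finite_setOf_norm_latticeVector_le (R : ℝ) : {m | ‖latticeVector m‖ ≤ R}.Finite := by
  refine ((finite_Icc (-⌈R⌉) ⌈R⌉).prod (finite_Icc (-⌈R⌉) ⌈R⌉)).subset fun m hm => ?_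
  have h1 := abs_le.1 ((Complex.abs_re_le_norm _).trans hm)
  have h2 := abs_le.1 ((Complex.abs_im_le_norm _).trans hm)
  rw [latticeVector_re] at h1
  rw [latticeVector_im] at h2
  have hR := Int.le_ceil R
  refine ⟨⟨?_, ?_⟩, ⟨?_, ?_⟩⟩ <;> rw [← Int.cast_le (R := ℝ)] <;> push_cast <;> linarith

instance (S : Scatterer) : Fact (0 < S.len) := ⟨S.len_pos⟩

namespace SinaiTable

variable (Q : SinaiTable)

instance (i : Fin Q.D) : CompactSpace (Q.Cylinder i) :=
  (WithLp.homeomorphProd 2 _ _).symm.compactSpace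

instance : CompactSpace Q.PhaseSpace := inferInstanceAs (CompactSpace (Σ i, Q.Cylinder i))

variable {Q}

theorem continuous_fst_cylinder {i : Fin Q.D} : Continuous fun x : Q.Cylinder i => x.fst :=
  continuous_fst.comp (WithLp.prod_continuous_ofLp 2 _ _)

theorem continuous_snd_cylinder {i : Fin Q.D} : Continuous fun x : Q.Cylinder i => x.snd :=
  continuous_snd.comp (WithLp.prod_continuous_ofLp 2 _ _)

theorem continuous_position : Continuous Q.position := by
  refine continuous_sigma fun i => ?_
  have h := (Q.scatterer i).continuous_point.comp (continuous_fst_cylinder (i := i))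
  exact h

theorem continuous_normal : Continuous Q.normal := by
  refine continuous_sigma fun i => ?_
  have h := (Q.scatterer i).continuous_normal.comp (continuous_fst_cylinder (i := i))
  exact h

theorem continuous_angle : Continuous Q.angle :=
  continuous_sigma fun _ => continuous_subtype_val.comp continuous_snd_cylinder

theorem continuous_velocity : Continuous Q.velocity :=
  (Complex.continuous_exp.comp ((Complex.continuous_ofReal.comp continuous_angle).mul
    continuous_const)).mul continuous_normal

theorem continuous_index : Continuous (fun x : Q.PhaseSpace => x.1) :=
  continuous_sigma fun _ => continuous_const

theorem exists_arclength (x : Q.PhaseSpace) : ∃ s : ℝ, (s : AddCircle (Q.scatterer x.1).len) =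
    x.2.fst ∧ Q.position x = (Q.scatterer x.1).curve s ∧
    Q.normal x = (Q.scatterer x.1).normalAt s := by
  obtain ⟨s, hs⟩ := (Q.scatterer x.1).exists_coe x.2.fst
  exact ⟨s, hs, by rw [position, ← hs]; rfl, by rw [normal, ← hs]; rfl⟩

theorem position_mem_frontier (x : Q.PhaseSpace) :
    Q.position x ∈ frontier (Q.scatterer x.1).body := by
  obtain ⟨s, -, h, -⟩ := exists_arclength x
  exact h ▸ Scatterer.curve_mem_frontier _ s

theorem position_mem_body (x : Q.PhaseSpace) : Q.position x ∈ (Q.scatterer x.1).body :=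
  (Q.scatterer x.1).isClosed_body.frontier_subset (position_mem_frontier x)

theorem inner_normal_lt (x : Q.PhaseSpace) {z : ℂ} (hz : z ∈ (Q.scatterer x.1).body)
    (hne : z ≠ Q.position x) : inner ℝ (Q.normal x) (z - Q.position x) < 0 := by
  obtain ⟨s, -, h, h'⟩ := exists_arclength x
  rw [h] at hne
  rw [h, h']
  exact Scatterer.inner_normalAt_lt _ hz hne

theorem inner_normal_le (x : Q.PhaseSpace) {z : ℂ} (hz : z ∈ (Q.scatterer x.1).body) :
    inner ℝ (Q.normal x) (z - Q.position x) ≤ 0 := by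
  by_cases hne : z = Q.position x
  · simp [hne]
  · exact (inner_normal_lt x hz hne).le

theorem exists_mem_interior (x : Q.PhaseSpace) {d : ℂ} (hd : inner ℝ (Q.normal x) d < 0) :
    ∃ ε : ℝ, 0 < ε ∧ Q.position x + ε * d ∈ interior (Q.scatterer x.1).body := by
  obtain ⟨s, -, h, h'⟩ := exists_arclength x
  rw [h'] at hd
  rw [h]
  exact Scatterer.exists_mem_interior_of_inner_neg _ hd

theorem norm_normal (x : Q.PhaseSpace) : ‖Q.normal x‖ = 1 := by
  obtain ⟨s, -, -, h⟩ := exists_arclength x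
  rw [h, Scatterer.norm_normalAt]

theorem norm_velocity (x : Q.PhaseSpace) : ‖Q.velocity x‖ = 1 := by
  rw [velocity, norm_mul, norm_normal, Complex.norm_exp_ofReal_mul_I, one_mul]

theorem normal_sq (x : Q.PhaseSpace) : (Q.normal x).re * (Q.normal x).re +
    (Q.normal x).im * (Q.normal x).im = 1 := sq_add_sq_of_norm_eq_one (norm_normal x)

theorem velocity_sq (x : Q.PhaseSpace) : (Q.velocity x).re * (Q.velocity x).re +
    (Q.velocity x).im * (Q.velocity x).im = 1 := sq_add_sq_of_norm_eq_one (norm_velocity x)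

theorem velocity_ne_zero (x : Q.PhaseSpace) : Q.velocity x ≠ 0 := fun h => by
  simpa [h] using norm_velocity x

theorem velocity_re (x : Q.PhaseSpace) : (Q.velocity x).re =
    Real.cos (Q.angle x) * (Q.normal x).re - Real.sin (Q.angle x) * (Q.normal x).im := by
  simp [velocity, Complex.mul_re, Complex.exp_ofReal_mul_I_re, Complex.exp_ofReal_mul_I_im]

theorem velocity_im (x : Q.PhaseSpace) : (Q.velocity x).im =
    Real.cos (Q.angle x) * (Q.normal x).im + Real.sin (Q.angle x) * (Q.normal x).re := by
  simp [velocity, Complex.mul_im, Complex.exp_ofReal_mul_I_re, Complex.exp_ofReal_mul_I_im]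

theorem inner_velocity_normal (x : Q.PhaseSpace) :
    inner ℝ (Q.velocity x) (Q.normal x) = Real.cos (Q.angle x) := by
  rw [inner_eq_re_im, velocity_re, velocity_im]
  linear_combination Real.cos (Q.angle x) * normal_sq x

theorem cross_normal_velocity (x : Q.PhaseSpace) :
    cross (Q.normal x) (Q.velocity x) = Real.sin (Q.angle x) := by
  rw [cross, velocity_re, velocity_im]
  linear_combination Real.sin (Q.angle x) * normal_sq x

theorem angle_mem (x : Q.PhaseSpace) : Q.angle x ∈ Icc (-(Real.pi / 2)) (Real.pi / 2) :=
  x.2.snd.2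

theorem cos_angle_nonneg (x : Q.PhaseSpace) : 0 ≤ Real.cos (Q.angle x) :=
  Real.cos_nonneg_of_mem_Icc (angle_mem x)

theorem mem_grazingSet_iff (x : Q.PhaseSpace) :
    x ∈ Q.grazingSet ↔ Real.cos (Q.angle x) = 0 := by
  have h := angle_mem x
  constructor
  · intro hx
    change |Q.angle x| = _ at hx
    rw [← Real.cos_abs, hx, Real.cos_pi_div_two]
  · intro hx
    change |Q.angle x| = _
    by_contra hne
    have hlt : |Q.angle x| < Real.pi / 2 := lt_of_le_of_ne (abs_le.2 h) hne
    have := Real.cos_pos_of_mem_Ioo (abs_lt.1 hlt)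
    exact this.ne' hx

/-- The position determines r, and sin φ is the determinant of normal and velocity, which determines
φ because the sine is injective on [-π/2, π/2]. -/
theorem phaseSpace_ext {x y : Q.PhaseSpace} (h1 : x.1 = y.1) (h2 : Q.position x = Q.position y)
    (h3 : Q.velocity x = Q.velocity y) : x = y := by
  have hs := cross_normal_velocity x
  have hs' := cross_normal_velocity y
  obtain ⟨i, a⟩ := x
  obtain ⟨j, b⟩ := y
  obtain rfl : i = j := h1
  have hr : a.fst = b.fst := (Q.scatterer i).point_injective h2
  have hn : Q.normal ⟨i, a⟩ = Q.normal ⟨i, b⟩ := by simp only [normal, hr]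
  rw [hn, h3, hs'] at hs
  have hφ : a.snd = b.snd := Subtype.ext
    (Real.injOn_sin (angle_mem ⟨i, a⟩) (angle_mem ⟨i, b⟩) hs.symm)
  have : a = b := (WithLp.equiv 2 _).injective (Prod.ext hr hφ)
  rw [this]

/-- The point of the phase space with given coordinates. -/
def phasePoint (i : Fin Q.D) (r : AddCircle (Q.scatterer i).len)
    (φ : Icc (-(Real.pi / 2)) (Real.pi / 2)) : Q.PhaseSpace := ⟨i, WithLp.toLp 2 (r, φ)⟩

/-- The angle is recovered as the arcsine of the determinant of normal and velocity; the outward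
condition selects the nonnegative cosine. -/
theorem exists_position_velocity (i : Fin Q.D) {z v : ℂ}
    (hz : z ∈ frontier (Q.scatterer i).body) (hv : ‖v‖ = 1)
    (hn : ∀ x : Q.PhaseSpace, x.1 = i → Q.position x = z → 0 ≤ inner ℝ v (Q.normal x)) :
    ∃ x : Q.PhaseSpace, x.1 = i ∧ Q.position x = z ∧ Q.velocity x = v := by
  rw [← (Q.scatterer i).range_curve] at hz
  obtain ⟨s, rfl⟩ := hz
  have h0 : (0 : ℝ) ∈ Icc (-(Real.pi / 2)) (Real.pi / 2) := by
    constructor <;> linarith [Real.pi_pos]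
  have h1 := hn (phasePoint i s ⟨0, h0⟩) rfl rfl
  set n := (Q.scatterer i).normalAt s with hnn
  change 0 ≤ inner ℝ v n at h1
  have hnsq := (Q.scatterer i).normalAt_sq s
  rw [← hnn] at hnsq
  have hvsq := sq_add_sq_of_norm_eq_one hv
  have hsum : inner ℝ v n ^ 2 + cross n v ^ 2 = 1 := by
    rw [inner_eq_re_im, cross]
    linear_combination (n.re * n.re + n.im * n.im) * hvsq + hnsq
  have hcos : Real.cos (Real.arcsin (cross n v)) = inner ℝ v n := by
    rw [Real.cos_arcsin, show 1 - cross n v ^ 2 = inner ℝ v n ^ 2 by linarith, Real.sqrt_sq h1]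
  have hsin : Real.sin (Real.arcsin (cross n v)) = cross n v :=
    Real.sin_arcsin (by nlinarith) (by nlinarith)
  refine ⟨phasePoint i s ⟨Real.arcsin (cross n v), Real.arcsin_mem_Icc _⟩, rfl, rfl, ?_⟩
  apply Complex.ext
  · rw [velocity_re]
    change Real.cos (Real.arcsin _) * n.re - Real.sin (Real.arcsin _) * n.im = _
    rw [hcos, hsin, inner_eq_re_im, cross]
    linear_combination v.re * hnsq
  · rw [velocity_im]
    change Real.cos (Real.arcsin _) * n.im + Real.sin (Real.arcsin _) * n.re = _
    rw [hcos, hsin, inner_eq_re_im, cross]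
    linear_combination v.im * hnsq

/-- The time reversal `(r, φ) ↦ (r, -φ)`. -/
def flip (x : Q.PhaseSpace) : Q.PhaseSpace :=
  phasePoint x.1 x.2.fst ⟨-x.2.snd, by have := x.2.snd.2; constructor <;> linarith [this.1, this.2]⟩

theorem position_flip (x : Q.PhaseSpace) : Q.position (flip x) = Q.position x := rfl

theorem normal_flip (x : Q.PhaseSpace) : Q.normal (flip x) = Q.normal x := rfl

theorem angle_flip (x : Q.PhaseSpace) : Q.angle (flip x) = -Q.angle x := rfl

/-- The right side is the opposite of the velocity just before the collision, so `flip` sends a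
particle back along the path by which it came. -/
theorem velocity_flip (x : Q.PhaseSpace) : Q.velocity (flip x) =
    -(Q.velocity x - ((2 * inner ℝ (Q.velocity x) (Q.normal x) : ℝ) : ℂ) * Q.normal x) := by
  rw [inner_velocity_normal]
  apply Complex.ext
  · rw [Complex.neg_re, Complex.sub_re, Complex.re_ofReal_mul, velocity_re, velocity_re,
      angle_flip, normal_flip, Real.cos_neg, Real.sin_neg]; ring
  · rw [Complex.neg_im, Complex.sub_im, Complex.im_ofReal_mul, velocity_im, velocity_im,
      angle_flip, normal_flip, Real.cos_neg, Real.sin_neg]; ring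

theorem flip_flip (x : Q.PhaseSpace) : flip (flip x) = x := by
  refine phaseSpace_ext rfl rfl ?_
  rw [velocity, velocity, angle_flip, angle_flip, neg_neg, normal_flip, normal_flip]

theorem flip_injective : Function.Injective (flip (Q := Q)) :=
  Function.LeftInverse.injective flip_flip

theorem continuous_phasePoint (i : Fin Q.D) : Continuous fun p : AddCircle (Q.scatterer i).len ×
    Icc (-(Real.pi / 2)) (Real.pi / 2) => phasePoint i p.1 p.2 :=
  continuous_sigmaMk.comp (WithLp.prod_continuous_toLp 2 _ _)

theorem continuous_flip : Continuous (flip (Q := Q)) :=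
  continuous_sigma fun i => (continuous_phasePoint i).comp (continuous_fst_cylinder.prodMk
    ((continuous_subtype_val.comp continuous_snd_cylinder).neg.subtype_mk _))

/-! ### Obstacles: the translates of the scatterers in the plane -/

variable (Q) in
/-- The obstacle with label `κ = (j, m)`: the translate of the scatterer `j` by `m`. -/
def obstacle (κ : Fin Q.D × (ℤ × ℤ)) : Set ℂ :=
  {z | z - latticeVector κ.2 ∈ (Q.scatterer κ.1).body}

theorem mem_obstacle {κ : Fin Q.D × (ℤ × ℤ)} {z : ℂ} :
    z ∈ Q.obstacle κ ↔ z - latticeVector κ.2 ∈ (Q.scatterer κ.1).body := Iff.rfl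

theorem isClosed_obstacle (κ : Fin Q.D × (ℤ × ℤ)) : IsClosed (Q.obstacle κ) :=
  (Q.scatterer κ.1).isClosed_body.preimage (continuous_id.sub continuous_const)

theorem obstacle_eq_image (κ : Fin Q.D × (ℤ × ℤ)) : Q.obstacle κ =
    (fun z => z + latticeVector κ.2) '' (Q.scatterer κ.1).body := by
  ext z
  constructor
  · intro h
    exact ⟨_, h, sub_add_cancel _ _⟩
  · rintro ⟨w, hw, rfl⟩
    rw [mem_obstacle]
    simpa using hw

theorem isCompact_obstacle (κ : Fin Q.D × (ℤ × ℤ)) : IsCompact (Q.obstacle κ) := by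
  rw [obstacle_eq_image]
  exact (Q.scatterer κ.1).isCompact_body.image (continuous_id.add continuous_const)

theorem mem_interior_obstacle {κ : Fin Q.D × (ℤ × ℤ)} {z : ℂ} :
    z ∈ interior (Q.obstacle κ) ↔ z - latticeVector κ.2 ∈ interior (Q.scatterer κ.1).body := by
  have : Q.obstacle κ = (Homeomorph.subRight (latticeVector κ.2)) ⁻¹'
      (Q.scatterer κ.1).body := rfl
  rw [this, ← Homeomorph.preimage_interior]
  rfl

theorem strictConvex_obstacle (κ : Fin Q.D × (ℤ × ℤ)) : StrictConvex ℝ (Q.obstacle κ) := by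
  have : Q.obstacle κ = (fun z => z + -latticeVector κ.2) ⁻¹' (Q.scatterer κ.1).body := by
    ext z; simp [obstacle, sub_eq_add_neg]
  rw [this]
  exact (Q.scatterer κ.1).strictConvex_body.preimage_add_left _

theorem disjoint_obstacle {κ κ' : Fin Q.D × (ℤ × ℤ)} (h : κ ≠ κ') :
    Disjoint (Q.obstacle κ) (Q.obstacle κ') := by
  rw [Set.disjoint_left]
  intro z h1 h2
  have hd := Q.disjoint_scatterer κ.1 κ'.1 (κ'.2 - κ.2) (by
    by_contra! hcon
    exact h (Prod.ext hcon.1 (sub_eq_zero.1 hcon.2).symm))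
  refine Set.disjoint_left.1 hd h1 ⟨_, h2, ?_⟩
  change z - latticeVector κ'.2 + latticeVector (κ'.2 - κ.2) = _
  rw [latticeVector_sub]; ring

theorem obstacle_add {κ : Fin Q.D × (ℤ × ℤ)} {z : ℂ} (m : ℤ × ℤ) :
    z + latticeVector m ∈ Q.obstacle (κ.1, κ.2 + m) ↔ z ∈ Q.obstacle κ := by
  rw [mem_obstacle, mem_obstacle, latticeVector_add, show z + latticeVector m - (latticeVector κ.2 + latticeVector m) =
    z - latticeVector κ.2 by ring]

theorem interior_obstacle_add {κ : Fin Q.D × (ℤ × ℤ)} {z : ℂ} (m : ℤ × ℤ) :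
    z + latticeVector m ∈ interior (Q.obstacle (κ.1, κ.2 + m)) ↔
      z ∈ interior (Q.obstacle κ) := by
  rw [mem_interior_obstacle, mem_interior_obstacle, latticeVector_add,
    show z + latticeVector m - (latticeVector κ.2 + latticeVector m) =
    z - latticeVector κ.2 by ring]

theorem position_mem_obstacle (x : Q.PhaseSpace) : Q.position x ∈ Q.obstacle (x.1, 0) := by
  rw [mem_obstacle, latticeVector_zero, sub_zero]
  exact position_mem_body x

theorem position_add_mem_obstacle (x : Q.PhaseSpace) (m : ℤ × ℤ) :
    Q.position x + latticeVector m ∈ Q.obstacle (x.1, m) := by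
  rw [mem_obstacle, add_sub_cancel_right]
  exact position_mem_body x

/-- A particle that leaves a scatterer never meets the same obstacle again. -/
theorem ray_notMem_start (x : Q.PhaseSpace) {t : ℝ} (ht : 0 < t) :
    Q.position x + t * Q.velocity x ∉ Q.obstacle (x.1, 0) := by
  intro h
  rw [mem_obstacle, latticeVector_zero, sub_zero] at h
  have h1 := inner_normal_lt x h (fun h' => by
    have : (t : ℂ) * Q.velocity x = 0 := by linear_combination h'
    rcases mul_eq_zero.1 this with h2 | h2
    · exact ht.ne' (by exact_mod_cast h2)
    · exact velocity_ne_zero x h2)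
  rw [add_sub_cancel_left] at h1
  have h2 := inner_velocity_normal x
  have h3 := mul_nonneg ht.le (cos_angle_nonneg x)
  rw [← h2] at h3
  rw [inner_eq_re_im] at h1 h3
  simp only [Complex.re_ofReal_mul, Complex.im_ofReal_mul] at h1
  linarith

theorem exists_norm_obstacle_bound (Q : SinaiTable) : ∃ R : ℝ, 0 < R ∧
    ∀ (i : Fin Q.D), ∀ z ∈ (Q.scatterer i).body, ‖z‖ ≤ R := by
  have : ∀ i : Fin Q.D, ∃ R : ℝ, ∀ z ∈ (Q.scatterer i).body, ‖z‖ ≤ R := fun i =>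
    (Q.scatterer i).isCompact_body.isBounded.exists_norm_le
  choose R hR using this
  refine ⟨1 + ∑ i, |R i|, by positivity, fun i z hz => ?_⟩
  have := Finset.single_le_sum (f := fun i => |R i|) (fun _ _ => abs_nonneg _)
    (Finset.mem_univ i)
  have h2 := hR i z hz
  have h3 := le_abs_self (R i)
  linarith

/-- Only finitely many obstacles meet a bounded set. -/
theorem finite_obstacle_meets (Q : SinaiTable) (R : ℝ) :
    {κ | ∃ z ∈ Q.obstacle κ, ‖z‖ ≤ R}.Finite := by
  obtain ⟨R', -, hR'⟩ := Q.exists_norm_obstacle_bound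
  refine ((finite_univ (α := Fin Q.D)).prod
    (finite_setOf_norm_latticeVector_le (R + R'))).subset ?_
  rintro κ ⟨z, hz, hzR⟩
  refine ⟨mem_univ _, ?_⟩
  have h1 := hR' _ _ hz
  have h2 := norm_sub_le z (z - latticeVector κ.2)
  rw [sub_sub_cancel] at h2
  change ‖_‖ ≤ _
  linarith

end SinaiTable

/-! ### Limits along ultrafilters -/

theorem Ultrafilter.exists_tendsto_of_isCompact {α X : Type*} [TopologicalSpace X]
    (𝒰 : Ultrafilter α) {f : α → X} {K : Set X} (hK : IsCompact K) (h : ∀ᶠ a in 𝒰, f a ∈ K) :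
    ∃ x ∈ K, Tendsto f 𝒰 (𝓝 x) :=
  hK.ultrafilter_le_nhds' (𝒰.map f) h

theorem Ultrafilter.exists_tendsto {α X : Type*} [TopologicalSpace X] [CompactSpace X]
    (𝒰 : Ultrafilter α) (f : α → X) : ∃ x, Tendsto f 𝒰 (𝓝 x) := by
  obtain ⟨x, -, h⟩ := 𝒰.exists_tendsto_of_isCompact (f := f) isCompact_univ
    (Eventually.of_forall fun _ => mem_univ _)
  exact ⟨x, h⟩

theorem Ultrafilter.exists_eventually_eq {α β : Type*} (𝒰 : Ultrafilter α) {f : α → β}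
    {s : Set β} (hs : s.Finite) (h : ∀ᶠ a in 𝒰, f a ∈ s) : ∃ c ∈ s, ∀ᶠ a in 𝒰, f a = c := by
  rw [← Ultrafilter.eventually_exists_mem_iff hs]
  filter_upwards [h] with a ha using ⟨_, ha, rfl⟩

theorem tendsto_inv_hyperfilter {f : ℕ → ℝ} (h0 : ∀ n, 0 ≤ f n) (h : ∀ n : ℕ, f n ≤ 1 / (n + 1)) :
    Tendsto f (hyperfilter ℕ) (𝓝 0) := by
  have : Tendsto f atTop (𝓝 0) :=
    squeeze_zero h0 h tendsto_one_div_add_atTop_nhds_zero_nat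
  exact this.mono_left Nat.hyperfilter_le_atTop

/-! ### Free flights; existence and invertibility of the billiard map -/

namespace SinaiTable

variable {Q : SinaiTable}

/-- Otherwise there are arbitrarily long segments that avoid the interiors. Their midpoints, moved
to a bounded region by lattice translations, and their directions accumulate at a full line that
avoids all interiors, against finite horizon. -/
theorem exists_maxFlight (hQ : Q.FiniteHorizon) : ∃ τ : ℝ, 0 < τ ∧ ∀ p v : ℂ, ‖v‖ = 1 →
    ∃ s ∈ Ioo 0 τ, ∃ κ, p + s * v ∈ interior (Q.obstacle κ) := by
  by_contra! hcon
  have hex : ∀ n : ℕ, ∃ p v : ℂ, ‖v‖ = 1 ∧ ∀ s ∈ Ioo (0 : ℝ) (2 * (n + 1)), ∀ κ,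
      p + s * v ∉ interior (Q.obstacle κ) := fun n => hcon _ (by positivity)
  choose p v hv hpv using hex
  -- The midpoint of the segment, so that the limit line is free in both directions.
  set q : ℕ → ℂ := fun n => p n + ((n + 1 : ℝ) : ℂ) * v n with hq
  set c : ℕ → ℂ := fun n => q n - latticeVector (⌊(q n).re⌋, ⌊(q n).im⌋) with hc
  have hcb : ∀ n, c n ∈ Metric.closedBall (0 : ℂ) 2 := fun n => by
    rw [mem_closedBall_zero_iff]
    have h1 : (c n).re = Int.fract (q n).re := by
      simp [hc, latticeVector_re]
    have h2 : (c n).im = Int.fract (q n).im := by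
      simp [hc, latticeVector_im]
    have h3 := Complex.norm_le_abs_re_add_abs_im (c n)
    rw [h1, h2, Int.abs_fract, Int.abs_fract] at h3
    linarith [Int.fract_lt_one (q n).re, Int.fract_lt_one (q n).im]
  obtain ⟨C, -, hC⟩ := (hyperfilter ℕ).exists_tendsto_of_isCompact
    (isCompact_closedBall (0 : ℂ) 2) (Eventually.of_forall hcb)
  obtain ⟨V, hV1, hV⟩ := (hyperfilter ℕ).exists_tendsto_of_isCompact (f := v)
    (isCompact_sphere (0 : ℂ) 1) (Eventually.of_forall fun n => by simpa using hv n)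
  have hV0 : V ≠ 0 := by
    rintro rfl
    simp at hV1
  obtain ⟨t, i, m, h⟩ := hQ C V hV0
  have h : C + t * V ∈ interior (Q.obstacle (i, m)) := mem_interior_obstacle.2 h
  have hlim : Tendsto (fun n => c n + t * v n) (hyperfilter ℕ) (𝓝 (C + t * V)) :=
    hC.add (hV.const_mul _)
  have hbig : ∀ᶠ n : ℕ in hyperfilter ℕ, |t| < n :=
    Nat.hyperfilter_le_atTop (tendsto_natCast_atTop_atTop.eventually_gt_atTop |t|)
  obtain ⟨n, h1, h2⟩ := ((hlim.eventually (isOpen_interior.mem_nhds h)).and hbig).exists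
  have h3 := abs_lt.1 h2
  have h4 := (interior_obstacle_add (⌊(q n).re⌋, ⌊(q n).im⌋)).2 h1
  refine hpv n (n + 1 + t) ⟨by linarith, by linarith⟩ _ (Set.mem_of_eq_of_mem ?_ h4)
  simp only [hc, hq]
  push_cast
  ring

/-- A sequence of obstacles approaching collision points of other obstacles would, since only
finitely many obstacles meet a bounded set, give in the limit a common point of two disjoint
obstacles. -/
theorem exists_minFlight (Q : SinaiTable) : ∃ τ : ℝ, 0 < τ ∧ ∀ (x : Q.PhaseSpace) (κ),
    κ ≠ (x.1, 0) → ∀ w ∈ Q.obstacle κ, τ ≤ ‖w - Q.position x‖ := by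
  by_contra! hcon
  have hex : ∀ n : ℕ, ∃ (x : Q.PhaseSpace) (κ : _), κ ≠ (x.1, 0) ∧ ∃ w ∈ Q.obstacle κ,
    ‖w - Q.position x‖ < 1 / (n + 1) := fun n => hcon _ (by positivity)
  choose x κ hκ w hw hn using hex
  obtain ⟨X, hX⟩ := (hyperfilter ℕ).exists_tendsto x
  have hdiff : Tendsto (fun n => w n - Q.position (x n)) (hyperfilter ℕ) (𝓝 0) := by
    rw [tendsto_zero_iff_norm_tendsto_zero]
    exact tendsto_inv_hyperfilter (fun n => norm_nonneg _) fun n => (hn n).le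
  have hpos := (continuous_position.tendsto X).comp hX
  have hw' : Tendsto w (hyperfilter ℕ) (𝓝 (Q.position X)) := by
    have := hdiff.add hpos
    simpa using this
  obtain ⟨R, -, hR⟩ := Q.exists_norm_obstacle_bound
  obtain ⟨k, -, hk⟩ := (hyperfilter ℕ).exists_eventually_eq (f := κ)
    (Q.finite_obstacle_meets (R + 1)) (Eventually.of_forall fun n => ⟨w n, hw n, by
      have h1 := hR _ _ (position_mem_body (x n))
      have h2 := norm_sub_norm_le (w n) (Q.position (x n))
      have h3 : (1 : ℝ) / (n + 1) ≤ 1 := by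
        rw [div_le_one (by positivity)]; linarith [Nat.cast_nonneg (α := ℝ) n]
      linarith [hn n]⟩)
  have hkm : Q.position X ∈ Q.obstacle k := (isClosed_obstacle k).mem_of_tendsto hw'
    (hk.mono fun n h => h ▸ hw n)
  have hidx : ∀ᶠ n in hyperfilter ℕ, (x n).1 = X.1 :=
    ((continuous_index.tendsto X).comp hX).eventually (by simp : ∀ᶠ i in 𝓝 X.1, i = X.1)
  obtain ⟨n, h1, h2⟩ := (hk.and hidx).exists
  exact Set.disjoint_left.1 (disjoint_obstacle (h1 ▸ h2 ▸ hκ n)) hkm (position_mem_obstacle X)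

/-- A lower bound for the length of a free flight. -/
def minFlight (Q : SinaiTable) : ℝ := Q.exists_minFlight.choose

theorem minFlight_pos : 0 < Q.minFlight := Q.exists_minFlight.choose_spec.1

theorem minFlight_le {x : Q.PhaseSpace} {κ : Fin Q.D × (ℤ × ℤ)} (hκ : κ ≠ (x.1, 0)) {w : ℂ}
    (hw : w ∈ Q.obstacle κ) : Q.minFlight ≤ ‖w - Q.position x‖ :=
  Q.exists_minFlight.choose_spec.2 x κ hκ w hw

/-- The first obstacle that a particle leaving `x` meets is `κ`, and this happens at time `t`. -/
def FirstHit (x : Q.PhaseSpace) (κ : Fin Q.D × (ℤ × ℤ)) (t : ℝ) : Prop :=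
  0 < t ∧ Q.position x + t * Q.velocity x ∈ Q.obstacle κ ∧
    ∀ s ∈ Ioo 0 t, ∀ κ', Q.position x + s * Q.velocity x ∉ Q.obstacle κ'

theorem norm_ray_sub (x : Q.PhaseSpace) {t : ℝ} (ht : 0 ≤ t) :
    ‖Q.position x + t * Q.velocity x - Q.position x‖ = t := by
  rw [add_sub_cancel_left, norm_mul, norm_velocity, mul_one, Complex.norm_real,
    Real.norm_of_nonneg ht]

theorem minFlight_le_of_mem {x : Q.PhaseSpace} {κ : Fin Q.D × (ℤ × ℤ)} {t : ℝ} (ht : 0 < t)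
    (h : Q.position x + t * Q.velocity x ∈ Q.obstacle κ) : Q.minFlight ≤ t := by
  have h1 := minFlight_le (x := x) (κ := κ) (fun hκ => ray_notMem_start x ht (hκ ▸ h)) h
  rwa [norm_ray_sub x ht.le] at h1

/-- The hit times up to the horizon form a nonempty compact set: finitely many closed obstacles are
involved, and the lower bound on flights keeps the times away from 0. The least one is the first
hit. -/
theorem exists_firstHit (hQ : Q.FiniteHorizon) (x : Q.PhaseSpace) : ∃ κ t, FirstHit x κ t := by
  obtain ⟨τ, hτ, h⟩ := exists_maxFlight hQ
  obtain ⟨s, hs, κ, hκ⟩ := h (Q.position x) (Q.velocity x) (norm_velocity x)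
  obtain ⟨R, hR0, hR⟩ := Q.exists_norm_obstacle_bound
  set F : Set (Fin Q.D × (ℤ × ℤ)) := {κ | ∃ z ∈ Q.obstacle κ, ‖z‖ ≤ R + τ} with hF
  have hFfin : F.Finite := Q.finite_obstacle_meets _
  have hray : ∀ t ∈ Icc 0 τ, ‖Q.position x + t * Q.velocity x‖ ≤ R + τ := fun t ht => by
    refine (norm_add_le _ _).trans (add_le_add (hR _ _ (position_mem_body x)) ?_)
    rw [norm_mul, norm_velocity, mul_one, Complex.norm_real, Real.norm_of_nonneg ht.1]
    exact ht.2
  have hcont : Continuous fun t : ℝ => Q.position x + t * Q.velocity x := by fun_prop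
  set H : Set ℝ := Icc Q.minFlight τ ∩
    ⋃ κ ∈ F, (fun t : ℝ => Q.position x + t * Q.velocity x) ⁻¹' Q.obstacle κ with hH
  have hHc : IsCompact H := isCompact_Icc.inter_right
    (hFfin.isClosed_biUnion fun κ _ => (isClosed_obstacle κ).preimage hcont)
  have hmem : ∀ t ∈ Ioc 0 τ, ∀ κ, Q.position x + t * Q.velocity x ∈ Q.obstacle κ → t ∈ H :=
    fun t ht κ hκ => ⟨⟨minFlight_le_of_mem ht.1 hκ, ht.2⟩,
      mem_biUnion (x := κ) ⟨_, hκ, hray t ⟨ht.1.le, ht.2⟩⟩ hκ⟩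
  obtain ⟨t, htH, hmin⟩ := hHc.exists_isLeast
    ⟨s, hmem s ⟨hs.1, hs.2.le⟩ κ (interior_subset hκ)⟩
  obtain ⟨κ', -, hκ'⟩ := mem_iUnion₂.1 htH.2
  have ht0 : 0 < t := minFlight_pos.trans_le htH.1.1
  refine ⟨κ', t, ht0, hκ', fun u hu k hk => ?_⟩
  exact absurd (hmin (hmem u ⟨hu.1, hu.2.le.trans htH.1.2⟩ k hk)) (not_le.2 hu.2)

theorem FirstHit.unique {x : Q.PhaseSpace} {κ κ' : Fin Q.D × (ℤ × ℤ)} {t t' : ℝ}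
    (h : FirstHit x κ t) (h' : FirstHit x κ' t') : κ = κ' ∧ t = t' := by
  have ht : t = t' := by
    rcases lt_trichotomy t t' with hlt | heq | hgt
    · exact absurd h.2.1 (h'.2.2 t ⟨h.1, hlt⟩ κ)
    · exact heq
    · exact absurd h'.2.1 (h.2.2 t' ⟨h'.1, hgt⟩ κ')
  subst ht
  refine ⟨?_, rfl⟩
  by_contra hne
  exact Set.disjoint_left.1 (disjoint_obstacle hne) h.2.1 h'.2.1

/-- The collision `y` follows the collision `x`, after a flight of length `t` that ends on the
translate by `m` of the scatterer of `y`. -/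
def Collision (x y : Q.PhaseSpace) (t : ℝ) (m : ℤ × ℤ) : Prop :=
  0 < t ∧ Q.position x + t * Q.velocity x = Q.position y + latticeVector m ∧
    (∀ s ∈ Ioo 0 t, ∀ κ, Q.position x + s * Q.velocity x ∉ Q.obstacle κ) ∧
    Q.velocity y =
      Q.velocity x - ((2 * inner ℝ (Q.velocity x) (Q.normal y) : ℝ) : ℂ) * Q.normal y

theorem isNextCollision_iff {x y : Q.PhaseSpace} :
    Q.IsNextCollision x y ↔ ∃ t m, Collision x y t m :=
  ⟨fun ⟨t, m, h0, h1, h2, h3⟩ => ⟨t, m, h0, h1, fun s hs κ => h2 s hs κ.1 κ.2, h3⟩,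
    fun ⟨t, m, h0, h1, h2, h3⟩ => ⟨t, m, h0, h1, fun s hs j k => h2 s hs (j, k), h3⟩⟩

theorem Collision.firstHit {x y : Q.PhaseSpace} {t : ℝ} {m : ℤ × ℤ} (h : Collision x y t m) :
    FirstHit x (y.1, m) t :=
  ⟨h.1, h.2.1 ▸ position_add_mem_obstacle y m, h.2.2.1⟩

theorem normal_congr {x y : Q.PhaseSpace} (h1 : x.1 = y.1) (h2 : Q.position x = Q.position y) :
    Q.normal x = Q.normal y := by
  obtain ⟨i, a⟩ := x
  obtain ⟨j, b⟩ := y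
  obtain rfl : i = j := h1
  have hr : a.fst = b.fst := (Q.scatterer i).point_injective h2
  simp only [normal, hr]

theorem Collision.unique {x y y' : Q.PhaseSpace} {t t' : ℝ} {m m' : ℤ × ℤ}
    (h : Collision x y t m) (h' : Collision x y' t' m') : y = y' ∧ t = t' ∧ m = m' := by
  obtain ⟨h1, rfl⟩ := h.firstHit.unique h'.firstHit
  obtain ⟨h2, rfl⟩ := Prod.ext_iff.1 h1
  have hp : Q.position y = Q.position y' := by
    have := h.2.1.symm.trans h'.2.1
    exact add_right_cancel this
  refine ⟨phaseSpace_ext h2 hp ?_, rfl, rfl⟩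
  rw [h.2.2.2, h'.2.2.2, normal_congr h2 hp]

/-- At a first hit the particle comes from outside, so the contact point is on the boundary and the
velocity does not point outwards; its reflection does not point inwards and is the velocity of a
phase point. -/
theorem FirstHit.exists_collision {x : Q.PhaseSpace} {κ : Fin Q.D × (ℤ × ℤ)} {t : ℝ}
    (h : FirstHit x κ t) : ∃ y : Q.PhaseSpace, y.1 = κ.1 ∧ Collision x y t κ.2 := by
  set z := Q.position x + t * Q.velocity x - latticeVector κ.2 with hz
  have hzm : z ∈ (Q.scatterer κ.1).body := h.2.1
  have hback : ∀ ε : ℝ, 0 < ε → ε < t → z + ε * -Q.velocity x ∉ (Q.scatterer κ.1).body := by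
    intro ε hε hεt hmem
    refine h.2.2 (t - ε) ⟨by linarith, by linarith⟩ κ ?_
    rw [mem_obstacle]
    convert hmem using 1
    rw [hz]; push_cast; ring
  have hfr : z ∈ frontier (Q.scatterer κ.1).body := by
    rw [(Q.scatterer κ.1).isClosed_body.frontier_eq]
    refine ⟨hzm, fun hint => ?_⟩
    have hc : Tendsto (fun ε : ℝ => z + ε * -Q.velocity x) (𝓝[>] 0) (𝓝 z) := by
      have : Tendsto (fun ε : ℝ => z + ε * -Q.velocity x) (𝓝 0)
          (𝓝 (z + (0 : ℝ) * -Q.velocity x)) := Continuous.tendsto (by fun_prop) 0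
      simp only [Complex.ofReal_zero, zero_mul, add_zero] at this
      exact this.mono_left nhdsWithin_le_nhds
    obtain ⟨ε, h1, h2⟩ := ((hc.eventually (isOpen_interior.mem_nhds hint)).and
      (Ioo_mem_nhdsGT h.1)).exists
    exact hback ε h2.1 h2.2 (interior_subset h1)
  -- If the velocity pointed strictly outwards, the particle would have been inside the obstacle
  -- just before the hit.
  have hin : ∀ y : Q.PhaseSpace, y.1 = κ.1 → Q.position y = z →
      inner ℝ (Q.velocity x) (Q.normal y) ≤ 0 := by
    intro y hy1 hy2
    by_contra hpos
    obtain ⟨ε, hε, hint⟩ := exists_mem_interior y (d := -Q.velocity x) (by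
      rw [inner_neg_right, real_inner_comm]; linarith [not_le.1 hpos])
    rw [hy1, hy2] at hint
    by_cases hεt : ε < t
    · exact hback ε hε hεt (interior_subset hint)
    · have hne : z ≠ z + ε * -Q.velocity x := fun h' => by
        have : (ε : ℂ) * Q.velocity x = 0 := by linear_combination h'
        rcases mul_eq_zero.1 this with h2 | h2
        · exact hε.ne' (by exact_mod_cast h2)
        · exact velocity_ne_zero x h2
      -- The interior point may lie further back than the starting point; convexity then puts the
      -- point at backward distance t / 2 inside too.
      have ht := h.1
      have hlam : 0 < t / (2 * ε) := by positivity
      have hlam1 : t / (2 * ε) < 1 := by rw [div_lt_one (by positivity)]; linarith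
      have := (Q.scatterer κ.1).mem_interior_of_mem_of_ne hzm (interior_subset hint) hne
        (a := 1 - t / (2 * ε)) (by linarith) hlam (by ring)
      refine hback (t / 2) (by linarith) (by linarith) (interior_subset ?_)
      convert this using 1
      have hε' : (ε : ℂ) ≠ 0 := by exact_mod_cast hε.ne'
      push_cast
      field_simp
      ring
  obtain ⟨y0, hy01, hy02, -⟩ : ∃ y : Q.PhaseSpace, y.1 = κ.1 ∧ Q.position y = z ∧ True := by
    have hfr' := hfr
    rw [← (Q.scatterer κ.1).range_curve] at hfr'
    obtain ⟨s, hs⟩ := hfr'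
    exact ⟨phasePoint κ.1 s ⟨0, by constructor <;> linarith [Real.pi_pos]⟩, rfl, hs, trivial⟩
  set n := Q.normal y0 with hn
  set w : ℂ := Q.velocity x - ((2 * inner ℝ (Q.velocity x) n : ℝ) : ℂ) * n with hw
  have hnsq : n.re * n.re + n.im * n.im = 1 := normal_sq y0
  have hwn : ‖w‖ = 1 := by
    have hv := velocity_sq x
    have : Complex.normSq w = 1 := by
      rw [Complex.normSq_apply, hw, inner_eq_re_im]
      simp only [Complex.sub_re, Complex.sub_im, Complex.re_ofReal_mul, Complex.im_ofReal_mul]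
      linear_combination hv + 4 * ((Q.velocity x).re * n.re + (Q.velocity x).im * n.im) ^ 2 * hnsq
    rw [Complex.norm_def, this, Real.sqrt_one]
  have hwin : ∀ y : Q.PhaseSpace, y.1 = κ.1 → Q.position y = z → 0 ≤ inner ℝ w (Q.normal y) := by
    intro y hy1 hy2
    have hyn : Q.normal y = n := normal_congr (hy1.trans hy01.symm) (hy2.trans hy02.symm)
    have := hin y0 hy01 hy02
    rw [← hn, inner_eq_re_im] at this
    rw [hyn, hw, inner_eq_re_im, inner_eq_re_im]
    simp only [Complex.sub_re, Complex.sub_im, Complex.re_ofReal_mul, Complex.im_ofReal_mul]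
    have h2 : ((Q.velocity x).re * n.re + (Q.velocity x).im * n.im) * (n.re * n.re + n.im * n.im)
      = ((Q.velocity x).re * n.re + (Q.velocity x).im * n.im) := by rw [hnsq, mul_one]
    nlinarith
  obtain ⟨y, hy1, hy2, hy3⟩ := exists_position_velocity κ.1 hfr hwn hwin
  have hyn : Q.normal y = n := normal_congr (hy1.trans hy01.symm) (hy2.trans hy02.symm)
  refine ⟨y, hy1, h.1, ?_, h.2.2, ?_⟩
  · rw [hy2, hz]; ring
  · rw [hy3, hyn, hw]

theorem exists_isNextCollision (hQ : Q.FiniteHorizon) (x : Q.PhaseSpace) :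
    ∃ y, Q.IsNextCollision x y := by
  obtain ⟨κ, t, h⟩ := exists_firstHit hQ x
  obtain ⟨y, -, hy⟩ := h.exists_collision
  exact ⟨y, isNextCollision_iff.2 ⟨t, _, hy⟩⟩

theorem isNextCollision_T (hQ : Q.FiniteHorizon) (x : Q.PhaseSpace) :
    Q.IsNextCollision x (Q.T x) := by
  have h := exists_isNextCollision hQ x
  rw [T, dif_pos h]
  exact h.choose_spec

theorem Collision.eq_T (hQ : Q.FiniteHorizon) {x y : Q.PhaseSpace} {t : ℝ} {m : ℤ × ℤ}
    (h : Collision x y t m) : y = Q.T x := by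
  obtain ⟨t', m', h'⟩ := isNextCollision_iff.1 (isNextCollision_T hQ x)
  exact (h.unique h').1

open Classical in
/-- The label of the first obstacle that a particle leaving `x` meets. -/
def label (x : Q.PhaseSpace) : Fin Q.D × (ℤ × ℤ) :=
  if h : ∃ κ t, FirstHit x κ t then h.choose else (x.1, 0)

open Classical in
/-- The length of the free flight of a particle leaving `x`. -/
def flight (x : Q.PhaseSpace) : ℝ :=
  if h : ∃ t, FirstHit x (label x) t then h.choose else 0

theorem firstHit_label (hQ : Q.FiniteHorizon) (x : Q.PhaseSpace) :
    FirstHit x (label x) (flight x) := by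
  have h := exists_firstHit hQ x
  have h' : ∃ t, FirstHit x (label x) t := by
    rw [label, dif_pos h]; exact h.choose_spec
  rw [flight, dif_pos h']
  exact h'.choose_spec

theorem FirstHit.label_eq (hQ : Q.FiniteHorizon) {x : Q.PhaseSpace} {κ : Fin Q.D × (ℤ × ℤ)}
    {t : ℝ} (h : FirstHit x κ t) : label x = κ := ((firstHit_label hQ x).unique h).1

theorem collision_T (hQ : Q.FiniteHorizon) (x : Q.PhaseSpace) :
    Collision x (Q.T x) (flight x) (label x).2 := by
  obtain ⟨y, hy1, hy⟩ := (firstHit_label hQ x).exists_collision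
  exact hy.eq_T hQ ▸ hy

theorem T_fst (hQ : Q.FiniteHorizon) (x : Q.PhaseSpace) : (Q.T x).1 = (label x).1 := by
  have := ((collision_T hQ x).firstHit.unique (firstHit_label hQ x)).1
  exact congrArg Prod.fst this

theorem Collision.label_eq (hQ : Q.FiniteHorizon) {x y : Q.PhaseSpace} {t : ℝ} {m : ℤ × ℤ}
    (h : Collision x y t m) : label x = (y.1, m) := h.firstHit.label_eq hQ

/-- The reversed particle runs through the same free segment, seen from the translate by -m. -/
theorem Collision.reverse {x y : Q.PhaseSpace} {t : ℝ} {m : ℤ × ℤ} (h : Collision x y t m) :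
    Collision (flip y) (flip x) t (-m) := by
  obtain ⟨h0, h1, h2, h3⟩ := h
  have hn := normal_sq y
  have hvel : Q.velocity (flip y) = -Q.velocity x := by
    rw [velocity_flip, h3, inner_eq_re_im, inner_eq_re_im]
    simp only [Complex.sub_re, Complex.sub_im, Complex.re_ofReal_mul, Complex.im_ofReal_mul]
    have hr : ((Q.velocity x).re - 2 * ((Q.velocity x).re * (Q.normal y).re +
        (Q.velocity x).im * (Q.normal y).im) * (Q.normal y).re) * (Q.normal y).re +
        ((Q.velocity x).im - 2 * ((Q.velocity x).re * (Q.normal y).re +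
        (Q.velocity x).im * (Q.normal y).im) * (Q.normal y).im) * (Q.normal y).im =
        -((Q.velocity x).re * (Q.normal y).re + (Q.velocity x).im * (Q.normal y).im) := by
      linear_combination (-2 * ((Q.velocity x).re * (Q.normal y).re +
        (Q.velocity x).im * (Q.normal y).im)) * hn
    rw [hr]; push_cast; ring
  refine ⟨h0, ?_, fun s hs κ hκ => ?_, ?_⟩
  · rw [hvel, position_flip, position_flip, latticeVector_neg]
    linear_combination -h1
  · rw [hvel, position_flip] at hκ
    refine h2 (t - s) ⟨by linarith [hs.2], by linarith [hs.1]⟩ _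
      (Set.mem_of_eq_of_mem ?_ ((obstacle_add m).2 hκ))
    push_cast
    linear_combination h1
  · rw [hvel, velocity_flip, normal_flip, inner_neg_left]
    push_cast; ring

theorem T_flip_T (hQ : Q.FiniteHorizon) (x : Q.PhaseSpace) : Q.T (flip (Q.T x)) = flip x :=
  ((collision_T hQ x).reverse.eq_T hQ).symm

theorem label_flip_T (hQ : Q.FiniteHorizon) (x : Q.PhaseSpace) :
    label (flip (Q.T x)) = (x.1, -(label x).2) :=
  (collision_T hQ x).reverse.label_eq hQ

/-- Both halves come from the relation T ∘ flip ∘ T = flip and the fact that `flip` is an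
involution. -/
theorem bijective_T (hQ : Q.FiniteHorizon) : Function.Bijective Q.T := by
  refine ⟨fun x y h => flip_injective ?_, fun z => ⟨flip (Q.T (flip z)), ?_⟩⟩
  · rw [← T_flip_T hQ x, h, T_flip_T hQ]
  · rw [T_flip_T hQ, flip_flip]

theorem Tinv_eq (hQ : Q.FiniteHorizon) (x : Q.PhaseSpace) : Q.Tinv x = flip (Q.T (flip x)) := by
  apply (bijective_T hQ).1
  rw [T_flip_T hQ, flip_flip]
  exact Function.rightInverse_invFun (bijective_T hQ).2 x

/-- An upper bound for the length of a free flight. -/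
def maxFlight (hQ : Q.FiniteHorizon) : ℝ := (exists_maxFlight hQ).choose

theorem maxFlight_spec (hQ : Q.FiniteHorizon) (p : ℂ) {v : ℂ} (hv : ‖v‖ = 1) :
    ∃ s ∈ Ioo 0 (maxFlight hQ), ∃ κ, p + s * v ∈ interior (Q.obstacle κ) :=
  (exists_maxFlight hQ).choose_spec.2 p v hv

theorem flight_le_maxFlight (hQ : Q.FiniteHorizon) (x : Q.PhaseSpace) :
    flight x ≤ maxFlight hQ := by
  obtain ⟨s, hs, κ, hκ⟩ := maxFlight_spec hQ (Q.position x) (norm_velocity x)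
  by_contra hlt
  exact (firstHit_label hQ x).2.2 s ⟨hs.1, hs.2.trans (not_le.1 hlt)⟩ κ (interior_subset hκ)

/-- Flights start on the chosen lifts and have bounded length, so they end in a bounded region,
which only finitely many obstacles meet. -/
theorem exists_finite_labels (hQ : Q.FiniteHorizon) :
    ∃ F : Set (Fin Q.D × (ℤ × ℤ)), F.Finite ∧ ∀ x : Q.PhaseSpace, label x ∈ F := by
  obtain ⟨R, -, hR⟩ := Q.exists_norm_obstacle_bound
  refine ⟨_, Q.finite_obstacle_meets (R + maxFlight hQ), fun x =>
    ⟨_, (firstHit_label hQ x).2.1, ?_⟩⟩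
  refine (norm_add_le _ _).trans (add_le_add (hR _ _ (position_mem_body x)) ?_)
  rw [norm_mul, norm_velocity, mul_one, Complex.norm_real,
    Real.norm_of_nonneg (firstHit_label hQ x).1.le]
  exact flight_le_maxFlight hQ x

end SinaiTable

/-! ### Limits of collisions and the cells of the base partition -/

namespace SinaiTable

variable {Q : SinaiTable}

/-- The closure of the collision relation: on its flight from `x` to `y` the particle may touch
obstacles, but it does not enter their interiors. -/
structure WeakCollision (x y : Q.PhaseSpace) (t : ℝ) (m : ℤ × ℤ) : Prop where
  minFlight_le : Q.minFlight ≤ t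
  position_eq : Q.position x + t * Q.velocity x = Q.position y + latticeVector m
  clear : ∀ s ∈ Ioo 0 t, ∀ κ, Q.position x + s * Q.velocity x ∉ interior (Q.obstacle κ)
  velocity_eq : Q.velocity y =
    Q.velocity x - ((2 * inner ℝ (Q.velocity x) (Q.normal y) : ℝ) : ℂ) * Q.normal y

theorem WeakCollision.pos {x y : Q.PhaseSpace} {t : ℝ} {m : ℤ × ℤ} (h : WeakCollision x y t m) :
    0 < t := minFlight_pos.trans_le h.minFlight_le

theorem Collision.weak {x y : Q.PhaseSpace} {t : ℝ} {m : ℤ × ℤ} (h : Collision x y t m) :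
    WeakCollision x y t m where
  minFlight_le := minFlight_le_of_mem h.1 (h.2.1 ▸ position_add_mem_obstacle y m)
  position_eq := h.2.1
  clear := fun s hs κ hκ => h.2.2.1 s hs κ (interior_subset hκ)
  velocity_eq := h.2.2.2

theorem WeakCollision.le_maxFlight (hQ : Q.FiniteHorizon) {x y : Q.PhaseSpace} {t : ℝ}
    {m : ℤ × ℤ} (h : WeakCollision x y t m) : t ≤ maxFlight hQ := by
  obtain ⟨s, hs, κ, hκ⟩ := maxFlight_spec hQ (Q.position x) (norm_velocity x)
  by_contra hlt
  exact h.clear s ⟨hs.1, hs.2.trans (not_le.1 hlt)⟩ κ hκ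

/-- All conditions are closed: the interiors are open, and the flight length stays bounded away from
0. Touching obstacles on the way must be allowed, since it can appear in the limit. -/
theorem WeakCollision.of_tendsto {α : Type*} {l : Filter α} [l.NeBot] {x y : α → Q.PhaseSpace}
    {t : α → ℝ} {m : ℤ × ℤ} {X Y : Q.PhaseSpace} {t' : ℝ} (hx : Tendsto x l (𝓝 X))
    (hy : Tendsto y l (𝓝 Y)) (ht : Tendsto t l (𝓝 t'))
    (h : ∀ᶠ a in l, WeakCollision (x a) (y a) (t a) m) : WeakCollision X Y t' m := by
  have hpx := (continuous_position.tendsto X).comp hx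
  have hpy := (continuous_position.tendsto Y).comp hy
  have hvx := (continuous_velocity.tendsto X).comp hx
  have hvy := (continuous_velocity.tendsto Y).comp hy
  have hny := (continuous_normal.tendsto Y).comp hy
  refine ⟨ge_of_tendsto ht (h.mono fun a ha => ha.minFlight_le), ?_, fun s hs κ hκ => ?_, ?_⟩
  · have h1 := hpx.add (((Complex.continuous_ofReal.tendsto t').comp ht).mul hvx)
    have h2 := hpy.add (tendsto_const_nhds (x := latticeVector m))
    exact tendsto_nhds_unique (h1.congr' (h.mono fun a ha => ha.position_eq)) h2
  · have h1 := hpx.add (hvx.const_mul (s : ℂ))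
    obtain ⟨a, ⟨h2, h3⟩, h4⟩ := ((h.and (h1.eventually (isOpen_interior.mem_nhds hκ))).and
      (ht.eventually (lt_mem_nhds hs.2))).exists
    exact h2.clear s ⟨hs.1, h4⟩ κ h3
  · have h1 := hvx.sub (((Complex.continuous_ofReal.tendsto _).comp
      ((hvx.inner (𝕜 := ℝ) hny).const_mul 2)).mul hny)
    exact tendsto_nhds_unique hvy (h1.congr' (h.mono fun a ha => ha.velocity_eq.symm))

theorem WeakCollision.exists_tendsto (hQ : Q.FiniteHorizon) {α : Type*} {𝒰 : Ultrafilter α}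
    {x y : α → Q.PhaseSpace} {t : α → ℝ} {m : ℤ × ℤ} {X Y : Q.PhaseSpace}
    (hx : Tendsto x 𝒰 (𝓝 X)) (hy : Tendsto y 𝒰 (𝓝 Y))
    (h : ∀ᶠ a in 𝒰, WeakCollision (x a) (y a) (t a) m) :
    ∃ t', Tendsto t 𝒰 (𝓝 t') ∧ WeakCollision X Y t' m := by
  obtain ⟨t', -, ht'⟩ := 𝒰.exists_tendsto_of_isCompact (f := t)
    (isCompact_Icc (a := Q.minFlight) (b := maxFlight hQ))
    (h.mono fun a ha => ⟨ha.minFlight_le, ha.le_maxFlight hQ⟩)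
  exact ⟨t', ht', .of_tendsto hx hy ht' h⟩

/-- A line that is invariant under a lattice translation along it and avoids the interiors of the
obstacles on one period would contradict the finite horizon condition. -/
theorem WeakCollision.lattice_unique (hQ : Q.FiniteHorizon) {x y : Q.PhaseSpace} {t t' : ℝ}
    {m m' : ℤ × ℤ} (h : WeakCollision x y t m) (h' : WeakCollision x y t' m') : m = m' := by
  wlog hle : t ≤ t' generalizing t t' m m'
  · exact (this h' h (le_of_not_ge hle)).symm
  have hdiff : ((t' - t : ℝ) : ℂ) * Q.velocity x = latticeVector (m' - m) := by
    rw [latticeVector_sub]; push_cast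
    linear_combination h'.position_eq - h.position_eq
  rcases hle.eq_or_lt with rfl | hlt
  · rw [sub_self, Complex.ofReal_zero, zero_mul] at hdiff
    have := latticeVector_injective (hdiff.symm.trans latticeVector_zero.symm)
    exact (sub_eq_zero.1 this).symm
  exfalso
  set L := t' - t with hL
  have hL0 : 0 < L := by linarith
  obtain ⟨u, i, k, hu⟩ := hQ (Q.position x) (Q.velocity x) (velocity_ne_zero x)
  have hu : Q.position x + u * Q.velocity x ∈ interior (Q.obstacle (i, k)) :=
    mem_interior_obstacle.2 hu
  -- The line is periodic with period L along itself. A point of it inside an obstacle, supplied by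
  -- finite horizon, is moved by N periods into [t, t'), where the longer flight is free.
  obtain ⟨N, hN, -⟩ := existsUnique_add_zsmul_mem_Ico hL0 u t
  have h1 := (interior_obstacle_add (N • (m' - m))).2 hu
  have h2 : latticeVector (N • (m' - m)) = ((N • L : ℝ) : ℂ) * Q.velocity x := by
    have : latticeVector (N • (m' - m)) = (N : ℂ) * latticeVector (m' - m) := by
      simp [latticeVector]; ring
    rw [this, ← hdiff]; push_cast [zsmul_eq_mul]; ring
  rw [h2] at h1
  refine h'.clear (u + N • L) ⟨by linarith [hN.1, h.pos], by linarith [hN.2]⟩ _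
    (Set.mem_of_eq_of_mem ?_ h1)
  push_cast; ring

theorem weakCollision_T (hQ : Q.FiniteHorizon) (x : Q.PhaseSpace) :
    WeakCollision x (Q.T x) (flight x) (label x).2 := (collision_T hQ x).weak

theorem eventually_index_eq {α : Type*} {l : Filter α} {x : α → Q.PhaseSpace}
    {X : Q.PhaseSpace} (hx : Tendsto x l (𝓝 X)) : ∀ᶠ a in l, (x a).1 = X.1 :=
  ((continuous_index.tendsto X).comp hx).eventually (by simp : ∀ᶠ i in 𝓝 X.1, i = X.1)

/-- If `x` and `y` are close, and so are `T x` and `T y`, then `x` and `y` have the same label. -/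
theorem eventually_label_eq (hQ : Q.FiniteHorizon) {α : Type*} {𝒰 : Ultrafilter α}
    {x y : α → Q.PhaseSpace} {X Y : Q.PhaseSpace} (hx : Tendsto x 𝒰 (𝓝 X))
    (hy : Tendsto y 𝒰 (𝓝 X)) (hTx : Tendsto (fun a => Q.T (x a)) 𝒰 (𝓝 Y))
    (hTy : Tendsto (fun a => Q.T (y a)) 𝒰 (𝓝 Y)) : ∀ᶠ a in 𝒰, label (x a) = label (y a) := by
  obtain ⟨F, hF, hFm⟩ := exists_finite_labels hQ
  obtain ⟨κ, -, hκ⟩ := 𝒰.exists_eventually_eq (f := fun a => label (x a)) hF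
    (Eventually.of_forall fun a => hFm _)
  obtain ⟨κ', -, hκ'⟩ := 𝒰.exists_eventually_eq (f := fun a => label (y a)) hF
    (Eventually.of_forall fun a => hFm _)
  obtain ⟨t, -, ht⟩ := WeakCollision.exists_tendsto hQ (m := κ.2) hx hTx
    (hκ.mono fun a ha => ha ▸ weakCollision_T hQ (x a))
  obtain ⟨t', -, ht'⟩ := WeakCollision.exists_tendsto hQ (m := κ'.2) hy hTy
    (hκ'.mono fun a ha => ha ▸ weakCollision_T hQ (y a))
  -- Both limits are weak collisions from X to Y, which forces the same lattice translation.
  have h2 := ht.lattice_unique hQ ht'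
  filter_upwards [hκ, hκ', eventually_index_eq hTx, eventually_index_eq hTy] with a h3 h4 h5 h6
  refine Prod.ext ?_ (by rw [h3, h4, h2])
  rw [← T_fst hQ, ← T_fst hQ, h5, h6]

/-- `T` is continuous on the set of points with a given label. -/
theorem continuousOn_T_label (hQ : Q.FiniteHorizon) (κ : Fin Q.D × (ℤ × ℤ)) :
    ContinuousOn Q.T {x | label x = κ} := by
  intro X hX
  change Tendsto _ _ _
  rw [tendsto_iff_ultrafilter]
  intro 𝒰 h𝒰
  obtain ⟨Y, hY⟩ := 𝒰.exists_tendsto Q.T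
  have hid : Tendsto id 𝒰 (𝓝 X) := h𝒰.trans nhdsWithin_le_nhds
  have hκ : ∀ᶠ x in 𝒰, label x = κ := h𝒰 self_mem_nhdsWithin
  obtain ⟨t, -, ht⟩ := WeakCollision.exists_tendsto hQ (m := κ.2) (x := id) hid hY
    (hκ.mono fun a ha => ha ▸ weakCollision_T hQ a)
  have hc := collision_T hQ X
  have hX : label X = κ := hX
  rw [hX] at hc
  have hYi : Y.1 = κ.1 := by
    obtain ⟨a, h1, h2⟩ := ((eventually_index_eq hY).and hκ).exists
    rw [← h1, T_fst hQ, h2]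
  have hi : (Q.T X).1 = κ.1 := by rw [T_fst hQ, hX]
  have hTm : Q.position X + flight X * Q.velocity X ∈ Q.obstacle κ := by
    rw [hc.2.1]; have := position_add_mem_obstacle (Q.T X) κ.2; rwa [hi] at this
  have hYm : Q.position X + t * Q.velocity X ∈ Q.obstacle κ := by
    rw [ht.position_eq]; have := position_add_mem_obstacle Y κ.2; rwa [hYi] at this
  -- The limit flight ends on κ, so it cannot be shorter than the first hit of X. If it were longer,
  -- strict convexity would make it pass through the interior of κ.
  have hle : flight X ≤ t := by
    by_contra hlt
    exact hc.2.2.1 t ⟨ht.pos, not_le.1 hlt⟩ κ hYm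
  have heq : flight X = t := by
    rcases hle.eq_or_lt with h | hlt
    · exact h
    exfalso
    have hne : Q.position X + flight X * Q.velocity X ≠ Q.position X + t * Q.velocity X := by
      intro h
      have h1 : ((t - flight X : ℝ) : ℂ) * Q.velocity X = 0 := by
        push_cast; linear_combination -h
      rcases mul_eq_zero.1 h1 with h2 | h2
      · have : t - flight X = 0 := by exact_mod_cast h2
        linarith
      · exact velocity_ne_zero X h2
    have hint := strictConvex_obstacle κ hTm hYm hne (a := 1 / 2) (b := 1 / 2)
      (by norm_num) (by norm_num) (by norm_num)
    refine ht.clear ((flight X + t) / 2) ⟨by linarith [hc.1, ht.pos], by linarith⟩ κ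
      (Set.mem_of_eq_of_mem ?_ hint)
    simp only [Complex.real_smul]; push_cast; ring
  have hYT : Y = Q.T X := by
    have hp : Q.position Y = Q.position (Q.T X) := by
      have := hc.2.1.symm.trans (heq ▸ ht.position_eq)
      exact (add_right_cancel this).symm
    have hfst : Y.1 = (Q.T X).1 := hYi.trans hi.symm
    refine phaseSpace_ext hfst hp ?_
    rw [ht.velocity_eq, hc.2.2.2, normal_congr hfst hp]
  exact hYT ▸ hY

theorem continuousOn_Tinv_label (hQ : Q.FiniteHorizon) (κ : Fin Q.D × (ℤ × ℤ)) :
    ContinuousOn Q.Tinv {x | label (flip x) = κ} := by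
  have : Q.Tinv = fun x => flip (Q.T (flip x)) := funext (Tinv_eq hQ)
  rw [this]
  exact continuous_flip.comp_continuousOn
    ((continuousOn_T_label hQ κ).comp continuous_flip.continuousOn fun x hx => hx)

/-- Where T is continuous, nearby points have nearby images, hence equal labels; so the label is
locally constant on C. -/
theorem label_eq_of_isPreconnected (hQ : Q.FiniteHorizon) {C : Set Q.PhaseSpace}
    (hC : IsPreconnected C) (hT : ContinuousOn Q.T C) {x y : Q.PhaseSpace} (hx : x ∈ C)
    (hy : y ∈ C) : label x = label y := by
  let _ : TopologicalSpace (Fin Q.D × (ℤ × ℤ)) := ⊥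
  have _ : DiscreteTopology (Fin Q.D × (ℤ × ℤ)) := ⟨rfl⟩
  refine hC.constant (f := label) ?_ hx hy
  intro X hX
  rw [ContinuousWithinAt, nhds_discrete, tendsto_pure, Filter.Eventually, mem_iff_ultrafilter]
  intro 𝒰 h𝒰
  have hid : Tendsto id 𝒰 (𝓝 X) := h𝒰.trans nhdsWithin_le_nhds
  exact eventually_label_eq hQ (x := id) (y := fun _ => X) hid tendsto_const_nhds
    ((hT X hX).mono_left h𝒰) tendsto_const_nhds

/-- Time reversal conjugates the inverse of T to T, which reduces this to the forward label. -/
theorem label_flip_eq_of_isPreconnected (hQ : Q.FiniteHorizon) {C : Set Q.PhaseSpace}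
    (hC : IsPreconnected C) (hT : ContinuousOn Q.Tinv C) {x y : Q.PhaseSpace} (hx : x ∈ C)
    (hy : y ∈ C) : label (flip x) = label (flip y) := by
  refine label_eq_of_isPreconnected hQ (C := flip '' C)
    (hC.image _ continuous_flip.continuousOn) ?_ (mem_image_of_mem _ hx) (mem_image_of_mem _ hy)
  have h1 : ∀ z, Q.T z = flip (Q.Tinv (flip z)) := fun z => by
    rw [Tinv_eq hQ, flip_flip, flip_flip]
  have h2 : Q.T = fun z => flip (Q.Tinv (flip z)) := funext h1
  rw [h2]
  refine continuous_flip.comp_continuousOn (hT.comp continuous_flip.continuousOn ?_)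
  rintro _ ⟨z, hz, rfl⟩
  rwa [flip_flip]

variable (Q) in
/-- The pair of the labels of the previous and the next obstacle. -/
def bilabel (x : Q.PhaseSpace) : (Fin Q.D × (ℤ × ℤ)) × (Fin Q.D × (ℤ × ℤ)) :=
  (label (flip x), label x)

variable (Q) in
/-- The element of the base partition that contains `x`. -/
def cell (x : Q.PhaseSpace) : Set Q.PhaseSpace :=
  connectedComponentIn (Q.bilabel ⁻¹' {Q.bilabel x}) x

theorem mem_cell_self (x : Q.PhaseSpace) : x ∈ Q.cell x := mem_connectedComponentIn rfl

theorem cell_subset (x : Q.PhaseSpace) : Q.cell x ⊆ Q.bilabel ⁻¹' {Q.bilabel x} :=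
  connectedComponentIn_subset _ _

theorem bilabel_eq_of_mem_cell {x y : Q.PhaseSpace} (h : y ∈ Q.cell x) :
    Q.bilabel y = Q.bilabel x := cell_subset x h

theorem cell_eq_of_mem {x y : Q.PhaseSpace} (h : y ∈ Q.cell x) : Q.cell y = Q.cell x := by
  rw [cell, bilabel_eq_of_mem_cell h]
  exact (connectedComponentIn_eq h).symm

theorem bilabel_eq_of_cell_eq {x y : Q.PhaseSpace} (h : Q.cell x = Q.cell y) :
    Q.bilabel x = Q.bilabel y := bilabel_eq_of_mem_cell (h ▸ mem_cell_self x)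

theorem label_eq_of_cell_eq {x y : Q.PhaseSpace} (h : Q.cell x = Q.cell y) :
    label x = label y := congrArg Prod.snd (bilabel_eq_of_cell_eq h)

theorem index_eq_of_cell_eq {x y : Q.PhaseSpace} (h : Q.cell x = Q.cell y) : x.1 = y.1 := by
  have h1 : IsPreconnected ((fun x : Q.PhaseSpace => x.1) '' Q.cell y) :=
    isPreconnected_connectedComponentIn.image _ continuous_index.continuousOn
  exact h1.subsingleton (mem_image_of_mem _ (h ▸ mem_cell_self x))
    (mem_image_of_mem _ (mem_cell_self y))

theorem cell_good (hQ : Q.FiniteHorizon) (x : Q.PhaseSpace) : IsConnected (Q.cell x) ∧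
    ContinuousOn Q.T (Q.cell x) ∧ ContinuousOn Q.Tinv (Q.cell x) := by
  refine ⟨⟨⟨x, mem_cell_self x⟩, isPreconnected_connectedComponentIn⟩, ?_, ?_⟩
  · exact (continuousOn_T_label hQ (label x)).mono fun y hy =>
      congrArg Prod.snd (bilabel_eq_of_mem_cell hy)
  · exact (continuousOn_Tinv_label hQ (label (flip x))).mono fun y hy =>
      congrArg Prod.fst (bilabel_eq_of_mem_cell hy)

theorem subset_cell (hQ : Q.FiniteHorizon) {C : Set Q.PhaseSpace} (hC : IsConnected C)
    (hT : ContinuousOn Q.T C) (hT' : ContinuousOn Q.Tinv C) {x : Q.PhaseSpace} (hx : x ∈ C) :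
    C ⊆ Q.cell x :=
  hC.isPreconnected.subset_connectedComponentIn hx fun _ hy =>
    Prod.ext (label_flip_eq_of_isPreconnected hQ hC.isPreconnected hT' hy hx)
      (label_eq_of_isPreconnected hQ hC.isPreconnected hT hy hx)

/-- T is continuous where the next label is constant and its inverse where the previous one is.
Conversely, both labels are constant on connected sets of continuity. Maximal such sets are
therefore components of the level sets of `bilabel`. -/
theorem basePartition_eq (hQ : Q.FiniteHorizon) : Q.basePartition = range Q.cell := by
  ext A
  constructor
  · intro hA
    obtain ⟨⟨hc, h1, h2⟩, hmax⟩ := hA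
    obtain ⟨x, hx⟩ := hc.nonempty
    have hsub := subset_cell hQ hc h1 h2 hx
    exact ⟨x, (hmax (cell_good hQ x) hsub).antisymm hsub⟩
  · rintro ⟨x, rfl⟩
    refine ⟨cell_good hQ x, fun C hC hsub => ?_⟩
    exact subset_cell hQ hC.1 hC.2.1 hC.2.2 (hsub (mem_cell_self x))

end SinaiTable

/-! ### The monotone pairing and expansivity -/

namespace SinaiTable

variable {Q : SinaiTable}

theorem distance_mk (i : Fin Q.D) (a b : Q.Cylinder i) :
    Q.distance ⟨i, a⟩ ⟨i, b⟩ = dist a b := by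
  simp [distance]

theorem distance_of_ne {x y : Q.PhaseSpace} (h : x.1 ≠ y.1) : Q.distance x y =
    10 * (Q.D : ℝ) * ⨆ i : Fin Q.D, Metric.diam (univ : Set (Q.Cylinder i)) := by
  rw [distance, dif_neg h]

theorem exists_index_eq_of_distance_lt (Q : SinaiTable) :
    ∃ c : ℝ, 0 < c ∧ ∀ x y : Q.PhaseSpace, Q.distance x y < c → x.1 = y.1 := by
  refine ⟨10 * (Q.D : ℝ) * ⨆ i : Fin Q.D, Metric.diam (univ : Set (Q.Cylinder i)), ?_,
    fun x y h => ?_⟩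
  · have hD : (0 : ℝ) < Q.D := by exact_mod_cast Q.D_pos
    set i0 : Fin Q.D := ⟨0, Q.D_pos⟩
    have h1 : Metric.diam (univ : Set (Q.Cylinder i0)) ≤
        ⨆ i : Fin Q.D, Metric.diam (univ : Set (Q.Cylinder i)) :=
      le_ciSup (f := fun i : Fin Q.D => Metric.diam (univ : Set (Q.Cylinder i)))
        (finite_range _).bddAbove i0
    have h2 : 0 < Metric.diam (univ : Set (Q.Cylinder i0)) := by
      have hp := Real.pi_pos
      set a : Q.Cylinder i0 := WithLp.toLp 2 (0, ⟨0, by constructor <;> linarith⟩)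
      set b : Q.Cylinder i0 := WithLp.toLp 2 (0, ⟨Real.pi / 2, by constructor <;> linarith⟩)
      have hab : a ≠ b := fun h => by
        have h3 : (a.snd : ℝ) = (b.snd : ℝ) := by rw [h]
        change (0 : ℝ) = Real.pi / 2 at h3
        linarith
      exact (dist_pos.2 hab).trans_le (Metric.dist_le_diam_of_mem
        (isCompact_univ (X := Q.Cylinder i0)).isBounded (mem_univ _) (mem_univ _))
    have := h2.trans_le h1
    positivity
  · by_contra hne
    rw [distance_of_ne hne] at h
    exact lt_irrefl _ h

theorem eventually_distance_lt {α : Type*} {l : Filter α} {x y : α → Q.PhaseSpace}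
    {X : Q.PhaseSpace} (hx : Tendsto x l (𝓝 X)) (hy : Tendsto y l (𝓝 X)) {ε : ℝ} (hε : 0 < ε) :
    ∀ᶠ a in l, Q.distance (x a) (y a) < ε := by
  obtain ⟨i, c⟩ := X
  have hn : ∀ᶠ z in 𝓝 (⟨i, c⟩ : Q.PhaseSpace), ∃ b, z = ⟨i, b⟩ ∧ dist b c < ε / 2 := by
    rw [Sigma.nhds_mk, eventually_map]
    filter_upwards [Metric.ball_mem_nhds c (half_pos hε)] with b hb using ⟨b, rfl, hb⟩
  filter_upwards [hx.eventually hn, hy.eventually hn] with a ⟨b, h1, h2⟩ ⟨b', h3, h4⟩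
  rw [h1, h3, distance_mk]
  linarith [dist_triangle_right b b' c]

theorem tendsto_of_distance {α : Type*} {l : Filter α} {x y : α → Q.PhaseSpace}
    {X : Q.PhaseSpace} (hx : Tendsto x l (𝓝 X))
    (hxy : Tendsto (fun a => Q.distance (x a) (y a)) l (𝓝 0)) : Tendsto y l (𝓝 X) := by
  obtain ⟨c0, hc0, hc⟩ := Q.exists_index_eq_of_distance_lt
  obtain ⟨i, c⟩ := X
  rw [Sigma.nhds_mk] at hx ⊢
  intro s hs
  rw [mem_map, Metric.mem_nhds_iff] at hs
  obtain ⟨ε, hε, hball⟩ := hs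
  have hn : ∀ᶠ z in map (Sigma.mk i) (𝓝 c), ∃ b : Q.Cylinder i, z = ⟨i, b⟩ ∧ dist b c < ε / 2 := by
    rw [eventually_map]
    filter_upwards [Metric.ball_mem_nhds c (half_pos hε)] with b hb using ⟨b, rfl, hb⟩
  change ∀ᶠ a in l, y a ∈ s
  filter_upwards [hx.eventually hn, hxy.eventually (gt_mem_nhds hc0),
    hxy.eventually (gt_mem_nhds (half_pos hε))] with a ⟨b, h1, h2⟩ h3 h4
  have h5 := hc _ _ h3
  rw [h1] at h4 h5
  obtain ⟨j, b', hb'⟩ : ∃ j, ∃ b' : Q.Cylinder j, y a = ⟨j, b'⟩ := ⟨_, _, rfl⟩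
  rw [hb'] at h4 h5
  obtain rfl : i = j := h5
  rw [distance_mk] at h4
  have : b' ∈ Metric.ball c ε := by
    rw [Metric.mem_ball]
    linarith [dist_triangle_left b' c b]
  change y a ∈ s
  rw [hb']
  exact hball this

/-- The pairing of the differences of the velocities and of the positions of two particles. -/
def gap (x y : Q.PhaseSpace) : ℝ :=
  inner ℝ (Q.velocity x - Q.velocity y) (Q.position x - Q.position y)

/-- Along a pair of flights between the same two obstacles the pairing increases. -/
theorem gap_flight {x y x' y' : Q.PhaseSpace} {t t' : ℝ} {m : ℤ × ℤ}
    (h : WeakCollision x y t m) (h' : WeakCollision x' y' t' m) :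
    inner ℝ (Q.velocity x - Q.velocity x') (Q.position y - Q.position y') =
      gap x x' + (t + t') / 2 * ‖Q.velocity x - Q.velocity x'‖ ^ 2 := by
  have h1 : Q.position y - Q.position y' = Q.position x - Q.position x' +
      (t * Q.velocity x - t' * Q.velocity x') := by
    linear_combination h'.position_eq - h.position_eq
  have hv := velocity_sq x
  have hv' := velocity_sq x'
  rw [h1, gap, inner_add_right, ← Complex.normSq_eq_norm_sq, Complex.normSq_apply]
  simp only [inner_eq_re_im, Complex.sub_re, Complex.sub_im, Complex.re_ofReal_mul,
    Complex.im_ofReal_mul]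
  -- Since both velocities are unit vectors, ⟨v - v', t v - t' v'⟩ = (t + t')(1 - ⟨v, v'⟩), and 2(1
  -- - ⟨v, v'⟩) = |v - v'|².
  linear_combination (t / 2 - t' / 2) * hv + (t' / 2 - t / 2) * hv'

theorem WeakCollision.velocity_sub {x y : Q.PhaseSpace} {t : ℝ} {m : ℤ × ℤ}
    (h : WeakCollision x y t m) :
    Q.velocity y = Q.velocity x + ((2 * Real.cos (Q.angle y) : ℝ) : ℂ) * Q.normal y := by
  have h1 := h.velocity_eq
  have h2 := inner_velocity_normal y
  have hn : inner ℝ (Q.normal y) (Q.normal y) = (1 : ℝ) := by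
    rw [real_inner_self_eq_norm_sq, norm_normal, one_pow]
  have h3 : Real.cos (Q.angle y) = -inner ℝ (Q.velocity x) (Q.normal y) := by
    rw [← h2]
    conv_lhs => rw [h1]
    rw [inner_sub_left, ← Complex.real_smul, real_inner_smul_left, hn]
    ring
  rw [h1, h3]
  push_cast; ring

/-- The reflection adds 2 cos φ times the normal to each velocity. If both points lie on the same
scatterer, the two correction terms are nonnegative, because each point lies on the inner side of
the tangent line at the other. -/
theorem gap_collision {x y x' y' : Q.PhaseSpace} {t t' : ℝ} {m m' : ℤ × ℤ}
    (h : WeakCollision x y t m) (h' : WeakCollision x' y' t' m') :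
    gap y y' = inner ℝ (Q.velocity x - Q.velocity x') (Q.position y - Q.position y') -
      2 * Real.cos (Q.angle y) * inner ℝ (Q.normal y) (Q.position y' - Q.position y) -
      2 * Real.cos (Q.angle y') * inner ℝ (Q.normal y') (Q.position y - Q.position y') := by
  rw [gap, h.velocity_sub, h'.velocity_sub]
  simp only [inner_eq_re_im, Complex.sub_re, Complex.sub_im, Complex.add_re, Complex.add_im,
    Complex.re_ofReal_mul, Complex.im_ofReal_mul]
  ring

theorem cos_mul_inner_nonpos {y y' : Q.PhaseSpace} (hi : y'.1 = y.1) :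
    Real.cos (Q.angle y) * inner ℝ (Q.normal y) (Q.position y' - Q.position y) ≤ 0 :=
  mul_nonpos_of_nonneg_of_nonpos (cos_angle_nonneg y)
    (inner_normal_le y (hi ▸ position_mem_body y'))

theorem abs_gap_le {R : ℝ} (hR : ∀ (i : Fin Q.D), ∀ z ∈ (Q.scatterer i).body, ‖z‖ ≤ R)
    (x y : Q.PhaseSpace) : |gap x y| ≤ ‖Q.velocity x - Q.velocity y‖ * (2 * R) := by
  refine (abs_real_inner_le_norm _ _).trans (mul_le_mul_of_nonneg_left ?_ (norm_nonneg _))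
  have h1 := hR _ _ (position_mem_body x)
  have h2 := hR _ _ (position_mem_body y)
  linarith [norm_sub_le (Q.position x) (Q.position y)]

/-- A bounded two-sided sequence that increases at least quadratically vanishes. -/
theorem eq_zero_of_quadratic_growth {Φ : ℤ → ℝ} {a K : ℝ} (ha : 0 < a)
    (h : ∀ i, Φ i + a * Φ i ^ 2 ≤ Φ (i + 1)) (hK : ∀ i, |Φ i| ≤ K) (i : ℤ) : Φ i = 0 := by
  rcases lt_trichotomy (Φ i) 0 with hlt | heq | hgt
  · exfalso
    -- From a negative value the sequence is followed backwards: it stays below Φ i and falls by at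
    -- least a (Φ i)² in each step, so it cannot stay bounded.
    have hind : ∀ n : ℕ, Φ (i - n) + n * (a * Φ i ^ 2) ≤ Φ i := by
      intro n
      induction n with
      | zero => simp
      | succ n ih =>
        have h1 := h (i - (n + 1 : ℕ))
        rw [show i - ((n + 1 : ℕ) : ℤ) + 1 = i - n by push_cast; ring] at h1
        have h2 : Φ (i - (n + 1 : ℕ)) ≤ Φ i := by
          have : 0 ≤ (n : ℝ) * (a * Φ i ^ 2) := by positivity
          have : 0 ≤ a * Φ (i - (n + 1 : ℕ)) ^ 2 := by positivity
          linarith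
        have h3 : a * Φ i ^ 2 ≤ a * Φ (i - (n + 1 : ℕ)) ^ 2 :=
          mul_le_mul_of_nonneg_left (by nlinarith) ha.le
        push_cast at *
        linarith
    have hpos : 0 < a * Φ i ^ 2 := by have := hlt.ne; positivity
    obtain ⟨n, hn⟩ := exists_nat_gt (2 * K / (a * Φ i ^ 2))
    rw [div_lt_iff₀ hpos] at hn
    linarith [hind n, (abs_le.1 (hK i)).2, (abs_le.1 (hK (i - n))).1]
  · exact heq
  · exfalso
    have hind : ∀ n : ℕ, Φ i + n * (a * Φ i ^ 2) ≤ Φ (i + n) := by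
      intro n
      induction n with
      | zero => simp
      | succ n ih =>
        have h1 := h (i + n)
        have h2 : Φ i ≤ Φ (i + n) := by
          have : 0 ≤ (n : ℝ) * (a * Φ i ^ 2) := by positivity
          linarith
        have h3 : a * Φ i ^ 2 ≤ a * Φ (i + n) ^ 2 :=
          mul_le_mul_of_nonneg_left (by nlinarith) ha.le
        push_cast at *
        rw [← add_assoc]
        linarith
    have hpos : 0 < a * Φ i ^ 2 := by have := hgt.ne'; positivity
    obtain ⟨n, hn⟩ := exists_nat_gt (2 * K / (a * Φ i ^ 2))
    rw [div_lt_iff₀ hpos] at hn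
    linarith [hind n, (abs_le.1 (hK i)).1, (abs_le.1 (hK (i + n))).2]

/-- A trajectory cannot have only tangential collisions in the future. -/
theorem exists_cos_ne_zero (hQ : Q.FiniteHorizon) {X : ℕ → Q.PhaseSpace}
    (h : ∀ n, ∃ t m, WeakCollision (X n) (X (n + 1)) t m) :
    ∃ n, Real.cos (Q.angle (X n)) ≠ 0 := by
  by_contra! hcos
  -- Tangential collisions do not change the velocity, so the orbit, lifted to the plane, is one
  -- straight segment of length at least n times the minimal flight that avoids all interiors.
  have hind : ∀ n : ℕ, Q.velocity (X n) = Q.velocity (X 0) ∧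
      ∃ (T : ℝ) (M : ℤ × ℤ), n * Q.minFlight ≤ T ∧
      Q.position (X n) + latticeVector M = Q.position (X 0) + T * Q.velocity (X 0) ∧
      ∀ s : ℝ, s ∈ Ioo 0 T → ∀ κ, Q.position (X 0) + s * Q.velocity (X 0) ∉ interior (Q.obstacle κ) := by
    intro n
    induction n with
    | zero =>
      refine ⟨rfl, 0, 0, by simp, by simp [latticeVector_zero], fun s hs => ?_⟩
      exact absurd (hs.1.trans hs.2) (lt_irrefl _)
    | succ n ih =>
      obtain ⟨hv, T, M, hT, hp, hc⟩ := ih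
      obtain ⟨t, m, hw⟩ := h n
      have hv' : Q.velocity (X (n + 1)) = Q.velocity (X n) := by
        rw [hw.velocity_sub, hcos (n + 1)]; simp
      refine ⟨hv'.trans hv, T + t, m + M, ?_, ?_, fun s hs κ hκ => ?_⟩
      · push_cast; linarith [hw.minFlight_le]
      · have := hw.position_eq
        rw [hv] at this
        rw [latticeVector_add]; push_cast
        linear_combination hp - this
      · rcases lt_trichotomy s T with hlt | heq | hgt
        · exact hc s ⟨hs.1, hlt⟩ κ hκ
        -- At a collision point itself, openness of the interior would give an interior point
        -- slightly earlier.
        · have hcont : Continuous fun u : ℝ => Q.position (X 0) + u * Q.velocity (X 0) := by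
            fun_prop
          have h1 : ∀ᶠ u : ℝ in 𝓝[<] s, Q.position (X 0) + u * Q.velocity (X 0) ∈
              interior (Q.obstacle κ) :=
            (hcont.tendsto s).mono_left nhdsWithin_le_nhds (isOpen_interior.mem_nhds hκ)
          obtain ⟨u, h2, h3⟩ := (h1.and (Ioo_mem_nhdsLT hs.1)).exists
          exact hc u ⟨h3.1, heq ▸ h3.2⟩ κ h2
        · have h1 := (interior_obstacle_add (-M)).2 hκ
          refine hw.clear (s - T) ⟨by linarith, by linarith [hs.2]⟩ _
            (Set.mem_of_eq_of_mem ?_ h1)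
          rw [hv, latticeVector_neg]; push_cast
          linear_combination hp
  obtain ⟨n, hn⟩ := exists_nat_gt (maxFlight hQ / Q.minFlight)
  rw [div_lt_iff₀ minFlight_pos] at hn
  obtain ⟨-, T, -, hT, -, hc⟩ := hind n
  obtain ⟨s, hs, κ, hκ⟩ := maxFlight_spec hQ (Q.position (X 0)) (norm_velocity (X 0))
  exact hc s ⟨hs.1, by linarith [hs.2]⟩ κ hκ

/-- Two complete trajectories that meet the same obstacles coincide. -/
theorem eq_of_weakCollision (hQ : Q.FiniteHorizon) {X Y : ℤ → Q.PhaseSpace}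
    (hi : ∀ i, (X i).1 = (Y i).1)
    (h : ∀ i, ∃ t t' m, WeakCollision (X i) (X (i + 1)) t m ∧
      WeakCollision (Y i) (Y (i + 1)) t' m) : X 0 = Y 0 := by
  obtain ⟨R, hR0, hR⟩ := Q.exists_norm_obstacle_bound
  have hstep : ∀ i, ∃ t t' m, WeakCollision (X i) (X (i + 1)) t m ∧
      WeakCollision (Y i) (Y (i + 1)) t' m ∧
      gap (X (i + 1)) (Y (i + 1)) = gap (X i) (Y i) +
      (t + t') / 2 * ‖Q.velocity (X i) - Q.velocity (Y i)‖ ^ 2 -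
      2 * Real.cos (Q.angle (X (i + 1))) * inner ℝ (Q.normal (X (i + 1)))
        (Q.position (Y (i + 1)) - Q.position (X (i + 1))) -
      2 * Real.cos (Q.angle (Y (i + 1))) * inner ℝ (Q.normal (Y (i + 1)))
        (Q.position (X (i + 1)) - Q.position (Y (i + 1))) := fun i => by
    obtain ⟨t, t', m, h1, h2⟩ := h i
    exact ⟨t, t', m, h1, h2, by rw [gap_collision h1 h2, gap_flight h1 h2]⟩
  have hcos : ∀ i, Real.cos (Q.angle (X i)) * inner ℝ (Q.normal (X i))
      (Q.position (Y i) - Q.position (X i)) ≤ 0 := fun i => cos_mul_inner_nonpos (hi i).symm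
  have hcos' : ∀ i, Real.cos (Q.angle (Y i)) * inner ℝ (Q.normal (Y i))
      (Q.position (X i) - Q.position (Y i)) ≤ 0 := fun i => cos_mul_inner_nonpos (hi i)
  have hzero : ∀ i, gap (X i) (Y i) = 0 := by
    -- By Cauchy-Schwarz the pairing is at most 2R |v - v'|, so the increment `minFlight` · |v -
    -- v'|² dominates a multiple of its square. The bound K uses |v - v'| ≤ 2.
    refine eq_zero_of_quadratic_growth (a := Q.minFlight / (2 * R) ^ 2) (K := 2 * (2 * R))
      (div_pos minFlight_pos (by positivity)) (fun i => ?_) (fun i => ?_)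
    · obtain ⟨t, t', m, h1, h2, h3⟩ := hstep i
      have h4 := abs_gap_le hR (X i) (Y i)
      set w := ‖Q.velocity (X i) - Q.velocity (Y i)‖
      have h5 : gap (X i) (Y i) ^ 2 ≤ w ^ 2 * (2 * R) ^ 2 := by
        rw [← mul_pow, ← sq_abs]
        exact pow_le_pow_left₀ (abs_nonneg _) h4 2
      have h6 : Q.minFlight / (2 * R) ^ 2 * gap (X i) (Y i) ^ 2 ≤ Q.minFlight * w ^ 2 := by
        rw [div_mul_eq_mul_div, div_le_iff₀ (by positivity), mul_assoc]
        exact mul_le_mul_of_nonneg_left h5 minFlight_pos.le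
      have h7 : Q.minFlight * w ^ 2 ≤ (t + t') / 2 * w ^ 2 :=
        mul_le_mul_of_nonneg_right (by linarith [h1.minFlight_le, h2.minFlight_le]) (sq_nonneg _)
      linarith [hcos (i + 1), hcos' (i + 1)]
    · refine (abs_gap_le hR _ _).trans (mul_le_mul_of_nonneg_right ?_ (by positivity))
      have := norm_sub_le (Q.velocity (X i)) (Q.velocity (Y i))
      rw [norm_velocity, norm_velocity] at this
      linarith
  -- A constant pairing leaves no room for any of the nonnegative increments: the velocities agree,
  -- and at points with different positions both collisions are tangential.
  have hvel : ∀ i, Q.velocity (X i) = Q.velocity (Y i) := fun i => by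
    obtain ⟨t, t', m, h1, h2, h3⟩ := hstep i
    rw [hzero, hzero] at h3
    have h4 : 0 < (t + t') / 2 := by linarith [h1.pos, h2.pos]
    have h5 : ‖Q.velocity (X i) - Q.velocity (Y i)‖ ^ 2 ≤ 0 := by
      by_contra hpos
      have := mul_pos h4 (not_le.1 hpos)
      linarith [hcos (i + 1), hcos' (i + 1)]
    have h6 : ‖Q.velocity (X i) - Q.velocity (Y i)‖ = 0 :=
      pow_eq_zero_iff two_ne_zero |>.1 (le_antisymm h5 (sq_nonneg _))
    exact sub_eq_zero.1 (norm_eq_zero.1 h6)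
  have htan : ∀ i, Q.position (X i) ≠ Q.position (Y i) → Real.cos (Q.angle (X i)) = 0 := by
    intro i hne
    obtain ⟨t, t', m, h1, h2, h3⟩ := hstep (i - 1)
    rw [hzero, hzero, sub_add_cancel, hvel, sub_self, norm_zero] at h3
    have h4 := inner_normal_lt (X i) (hi i ▸ position_mem_body (Y i)) hne.symm
    have h5 : Real.cos (Q.angle (X i)) * inner ℝ (Q.normal (X i))
      (Q.position (Y i) - Q.position (X i)) = 0 := by linarith [hcos i, hcos' i]
    exact (mul_eq_zero.1 h5).resolve_right h4.ne
  refine phaseSpace_ext (hi 0) ?_ (hvel 0)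
  by_contra hne
  -- Orbits with different positions never meet later: meeting at time n + 1 would make the chord at
  -- time n parallel to the common velocity, which is tangent there, while the chord points strictly
  -- inside.
  have hall : ∀ n : ℕ, Q.position (X n) ≠ Q.position (Y n) := by
    intro n
    induction n with
    | zero => exact hne
    | succ n ih =>
      intro heq
      obtain ⟨t, t', m, h1, h2⟩ := h n
      push_cast at heq
      have h3 : Q.position (Y n) - Q.position (X n) =
          ((t - t' : ℝ) : ℂ) * Q.velocity (X n) := by
        have := h2.position_eq
        rw [← hvel n] at this
        push_cast
        linear_combination this - h1.position_eq - heq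
      have h4 := inner_normal_lt (X n) (hi n ▸ position_mem_body (Y n)) ih.symm
      rw [h3, ← Complex.real_smul, real_inner_smul_right, real_inner_comm,
        inner_velocity_normal, htan n ih, mul_zero] at h4
      exact lt_irrefl _ h4
  obtain ⟨n, hn⟩ := exists_cos_ne_zero hQ (X := fun n => X n) (fun n => by
    obtain ⟨t, t', m, h1, h2⟩ := h n
    exact ⟨t, m, by push_cast; exact h1⟩)
  exact hn (htan n (hall n))

theorem index_iterate_eq (hQ : Q.FiniteHorizon) {x y : Q.PhaseSpace} (hxy : x.1 = y.1) {n : ℕ}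
    (h : ∀ i < n, label (Q.T^[i] x) = label (Q.T^[i] y)) : (Q.T^[n] x).1 = (Q.T^[n] y).1 := by
  cases n with
  | zero => exact hxy
  | succ n =>
    rw [Function.iterate_succ_apply', Function.iterate_succ_apply', T_fst hQ, T_fst hQ,
      h n (Nat.lt_succ_self n)]

/-- Expansivity: two orbit segments of length `2 k` with the same labels are close in the middle. -/
theorem exists_expansive (hQ : Q.FiniteHorizon) {ε : ℝ} (hε : 0 < ε) : ∃ k : ℕ,
    ∀ x y : Q.PhaseSpace, x.1 = y.1 → (∀ i < 2 * k, label (Q.T^[i] x) = label (Q.T^[i] y)) →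
      Q.distance (Q.T^[k] x) (Q.T^[k] y) < ε := by
  by_contra! hcon
  choose x y hxy hlab hdist using hcon
  set 𝒰 := hyperfilter ℕ
  -- The segments are recentred at their middle time k. The truncation `toNat` is harmless, because
  -- k + i is nonnegative for all large k. The limits form two complete orbits of weak collisions
  -- with the same labels.
  have hX : ∀ i : ℤ, ∃ X, Tendsto (fun k : ℕ => Q.T^[(k + i).toNat] (x k)) 𝒰 (𝓝 X) :=
    fun i => 𝒰.exists_tendsto _
  have hY : ∀ i : ℤ, ∃ X, Tendsto (fun k : ℕ => Q.T^[(k + i).toNat] (y k)) 𝒰 (𝓝 X) :=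
    fun i => 𝒰.exists_tendsto _
  choose X hX using hX
  choose Y hY using hY
  have hbig : ∀ i : ℤ, ∀ᶠ k : ℕ in 𝒰, i.natAbs < k := fun i =>
    Nat.hyperfilter_le_atTop (eventually_gt_atTop i.natAbs)
  have hidx : ∀ i, (X i).1 = (Y i).1 := by
    intro i
    obtain ⟨k, ⟨h1, h2⟩, h3⟩ := (((eventually_index_eq (hX i)).and
      (eventually_index_eq (hY i))).and (hbig i)).exists
    rw [← h1, ← h2]
    exact index_iterate_eq hQ (hxy k) fun j hj => hlab k j (by omega)
  obtain ⟨F, hF, hFm⟩ := exists_finite_labels hQ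
  have hmain : X 0 = Y 0 := by
    refine eq_of_weakCollision hQ hidx fun i => ?_
    obtain ⟨κ, -, hκ⟩ := 𝒰.exists_eventually_eq
      (f := fun k : ℕ => label (Q.T^[(k + i).toNat] (x k))) hF (Eventually.of_forall fun k => hFm _)
    have hsucc : ∀ᶠ k : ℕ in 𝒰, ((k : ℤ) + (i + 1)).toNat = ((k : ℤ) + i).toNat + 1 :=
      (hbig i).mono fun k hk => by omega
    obtain ⟨t, -, ht⟩ := WeakCollision.exists_tendsto hQ (m := κ.2) (hX i) (hX (i + 1))
      (t := fun k : ℕ => flight (Q.T^[((k : ℤ) + i).toNat] (x k))) (by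
        filter_upwards [hκ, hsucc] with k h1 h2
        rw [h2, Function.iterate_succ_apply', ← h1]
        exact weakCollision_T hQ _)
    obtain ⟨t', -, ht'⟩ := WeakCollision.exists_tendsto hQ (m := κ.2) (hY i) (hY (i + 1))
      (t := fun k : ℕ => flight (Q.T^[((k : ℤ) + i).toNat] (y k))) (by
        filter_upwards [hκ, hsucc, hbig i] with k h1 h2 h3
        rw [h2, Function.iterate_succ_apply', ← h1, hlab k _ (by omega)]
        exact weakCollision_T hQ _)
    exact ⟨t, t', κ.2, ht, ht'⟩
  have h0 := hX 0
  have h0' := hY 0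
  rw [← hmain] at h0'
  obtain ⟨k, hk⟩ := (eventually_distance_lt h0 h0' hε).exists
  simp only [add_zero, Int.toNat_natCast] at hk
  exact absurd (hdist k) (not_le.2 hk)

/-- If `x`, `y` are close and `T x`, `T y` are close, then `x` and `y` have the same label. -/
theorem exists_label_eq_of_distance (hQ : Q.FiniteHorizon) : ∃ ε : ℝ, 0 < ε ∧
    ∀ x y : Q.PhaseSpace, Q.distance x y ≤ ε → Q.distance (Q.T x) (Q.T y) ≤ ε →
      label x = label y := by
  by_contra! hcon
  have hex : ∀ n : ℕ, ∃ x y : Q.PhaseSpace, Q.distance x y ≤ 1 / (n + 1) ∧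
    Q.distance (Q.T x) (Q.T y) ≤ 1 / (n + 1) ∧ label x ≠ label y := fun n => hcon _ (by positivity)
  choose x y h1 h2 h3 using hex
  obtain ⟨X, hX⟩ := (hyperfilter ℕ).exists_tendsto x
  obtain ⟨Y, hY⟩ := (hyperfilter ℕ).exists_tendsto fun n => Q.T (x n)
  have hnn : ∀ x y : Q.PhaseSpace, 0 ≤ Q.distance x y := fun x y => by
    by_cases h : x.1 = y.1
    · obtain ⟨i, a⟩ := x
      obtain ⟨j, b⟩ := y
      obtain rfl : i = j := h
      rw [distance_mk]; exact dist_nonneg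
    · rw [distance_of_ne h]
      exact mul_nonneg (by positivity) (Real.iSup_nonneg fun _ => Metric.diam_nonneg)
  have hy := tendsto_of_distance hX (tendsto_inv_hyperfilter (fun n => hnn _ _) h1)
  have hTy := tendsto_of_distance hY (tendsto_inv_hyperfilter (fun n => hnn _ _) h2)
  obtain ⟨n, hn⟩ := (eventually_label_eq hQ hX hy hY hTy).exists
  exact h3 n hn

end SinaiTable

/-- A relation that holds locally near the diagonal of a compact space holds on the fibres of a
map with finitely many values. -/
theorem exists_coloring {X : Type*} [TopologicalSpace X] [CompactSpace X] {P : X → X → Prop}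
    (h : ∀ x, ∃ U ∈ 𝓝 x, ∀ y ∈ U, ∀ z ∈ U, P y z) :
    ∃ (N : ℕ) (c : X → Fin N), ∀ y z, c y = c z → P y z := by
  choose U hU hP using h
  obtain ⟨s, hs⟩ := CompactSpace.elim_nhds_subcover U hU
  have hmem : ∀ y, ∃ x : s, y ∈ U x := fun y => by
    have : y ∈ ⋃ x ∈ s, U x := hs.symm ▸ mem_univ y
    obtain ⟨x, hx, hy⟩ := mem_iUnion₂.1 this
    exact ⟨⟨x, hx⟩, hy⟩
  choose f hf using hmem
  refine ⟨Fintype.card s, fun y => Fintype.equivFin s (f y), fun y z hyz => ?_⟩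
  have := (Fintype.equivFin s).injective hyz
  exact hP (f y) y (hf y) z (this ▸ hf z)

/-! ### Uniqueness of orbit segments between grazing collisions -/

namespace Scatterer

variable (S : Scatterer)

/-- Near a boundary point, the tangent vectors at two points differ by a first order amount that
is orthogonal, up to higher order, to the chord. -/
theorem eventually_inner_deriv_sub_le (s₀ : ℝ) {c : ℝ} (hc : 0 < c) :
    ∀ᶠ p : ℝ × ℝ in 𝓝 (s₀, s₀),
      |inner ℝ (deriv S.curve p.1 - deriv S.curve p.2) (S.curve p.1 - S.curve p.2)| ≤
        c * ‖deriv S.curve p.1 - deriv S.curve p.2‖ ^ 2 ∧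
      (deriv S.curve p.1 = deriv S.curve p.2 → p.1 = p.2) := by
  set d2 := deriv (deriv S.curve) s₀ with hd2
  set d1 := deriv S.curve s₀ with hd1
  set k := ‖d2‖ with hk
  have hk0 : 0 < k := by
    rw [hk, norm_pos_iff]
    intro h
    have h1 := S.curvature_positive s₀
    rw [curvature_eq, ← hd2, h] at h1
    simp at h1
  have hperp : inner ℝ d2 d1 = (0 : ℝ) := by
    rw [inner_eq_re_im]; linarith [S.deriv_inner_deriv_deriv s₀]
  -- The bound k / 2 keeps |a| ≥ (k / 2)|Δ|, the bound 1 gives η² ≤ η, and the last bound turns the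
  -- error η (k + 2) Δ² into at most c |a|².
  set η := min (min (k / 2) 1) (c * (k / 2) ^ 2 / (k + 2)) with hη
  have hη0 : 0 < η := by positivity
  have hη1 : η ≤ k / 2 := (min_le_left _ _).trans (min_le_left _ _)
  have hη2 : η ≤ 1 := (min_le_left _ _).trans (min_le_right _ _)
  have hη3 : η * (k + 2) ≤ c * (k / 2) ^ 2 := by
    have : η ≤ c * (k / 2) ^ 2 / (k + 2) := min_le_right _ _
    rwa [le_div_iff₀ (by positivity)] at this
  filter_upwards [(S.hasStrictDerivAt_curve s₀).isLittleO.def hη0,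
    (S.hasStrictDerivAt_deriv s₀).isLittleO.def hη0] with p h1 h2
  set Δ := p.1 - p.2 with hΔ
  set a := deriv S.curve p.1 - deriv S.curve p.2 with ha
  set b := S.curve p.1 - S.curve p.2 with hb
  have h1' : ‖b - Δ • d1‖ ≤ η * |Δ| := h1
  have h2' : ‖a - Δ • d2‖ ≤ η * |Δ| := h2
  have hnd1 : ‖d1‖ = 1 := S.norm_deriv_curve s₀
  have hlow : k / 2 * |Δ| ≤ ‖a‖ := by
    have h3 := norm_sub_le a (a - Δ • d2)
    rw [sub_sub_cancel, norm_smul, Real.norm_eq_abs, ← hk] at h3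
    nlinarith [abs_nonneg Δ]
  refine ⟨?_, fun heq => ?_⟩
  -- The leading term Δ²⟨γ'', γ'⟩ vanishes since γ has unit speed; each of the other terms contains
  -- a factor η.
  · have hsplit : inner ℝ a b = inner ℝ (a - Δ • d2) (b - Δ • d1) +
        Δ * inner ℝ d2 (b - Δ • d1) + Δ * inner ℝ (a - Δ • d2) d1 := by
      simp only [inner_sub_left, inner_sub_right, real_inner_smul_left, real_inner_smul_right,
        hperp]
      ring
    have e1 : |inner ℝ (a - Δ • d2) (b - Δ • d1)| ≤ (η * |Δ|) * (η * |Δ|) :=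
      (abs_real_inner_le_norm _ _).trans (mul_le_mul h2' h1' (norm_nonneg _) (by positivity))
    have e2 : |Δ * inner ℝ d2 (b - Δ • d1)| ≤ |Δ| * (k * (η * |Δ|)) := by
      rw [abs_mul]
      exact mul_le_mul_of_nonneg_left ((abs_real_inner_le_norm _ _).trans
        (mul_le_mul_of_nonneg_left h1' (norm_nonneg _))) (abs_nonneg _)
    have e3 : |Δ * inner ℝ (a - Δ • d2) d1| ≤ |Δ| * (η * |Δ| * 1) := by
      rw [abs_mul]
      refine mul_le_mul_of_nonneg_left ((abs_real_inner_le_norm _ _).trans ?_) (abs_nonneg _)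
      rw [hnd1]
      exact mul_le_mul_of_nonneg_right h2' zero_le_one
    have e4 : |inner ℝ a b| ≤ |Δ| ^ 2 * (η * (k + 2)) := by
      rw [hsplit]
      refine (abs_add_three _ _ _).trans ?_
      have : (η * |Δ|) * (η * |Δ|) ≤ |Δ| ^ 2 * η := by nlinarith [sq_nonneg (|Δ|)]
      nlinarith
    have e5 : (k / 2 * |Δ|) ^ 2 ≤ ‖a‖ ^ 2 := pow_le_pow_left₀ (by positivity) hlow 2
    calc |inner ℝ a b| ≤ |Δ| ^ 2 * (η * (k + 2)) := e4
      _ ≤ |Δ| ^ 2 * (c * (k / 2) ^ 2) := mul_le_mul_of_nonneg_left hη3 (sq_nonneg _)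
      _ = c * (k / 2 * |Δ|) ^ 2 := by ring
      _ ≤ c * ‖a‖ ^ 2 := mul_le_mul_of_nonneg_left e5 hc.le
  · rw [show a = 0 from sub_eq_zero.2 heq, norm_zero] at hlow
    have : |Δ| = 0 := le_antisymm (by nlinarith [abs_nonneg Δ]) (abs_nonneg Δ)
    exact sub_eq_zero.1 (abs_eq_zero.1 this)

end Scatterer

namespace SinaiTable

variable {Q : SinaiTable}

/-- The relation holds uniformly if it holds locally near the diagonal. -/
theorem exists_of_distance_le {P : Q.PhaseSpace → Q.PhaseSpace → Prop}
    (h : ∀ x, ∃ U ∈ 𝓝 x, ∀ y ∈ U, ∀ z ∈ U, P y z) :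
    ∃ ε : ℝ, 0 < ε ∧ ∀ y z, Q.distance y z ≤ ε → P y z := by
  by_contra! hcon
  have hex : ∀ n : ℕ, ∃ y z : Q.PhaseSpace, Q.distance y z ≤ 1 / (n + 1) ∧ ¬P y z :=
    fun n => hcon _ (by positivity)
  choose y z hyz hP using hex
  obtain ⟨X, hX⟩ := (hyperfilter ℕ).exists_tendsto y
  obtain ⟨U, hU, hUP⟩ := h X
  have hz : Tendsto z (hyperfilter ℕ) (𝓝 X) := by
    refine tendsto_of_distance hX ?_
    obtain ⟨c0, hc0, hc⟩ := Q.exists_index_eq_of_distance_lt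
    refine tendsto_inv_hyperfilter (fun n => ?_) hyz
    by_cases hi : (y n).1 = (z n).1
    · obtain ⟨i, a, hi1⟩ : ∃ i, ∃ a : Q.Cylinder i, y n = ⟨i, a⟩ := ⟨_, _, rfl⟩
      obtain ⟨j, b, hi2⟩ : ∃ j, ∃ b : Q.Cylinder j, z n = ⟨j, b⟩ := ⟨_, _, rfl⟩
      rw [hi1, hi2] at hi
      obtain rfl : i = j := hi
      rw [hi1, hi2, distance_mk]
      exact dist_nonneg
    · exact hc0.le.trans (not_lt.1 fun hlt => hi (hc _ _ hlt))
  obtain ⟨n, h1, h2⟩ := ((hX.eventually hU).and (hz.eventually hU)).exists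
  exact hP n (hUP _ h1 _ h2)

theorem phasePoint_surjective (x : Q.PhaseSpace) : ∃ s φ, x = phasePoint x.1 (s : ℝ) φ := by
  obtain ⟨s, hs⟩ := (Q.scatterer x.1).exists_coe x.2.fst
  exact ⟨s, x.2.snd, by rw [hs]; rfl⟩

theorem nhds_phasePoint (i : Fin Q.D) (s : ℝ) (φ : Icc (-(Real.pi / 2)) (Real.pi / 2)) :
    𝓝 (phasePoint (Q := Q) i s φ) =
      map (fun p : ℝ × Icc (-(Real.pi / 2)) (Real.pi / 2) => phasePoint i (p.1 : ℝ) p.2)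
        (𝓝 s ×ˢ 𝓝 φ) := by
  have h1 : 𝓝 ((s : AddCircle (Q.scatterer i).len)) = map (fun u : ℝ =>
    (u : AddCircle (Q.scatterer i).len)) (𝓝 s) := QuotientAddGroup.nhds_eq _ s
  have h2 : 𝓝 (WithLp.toLp 2 ((s : AddCircle (Q.scatterer i).len), φ) : Q.Cylinder i) =
      map (WithLp.toLp 2) (𝓝 ((s : AddCircle (Q.scatterer i).len), φ)) :=
    ((WithLp.homeomorphProd 2 _ _).symm.map_nhds_eq _).symm
  have h3 : map (fun p : ℝ × Icc (-(Real.pi / 2)) (Real.pi / 2) =>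
      ((p.1 : AddCircle (Q.scatterer i).len), p.2)) (𝓝 s ×ˢ 𝓝 φ) =
      𝓝 ((s : AddCircle (Q.scatterer i).len), φ) := by
    rw [nhds_prod_eq, h1]
    exact (prod_map_map_eq (m₂ := fun q : Icc (-(Real.pi / 2)) (Real.pi / 2) => q)).symm.trans
      (by rw [map_id'])
  rw [phasePoint, Sigma.nhds_mk, h2, ← h3, map_map, map_map]
  rfl

theorem velocity_phasePoint (i : Fin Q.D) (s : ℝ) (φ : Icc (-(Real.pi / 2)) (Real.pi / 2)) :
    Q.velocity (phasePoint i s φ) =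
      Complex.exp ((φ : ℝ) * Complex.I) * (Q.scatterer i).normalAt s := rfl

/-- The relation between nearby grazing points that forbids two orbits with the same labels to
start and to end with nearby grazing collisions. -/
def GrazingClose (x y : Q.PhaseSpace) : Prop :=
  x ∈ Q.grazingSet → y ∈ Q.grazingSet →
    |gap x y| ≤ Q.minFlight / 4 * ‖Q.velocity x - Q.velocity y‖ ^ 2 ∧
      (Q.velocity x = Q.velocity y → x = y)

/-- At a grazing point the velocity is plus or minus the unit tangent, with the same sign for all
nearby grazing points, so the estimate for tangents and chords of the boundary curve applies. -/
theorem exists_nhds_grazingClose (X : Q.PhaseSpace) :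
    ∃ U ∈ 𝓝 X, ∀ x ∈ U, ∀ y ∈ U, GrazingClose x y := by
  obtain ⟨s, φ, hX⟩ := phasePoint_surjective X
  generalize X.1 = i at hX
  subst hX
  have key : ∀ᶠ p in 𝓝 (phasePoint (Q := Q) i s φ) ×ˢ 𝓝 (phasePoint (Q := Q) i s φ),
      GrazingClose p.1 p.2 := by
    rw [nhds_phasePoint, prod_map_map_eq, eventually_map]
    have h1 := (Q.scatterer i).eventually_inner_deriv_sub_le s (c := Q.minFlight / 4)
      (by have := minFlight_pos (Q := Q); positivity)
    rw [nhds_prod_eq] at h1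
    have h2 : Tendsto (fun q : (ℝ × Icc (-(Real.pi / 2)) (Real.pi / 2)) ×
        (ℝ × Icc (-(Real.pi / 2)) (Real.pi / 2)) => (q.1.1, q.2.1))
        ((𝓝 s ×ˢ 𝓝 φ) ×ˢ (𝓝 s ×ˢ 𝓝 φ)) (𝓝 s ×ˢ 𝓝 s) :=
      (tendsto_fst.comp tendsto_fst).prodMk (tendsto_fst.comp tendsto_snd)
    have h3 : ∀ᶠ ψ : Icc (-(Real.pi / 2)) (Real.pi / 2) in 𝓝 φ, dist ψ φ < 1 :=
      Metric.ball_mem_nhds φ one_pos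
    filter_upwards [h2.eventually h1, (tendsto_snd.comp tendsto_fst).eventually h3,
      (tendsto_snd.comp tendsto_snd).eventually h3] with q ⟨hq1, hq2⟩ h4 h5
    obtain ⟨⟨u, ψ⟩, ⟨u', ψ'⟩⟩ := q
    intro hx hy
    replace hx : |(ψ : ℝ)| = Real.pi / 2 := hx
    replace hy : |(ψ' : ℝ)| = Real.pi / 2 := hy
    replace h4 : |(ψ : ℝ) - φ| < 1 := h4
    replace h5 : |(ψ' : ℝ) - φ| < 1 := h5
    have hpi := Real.pi_gt_three
    -- Both angles are ±π/2 and differ by less than 2 < π, so they are equal.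
    have hψ : ψ = ψ' := by
      rw [abs_lt] at h4 h5
      apply Subtype.ext
      rcases abs_choice (ψ : ℝ) with h6 | h6 <;> rcases abs_choice (ψ' : ℝ) with h7 | h7 <;>
        rw [h6] at hx <;> rw [h7] at hy <;> linarith
    subst hψ
    obtain ⟨σ, hσ, hvel⟩ : ∃ σ : ℝ, |σ| = 1 ∧ ∀ w : ℝ, Q.velocity (phasePoint i w ψ) =
        (σ : ℂ) * deriv (Q.scatterer i).curve w := by
      rcases abs_choice (ψ : ℝ) with h6 | h6 <;> rw [h6] at hx
      · refine ⟨1, by simp, fun w => ?_⟩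
        rw [velocity_phasePoint, hx, Scatterer.normalAt]
        push_cast
        rw [Complex.exp_pi_div_two_mul_I, ← mul_assoc]
        simp
      · refine ⟨-1, by simp, fun w => ?_⟩
        rw [velocity_phasePoint, show (ψ : ℝ) = -(Real.pi / 2) by linarith, Scatterer.normalAt]
        push_cast
        rw [neg_mul, Complex.exp_neg, Complex.exp_pi_div_two_mul_I, ← mul_assoc]
        simp
    have hσ0 : σ ≠ 0 := fun h => by simp [h] at hσ
    have hdiff : Q.velocity (phasePoint i u ψ) - Q.velocity (phasePoint i u' ψ) =
        σ • (deriv (Q.scatterer i).curve u - deriv (Q.scatterer i).curve u') := by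
      rw [hvel, hvel, Complex.real_smul]; ring
    change |inner ℝ (Q.velocity (phasePoint i u ψ) - Q.velocity (phasePoint i u' ψ))
      ((Q.scatterer i).curve u - (Q.scatterer i).curve u')| ≤ _ *
      ‖Q.velocity (phasePoint i u ψ) - Q.velocity (phasePoint i u' ψ)‖ ^ 2 ∧
      (Q.velocity (phasePoint i u ψ) = Q.velocity (phasePoint i u' ψ) →
        phasePoint (Q := Q) i u ψ = phasePoint i u' ψ)
    refine ⟨?_, fun h => ?_⟩
    · rw [hdiff, real_inner_smul_left, abs_mul, norm_smul, Real.norm_eq_abs, hσ, one_mul, one_mul]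
      exact hq1
    · rw [h, sub_self] at hdiff
      have h6 := (smul_eq_zero.1 hdiff.symm).resolve_left hσ0
      have h7 : u = u' := hq2 (sub_eq_zero.1 h6)
      rw [h7]
  obtain ⟨U, hU, V, hV, hUV⟩ := Filter.mem_prod_iff.1 key
  exact ⟨U ∩ V, inter_mem hU hV, fun x hx y hy => hUV (mk_mem_prod hx.1 hy.2)⟩

theorem gap_step (hQ : Q.FiniteHorizon) {x y : Q.PhaseSpace} (hl : label x = label y) :
    gap x y + Q.minFlight * ‖Q.velocity x - Q.velocity y‖ ^ 2 ≤ gap (Q.T x) (Q.T y) := by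
  have h1 := weakCollision_T hQ x
  have h2 := weakCollision_T hQ y
  rw [← hl] at h2
  have hi : (Q.T x).1 = (Q.T y).1 := by rw [T_fst hQ, T_fst hQ, hl]
  rw [gap_collision h1 h2, gap_flight h1 h2]
  have h3 := cos_mul_inner_nonpos hi
  have h4 := cos_mul_inner_nonpos hi.symm
  have h5 : Q.minFlight * ‖Q.velocity x - Q.velocity y‖ ^ 2 ≤
      (flight x + flight y) / 2 * ‖Q.velocity x - Q.velocity y‖ ^ 2 :=
    mul_le_mul_of_nonneg_right (by linarith [h1.minFlight_le, h2.minFlight_le]) (sq_nonneg _)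
  linarith

theorem velocity_T_of_grazing (hQ : Q.FiniteHorizon) {x : Q.PhaseSpace}
    (h : Q.T x ∈ Q.grazingSet) : Q.velocity (Q.T x) = Q.velocity x := by
  rw [(weakCollision_T hQ x).velocity_sub, (mem_grazingSet_iff _).1 h]; simp

/-- Two orbit segments with the same labels that start and end with grazing collisions are
locally unique. -/
theorem eq_of_grazingClose (hQ : Q.FiniteHorizon) {x y : Q.PhaseSpace} {l : ℕ} (hl : 0 < l)
    (hlab : ∀ i < l, label (Q.T^[i] x) = label (Q.T^[i] y))
    (hx : x ∈ Q.grazingSet) (hy : y ∈ Q.grazingSet)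
    (hx' : Q.T^[l] x ∈ Q.grazingSet) (hy' : Q.T^[l] y ∈ Q.grazingSet)
    (h0 : GrazingClose x y) (h1 : GrazingClose (Q.T^[l] x) (Q.T^[l] y)) : x = y := by
  obtain ⟨h2, h3⟩ := h0 hx hy
  obtain ⟨h4, -⟩ := h1 hx' hy'
  have hτ := minFlight_pos (Q := Q)
  have hstep : ∀ i < l, gap (Q.T^[i] x) (Q.T^[i] y) +
      Q.minFlight * ‖Q.velocity (Q.T^[i] x) - Q.velocity (Q.T^[i] y)‖ ^ 2 ≤
      gap (Q.T^[i + 1] x) (Q.T^[i + 1] y) := fun i hi => by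
    rw [Function.iterate_succ_apply', Function.iterate_succ_apply']
    exact gap_step hQ (hlab i hi)
  have hmono : ∀ j, j < l → gap x y + Q.minFlight * ‖Q.velocity x - Q.velocity y‖ ^ 2 ≤
      gap (Q.T^[j + 1] x) (Q.T^[j + 1] y) := by
    intro j
    induction j with
    | zero => exact fun h => hstep 0 h
    | succ j ih =>
      intro h
      have := hstep (j + 1) h
      have h5 : 0 ≤ Q.minFlight *
        ‖Q.velocity (Q.T^[j + 1] x) - Q.velocity (Q.T^[j + 1] y)‖ ^ 2 := by positivity
      linarith [ih (by omega)]
  obtain ⟨k, rfl⟩ : ∃ k, l = k + 1 := ⟨l - 1, by omega⟩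
  set w := ‖Q.velocity x - Q.velocity y‖ ^ 2 with hw
  set w' := ‖Q.velocity (Q.T^[k] x) - Q.velocity (Q.T^[k] y)‖ ^ 2 with hw'
  -- The last collision is grazing for both orbits and leaves the velocities unchanged.
  have hwl : ‖Q.velocity (Q.T^[k + 1] x) - Q.velocity (Q.T^[k + 1] y)‖ ^ 2 = w' := by
    rw [Function.iterate_succ_apply'] at hx' hy'
    rw [Function.iterate_succ_apply', Function.iterate_succ_apply', velocity_T_of_grazing hQ hx',
      velocity_T_of_grazing hQ hy']
  rw [hwl] at h4
  -- The pairing gains `minFlight` · w on the first flight and `minFlight` · w' on the last. These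
  -- flights coincide for k = 0, so only the mean is claimed. At the two ends its modulus is at most
  -- a quarter of `minFlight` times w and w', which is too little unless both vanish.
  have hsum : gap x y + Q.minFlight * ((w + w') / 2) ≤ gap (Q.T^[k + 1] x) (Q.T^[k + 1] y) := by
    rcases Nat.eq_zero_or_pos k with rfl | hk
    · have := hstep 0 (by omega)
      have hww : w' = w := rfl
      rw [hww, add_self_div_two]
      exact this
    · obtain ⟨j, rfl⟩ : ∃ j, k = j + 1 := ⟨k - 1, by omega⟩
      have h5 := hmono j (by omega)
      have h6 := hstep (j + 1) (by omega)
      have h7 : 0 ≤ Q.minFlight * w := by positivity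
      have h8 : 0 ≤ Q.minFlight * w' := by positivity
      linarith
  have hw0 : w = 0 := by
    have h5 := (abs_le.1 h2).1
    have h6 := (abs_le.1 h4).2
    have h7 : 0 ≤ w := by positivity
    have h8 : 0 ≤ w' := by positivity
    nlinarith
  refine h3 (sub_eq_zero.1 (norm_eq_zero.1 ?_))
  exact pow_eq_zero_iff two_ne_zero |>.1 hw0

end SinaiTable

/-! ### Local connectedness of regions bounded by graphs -/

/-- A planar set with connected vertical fibres over a connected base is connected if its fibres
admit a continuous selection. -/
theorem isPreconnected_of_selection {X Y : Type*} [TopologicalSpace X] [TopologicalSpace Y]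
    {A : Set X} (hA : IsPreconnected A) {N : X → Set Y} (hN : ∀ s ∈ A, IsPreconnected (N s))
    {m : X → Y} (hm : ContinuousOn m A) (hmN : ∀ s ∈ A, m s ∈ N s) :
    IsPreconnected {p : X × Y | p.1 ∈ A ∧ p.2 ∈ N p.1} := by
  rcases A.eq_empty_or_nonempty with rfl | ⟨s₀, hs₀⟩
  · simp [isPreconnected_empty]
  set G : Set (X × Y) := (fun s => (s, m s)) '' A with hG
  have hGc : IsPreconnected G := hA.image _ (continuousOn_id.prodMk hm)
  have hT : ∀ s ∈ A, IsPreconnected (G ∪ (fun y => (s, y)) '' N s) := fun s hs =>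
    IsPreconnected.union (s, m s) ⟨s, hs, rfl⟩ ⟨m s, hmN s hs, rfl⟩ hGc
      ((hN s hs).image _ (by fun_prop))
  have : {p : X × Y | p.1 ∈ A ∧ p.2 ∈ N p.1} =
      ⋃₀ {T | ∃ s ∈ A, T = G ∪ (fun y => (s, y)) '' N s} := by
    ext ⟨s, y⟩
    simp only [mem_ofPred_eq, mem_sUnion]
    constructor
    · rintro ⟨h1, h2⟩
      exact ⟨_, ⟨s, h1, rfl⟩, Or.inr ⟨y, h2, rfl⟩⟩
    · rintro ⟨_, ⟨u, hu, rfl⟩, ⟨w, hw, h⟩ | ⟨w, hw, h⟩⟩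
      · simp only [Prod.mk.injEq] at h
        obtain ⟨rfl, rfl⟩ := h
        exact ⟨hw, hmN _ hw⟩
      · simp only [Prod.mk.injEq] at h
        obtain ⟨rfl, rfl⟩ := h
        exact ⟨hu, hw⟩
  rw [this]
  refine isPreconnected_sUnion (s₀, m s₀) _ ?_ ?_
  · rintro _ ⟨s, hs, rfl⟩
    exact Or.inl ⟨s₀, hs₀, rfl⟩
  · rintro _ ⟨s, hs, rfl⟩
    exact hT s hs

/-- The condition that `φ` lies above (`ε = 1`) or below (`ε = -1`) the value `c`. -/
def SatisfiesCut (c ε : ℝ) (strict : Prop) (φ : ℝ) : Prop :=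
  0 ≤ ε * (φ - c) ∧ (strict → 0 < ε * (φ - c))

theorem satisfiesCut_of_lt {c ε : ℝ} {strict : Prop} {φ : ℝ} (h : 0 < ε * (φ - c)) :
    SatisfiesCut c ε strict φ := ⟨h.le, fun _ => h⟩

theorem ordConnected_satisfiesCut (c ε : ℝ) (strict : Prop) :
    OrdConnected {φ | SatisfiesCut c ε strict φ} := by
  refine ⟨fun x hx y hy z hz => ?_⟩
  obtain ⟨h1, h2⟩ := hx
  obtain ⟨h3, h4⟩ := hy
  rcases le_total 0 ε with hε | hε
  · have : ε * (x - c) ≤ ε * (z - c) := mul_le_mul_of_nonneg_left (by linarith [hz.1]) hε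
    exact ⟨h1.trans this, fun h => (h2 h).trans_le this⟩
  · have : ε * (y - c) ≤ ε * (z - c) := mul_le_mul_of_nonpos_left (by linarith [hz.2]) hε
    exact ⟨h3.trans this, fun h => (h4 h).trans_le this⟩

/-- A region near `(s₀, φ₀)` that is bounded by finitely many graphs through `(s₀, φ₀)` is locally
connected at `(s₀, φ₀)` if each lower and each upper bound are strictly ordered on either side of
`s₀`, and some pair of them is in the wrong order on one side. -/
theorem exists_isPreconnected_wedge {ι : Type*} [Finite ι] {s₀ φ₀ : ℝ} {f : ι → ℝ → ℝ}
    {ε : ι → ℝ} {strict : ι → Prop} (hε : ∀ j, ε j = 1 ∨ ε j = -1)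
    (hcont : ∀ j, ∀ᶠ s in 𝓝 s₀, ContinuousAt (f j) s) (hbase : ∀ j, f j s₀ = φ₀)
    (hright : ∀ j k, ε j = 1 → ε k = -1 →
      (∀ᶠ s in 𝓝[>] s₀, f j s < f k s) ∨ (∀ᶠ s in 𝓝[>] s₀, f k s < f j s))
    (hleft : ∀ j k, ε j = 1 → ε k = -1 →
      (∀ᶠ s in 𝓝[<] s₀, f j s < f k s) ∨ (∀ᶠ s in 𝓝[<] s₀, f k s < f j s))
    (hbad : (∃ j, ε j = 1) → (∃ k, ε k = -1) → ∃ j k, ε j = 1 ∧ ε k = -1 ∧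
      ((∀ᶠ s in 𝓝[>] s₀, f k s < f j s) ∨ (∀ᶠ s in 𝓝[<] s₀, f k s < f j s)))
    {U : Set (ℝ × ℝ)} (hU : U ∈ 𝓝 (s₀, φ₀)) :
    ∃ V ∈ 𝓝 (s₀, φ₀), V ⊆ U ∧
      IsPreconnected (V ∩ {p | ∀ j, SatisfiesCut (f j p.1) (ε j) (strict j) p.2}) := by
  have := Fintype.ofFinite ι
  obtain ⟨U1, hU1, U2, hU2, hU12⟩ := mem_nhds_prod_iff.1 hU
  obtain ⟨η, hη, hηU⟩ := Metric.mem_nhds_iff.1 hU2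
  rw [Real.ball_eq_Ioo] at hηU
  have hall : ∀ᶠ s in 𝓝 s₀, s ∈ U1 ∧ (∀ j, ContinuousAt (f j) s) ∧
      (∀ j, f j s ∈ Ioo (φ₀ - η) (φ₀ + η)) ∧
      (s₀ < s → ∀ j k, ε j = 1 → ε k = -1 → ((∀ᶠ s in 𝓝[>] s₀, f j s < f k s) → f j s < f k s) ∧
        ((∀ᶠ s in 𝓝[>] s₀, f k s < f j s) → f k s < f j s)) ∧
      (s < s₀ → ∀ j k, ε j = 1 → ε k = -1 → ((∀ᶠ s in 𝓝[<] s₀, f j s < f k s) → f j s < f k s) ∧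
        ((∀ᶠ s in 𝓝[<] s₀, f k s < f j s) → f k s < f j s)) := by
    refine (Filter.eventually_mem_set.2 hU1).and ((eventually_all.2 hcont).and
      ((eventually_all.2 fun j => ?_).and (Eventually.and ?_ ?_)))
    · have h1 : Tendsto (f j) (𝓝 s₀) (𝓝 φ₀) := hbase j ▸ (hcont j).self_of_nhds
      exact h1 (Ioo_mem_nhds (by linarith) (by linarith))
    · refine eventually_nhdsWithin_iff.1 (eventually_all.2 fun j => eventually_all.2 fun k => ?_)
      simp only [eventually_imp_distrib_left]
      intro _ _
      exact Eventually.and (by simp only [eventually_imp_distrib_left]; exact id)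
        (by simp only [eventually_imp_distrib_left]; exact id)
    · refine eventually_nhdsWithin_iff.1 (eventually_all.2 fun j => eventually_all.2 fun k => ?_)
      simp only [eventually_imp_distrib_left]
      intro _ _
      exact Eventually.and (by simp only [eventually_imp_distrib_left]; exact id)
        (by simp only [eventually_imp_distrib_left]; exact id)
  obtain ⟨δ, hδ, hδI⟩ := Metric.eventually_nhds_iff_ball.1 hall
  rw [Real.ball_eq_Ioo] at hδI
  set I := Ioo (s₀ - δ) (s₀ + δ) with hI
  set N : ℝ → Set ℝ := fun s => Ioo (φ₀ - η) (φ₀ + η) ∩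
    ⋂ j, {φ | SatisfiesCut (f j s) (ε j) (strict j) φ} with hN
  have hNmem : ∀ s φ, φ ∈ N s ↔ φ ∈ Ioo (φ₀ - η) (φ₀ + η) ∧
      ∀ j, SatisfiesCut (f j s) (ε j) (strict j) φ := fun s φ => by simp [hN]
  -- The largest lower bound and the smallest upper bound of the fibre over s. The value `none`
  -- contributes the edges of the window, which also makes the families nonempty.
  set a : ℝ → ℝ := fun s => Finset.univ.sup' Finset.univ_nonempty fun o : Option ι =>
    o.elim (φ₀ - η) fun j => if ε j = 1 then f j s else φ₀ - η with ha
  set b : ℝ → ℝ := fun s => Finset.univ.inf' Finset.univ_nonempty fun o : Option ι =>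
    o.elim (φ₀ + η) fun j => if ε j = 1 then φ₀ + η else f j s with hb
  have hle_a : ∀ s j, ε j = 1 → f j s ≤ a s := fun s j hj => by
    have := Finset.le_sup' (fun o : Option ι =>
      o.elim (φ₀ - η) fun j => if ε j = 1 then f j s else φ₀ - η) (Finset.mem_univ (some j))
    simpa [hj] using this
  have hle_b : ∀ s j, ε j = -1 → b s ≤ f j s := fun s j hj => by
    have := Finset.inf'_le (fun o : Option ι =>
      o.elim (φ₀ + η) fun j => if ε j = 1 then φ₀ + η else f j s) (Finset.mem_univ (some j))
    have h1 : ¬ε j = 1 := by rw [hj]; norm_num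
    simpa [h1] using this
  have ha0 : ∀ s, φ₀ - η ≤ a s := fun s =>
    Finset.le_sup' (fun o : Option ι =>
      o.elim (φ₀ - η) fun j => if ε j = 1 then f j s else φ₀ - η) (Finset.mem_univ none)
  have hb0 : ∀ s, b s ≤ φ₀ + η := fun s =>
    Finset.inf'_le (fun o : Option ι =>
      o.elim (φ₀ + η) fun j => if ε j = 1 then φ₀ + η else f j s) (Finset.mem_univ none)
  have hIoo : ∀ s, Ioo (a s) (b s) ⊆ N s := fun s φ hφ => by
    rw [hNmem]
    refine ⟨⟨(ha0 s).trans_lt hφ.1, hφ.2.trans_le (hb0 s)⟩, fun j => satisfiesCut_of_lt ?_⟩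
    rcases hε j with h | h
    · rw [h]; linarith [hle_a s j h, hφ.1]
    · rw [h]; linarith [hle_b s j h, hφ.2]
  have hIcc : ∀ s, N s ⊆ Icc (a s) (b s) := fun s φ hφ => by
    rw [hNmem] at hφ
    constructor
    · refine Finset.sup'_le _ _ fun o _ => ?_
      cases o with
      | none => exact hφ.1.1.le
      | some j =>
        change (if ε j = 1 then f j s else φ₀ - η) ≤ φ
        split_ifs with h
        · have := (hφ.2 j).1
          rw [h] at this; linarith
        · exact hφ.1.1.le
    · refine Finset.le_inf' _ _ fun o _ => ?_
      cases o with
      | none => exact hφ.1.2.le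
      | some j =>
        change φ ≤ if ε j = 1 then φ₀ + η else f j s
        split_ifs with h
        · exact hφ.1.2.le
        · have := (hφ.2 j).1
          rw [(hε j).resolve_left h] at this; linarith
  have hmid : ∀ s, (N s).Nonempty → (a s + b s) / 2 ∈ N s := by
    rintro s ⟨φ, hφ⟩
    have h1 := hIcc s hφ
    rcases (h1.1.trans h1.2).lt_or_eq with hlt | heq
    · exact hIoo s ⟨by linarith, by linarith⟩
    · rwa [show (a s + b s) / 2 = φ by linarith [h1.1, h1.2]]
  have hne : ∀ s ∈ I, (∀ j k, ε j = 1 → ε k = -1 → f j s < f k s) → (N s).Nonempty := by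
    intro s hs h
    refine ⟨_, hIoo s (show (a s + b s) / 2 ∈ _ from ?_)⟩
    have hab : a s < b s := by
      have hw := (hδI s hs).2.2.1
      rw [Finset.sup'_lt_iff]
      intro o _
      rw [Finset.lt_inf'_iff]
      intro o' _
      cases o with
      | none =>
        cases o' with
        | none => change φ₀ - η < φ₀ + η; linarith
        | some k =>
          change φ₀ - η < if ε k = 1 then φ₀ + η else f k s
          split_ifs
          · linarith
          · exact (hw k).1
      | some j =>
        change (if ε j = 1 then f j s else φ₀ - η) < _
        cases o' with
        | none =>
          change _ < φ₀ + η
          split_ifs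
          · exact (hw j).2
          · linarith
        | some k =>
          change _ < if ε k = 1 then φ₀ + η else f k s
          split_ifs with h1 h2 h2
          · exact (hw j).2
          · exact h j k h1 ((hε k).resolve_left h2)
          · linarith
          · exact (hw k).1
    constructor <;> linarith
  have hempty : ∀ s j k, ε j = 1 → ε k = -1 → f k s < f j s → ¬(N s).Nonempty := by
    rintro s j k hj hk hlt ⟨φ, hφ⟩
    have h1 := hIcc s hφ
    linarith [h1.1, h1.2, hle_a s j hj, hle_b s k hk]
  set A : Set ℝ := {s | s ∈ I ∧ (N s).Nonempty} with hA
  -- Some pair is in the wrong order on one side of s₀, so the nonempty fibres lie over the other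
  -- side, possibly with s₀. There a pair in the wrong order would empty all fibres; hence a
  -- nonempty fibre forces the correct order of every pair throughout that side.
  have hAord : OrdConnected A := by
    refine ⟨fun x hx y hy z hz => ?_⟩
    have hzI : z ∈ I := ⟨hx.1.1.trans_le hz.1, hz.2.trans_lt hy.1.2⟩
    rcases hz.1.eq_or_lt with rfl | hxz
    · exact hx
    rcases hz.2.eq_or_lt with rfl | hzy
    · exact hy
    refine ⟨hzI, hne z hzI fun j k hj hk => ?_⟩
    obtain ⟨j', k', hj', hk', hbad'⟩ := hbad ⟨j, hj⟩ ⟨k, hk⟩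
    have hx5 := (hδI x hx.1).2.2.2.2
    have hy4 := (hδI y hy.1).2.2.2.1
    rcases hbad' with hb | hb
    · have hys : y ≤ s₀ := by
        by_contra hlt
        exact hempty y j' k' hj' hk' ((hy4 (not_le.1 hlt) j' k' hj' hk').2 hb) hy.2
      have h1 : ∀ᶠ s in 𝓝[<] s₀, f j s < f k s := by
        refine (hleft j k hj hk).resolve_right fun h => ?_
        exact hempty x j k hj hk ((hx5 (by linarith) j k hj hk).2 h) hx.2
      exact ((hδI z hzI).2.2.2.2 (by linarith) j k hj hk).1 h1
    · have hxs : s₀ ≤ x := by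
        by_contra hlt
        exact hempty x j' k' hj' hk' ((hx5 (not_le.1 hlt) j' k' hj' hk').2 hb) hx.2
      have h1 : ∀ᶠ s in 𝓝[>] s₀, f j s < f k s := by
        refine (hright j k hj hk).resolve_right fun h => ?_
        exact hempty y j k hj hk ((hy4 (by linarith) j k hj hk).2 h) hy.2
      exact ((hδI z hzI).2.2.2.1 (by linarith) j k hj hk).1 h1
  have hac : ∀ s ∈ I, ContinuousAt a s := fun s hs =>
    ContinuousAt.finset_sup'_apply _ fun o _ => by
      cases o with
      | none => exact continuousAt_const
      | some j =>
        change ContinuousAt (fun s => if ε j = 1 then f j s else φ₀ - η) s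
        split_ifs
        · exact (hδI s hs).2.1 j
        · exact continuousAt_const
  have hbc : ∀ s ∈ I, ContinuousAt b s := fun s hs =>
    ContinuousAt.finset_inf'_apply _ fun o _ => by
      cases o with
      | none => exact continuousAt_const
      | some j =>
        change ContinuousAt (fun s => if ε j = 1 then φ₀ + η else f j s) s
        split_ifs
        · exact continuousAt_const
        · exact (hδI s hs).2.1 j
  refine ⟨I ×ˢ Ioo (φ₀ - η) (φ₀ + η), prod_mem_nhds (Ioo_mem_nhds (by linarith) (by linarith))
    (Ioo_mem_nhds (by linarith) (by linarith)), ?_, ?_⟩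
  · rintro ⟨s, φ⟩ ⟨h1, h2⟩
    exact hU12 ⟨(hδI s h1).1, hηU h2⟩
  · have hset : I ×ˢ Ioo (φ₀ - η) (φ₀ + η) ∩
        {p | ∀ j, SatisfiesCut (f j p.1) (ε j) (strict j) p.2} =
        {p : ℝ × ℝ | p.1 ∈ A ∧ p.2 ∈ N p.1} := by
      ext ⟨s, φ⟩
      simp only [mem_inter_iff, mem_prod, mem_ofPred_eq, hA, hNmem]
      constructor
      · rintro ⟨⟨h1, h2⟩, h3⟩
        exact ⟨⟨h1, φ, (hNmem _ _).2 ⟨h2, h3⟩⟩, h2, h3⟩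
      · rintro ⟨⟨h1, -⟩, h2, h3⟩
        exact ⟨⟨h1, h2⟩, h3⟩
    rw [hset]
    refine isPreconnected_of_selection hAord.isPreconnected (fun s _ => ?_)
      (m := fun s => (a s + b s) / 2) (fun s hs => ?_) fun s hs => hmid s hs.2
    · exact (OrdConnected.inter ordConnected_Ioo
        (ordConnected_iInter fun j => ordConnected_satisfiesCut _ _ _)).isPreconnected
    · exact (((hac s hs.1).add (hbc s hs.1)).div_const 2).continuousWithinAt

/-- A finite family of graphs through `(s₀, φ₀)` that all cross the level `φ₀` downwards and that
are pairwise ordered on either side of `s₀`. -/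
structure CrossingFamily (s₀ φ₀ : ℝ) {ι : Type*} (f : ι → ℝ → ℝ) : Prop where
  cont : ∀ j, ∀ᶠ s in 𝓝 s₀, ContinuousAt (f j) s
  base : ∀ j, f j s₀ = φ₀
  right : ∀ j, ∀ᶠ s in 𝓝[>] s₀, f j s < φ₀
  left : ∀ j, ∀ᶠ s in 𝓝[<] s₀, φ₀ < f j s
  pair_right : ∀ j k, j ≠ k →
    (∀ᶠ s in 𝓝[>] s₀, f j s < f k s) ∨ (∀ᶠ s in 𝓝[>] s₀, f k s < f j s)
  pair_left : ∀ j k, j ≠ k →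
    (∀ᶠ s in 𝓝[<] s₀, f j s < f k s) ∨ (∀ᶠ s in 𝓝[<] s₀, f k s < f j s)
  -- Applied to both orders of a pair, this says that the two graphs exchange their order at s₀. At
  -- the edges of the strip they need not, but there the edge itself supplies a pair in the wrong
  -- order.
  swap : |φ₀| < Real.pi / 2 → ∀ j k, j ≠ k →
    (∀ᶠ s in 𝓝[>] s₀, f j s < f k s) ∨ (∀ᶠ s in 𝓝[<] s₀, f j s < f k s)

theorem CrossingFamily.of_isEmpty (s₀ φ₀ : ℝ) {ι : Type*} [IsEmpty ι] (f : ι → ℝ → ℝ) :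
    CrossingFamily s₀ φ₀ f :=
  ⟨isEmptyElim, isEmptyElim, isEmptyElim, isEmptyElim, isEmptyElim, isEmptyElim,
    fun _ => isEmptyElim⟩

/-- The boundary components of the strip `|φ| ≤ π / 2` that contain the level `φ₀`. -/
def StripEdge (φ₀ : ℝ) : Type :=
  {b : Bool // φ₀ = if b then Real.pi / 2 else -(Real.pi / 2)}

instance (φ₀ : ℝ) : Finite (StripEdge φ₀) := inferInstanceAs (Finite (Subtype _))

/-- The sign of the cut that a boundary component of the strip defines. -/
def StripEdge.sign {φ₀ : ℝ} (b : StripEdge φ₀) : ℝ := if b.1 then -1 else 1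

theorem StripEdge.sign_eq {φ₀ : ℝ} (b : StripEdge φ₀) : b.sign = 1 ∨ b.sign = -1 := by
  rw [sign]; split_ifs <;> simp

theorem StripEdge.eq_of_sign_one {φ₀ : ℝ} {b : StripEdge φ₀} (h : b.sign = 1) :
    φ₀ = -(Real.pi / 2) := by
  have h1 := b.2
  rw [sign] at h
  split_ifs at h with h2
  · norm_num at h
  · rwa [if_neg h2] at h1

theorem StripEdge.eq_of_sign_neg_one {φ₀ : ℝ} {b : StripEdge φ₀} (h : b.sign = -1) :
    φ₀ = Real.pi / 2 := by
  have h1 := b.2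
  rw [sign] at h
  split_ifs at h with h2
  · rwa [if_pos h2] at h1
  · norm_num at h

/-- A region bounded by a crossing family, by the mirror image of a crossing family and by the
edges of the strip `|φ| ≤ π / 2` is locally connected. -/
theorem exists_isPreconnected_of_crossingFamily {ι ι' : Type*} [Finite ι] [Finite ι'] {s₀ φ₀ : ℝ}
    {f : ι → ℝ → ℝ} {f' : ι' → ℝ → ℝ} (hf : CrossingFamily s₀ φ₀ f)
    (hf' : CrossingFamily s₀ (-φ₀) f') {ε : ι → ℝ} {ε' : ι' → ℝ}
    (hε : ∀ j, ε j = 1 ∨ ε j = -1) (hε' : ∀ j, ε' j = 1 ∨ ε' j = -1)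
    (hφ₀ : |φ₀| ≤ Real.pi / 2) (strict : ι → Prop) (strict' : ι' → Prop) (edge : Prop)
    {U : Set (ℝ × ℝ)} (hU : U ∈ 𝓝 (s₀, φ₀)) :
    ∃ V ∈ 𝓝 (s₀, φ₀), V ⊆ U ∧ IsPreconnected (V ∩
      {p | (∀ j, SatisfiesCut (f j p.1) (ε j) (strict j) p.2) ∧
        (∀ j, SatisfiesCut (-f' j p.1) (ε' j) (strict' j) p.2) ∧
        ∀ b : StripEdge φ₀, SatisfiesCut φ₀ b.sign edge p.2}) := by
  set F : ι ⊕ ι' ⊕ StripEdge φ₀ → ℝ → ℝ :=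
    Sum.elim f (Sum.elim (fun j s => -f' j s) fun _ _ => φ₀) with hF
  set E : ι ⊕ ι' ⊕ StripEdge φ₀ → ℝ := Sum.elim ε (Sum.elim ε' StripEdge.sign) with hE
  set P : ι ⊕ ι' ⊕ StripEdge φ₀ → Prop := Sum.elim strict (Sum.elim strict' fun _ => edge) with hP
  have hfr' : ∀ j, ∀ᶠ s in 𝓝[>] s₀, φ₀ < -f' j s := fun j =>
    (hf'.right j).mono fun s hs => by linarith
  have hfl' : ∀ j, ∀ᶠ s in 𝓝[<] s₀, -f' j s < φ₀ := fun j =>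
    (hf'.left j).mono fun s hs => by linarith
  have hpos := Real.pi_pos
  have hne : ∀ {b b' : StripEdge φ₀}, b.sign = 1 → b'.sign = -1 → False := fun h h' => by
    linarith [StripEdge.eq_of_sign_one h, StripEdge.eq_of_sign_neg_one h']
  have h1 : ∀ j, E j = 1 ∨ E j = -1 := by
    rintro (j | j | b)
    exacts [hε j, hε' j, b.sign_eq]
  have hεne : ∀ {e : ℝ}, e = 1 → e = -1 → False := fun h h' => by linarith
  suffices h : ∃ V ∈ 𝓝 (s₀, φ₀), V ⊆ U ∧
      IsPreconnected (V ∩ {p | ∀ j, SatisfiesCut (F j p.1) (E j) (P j) p.2}) by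
    obtain ⟨V, hV, hVU, hVc⟩ := h
    refine ⟨V, hV, hVU, ?_⟩
    convert hVc using 4 with p
    simp [hF, hE, hP]
  refine exists_isPreconnected_wedge h1 ?_ ?_ ?_ ?_ ?_ hU
  · rintro (j | j | b)
    · exact hf.cont j
    · exact (hf'.cont j).mono fun s hs => hs.neg
    · exact Eventually.of_forall fun s => continuousAt_const
  · rintro (j | j | b)
    · exact hf.base j
    · change -f' j s₀ = φ₀
      rw [hf'.base, neg_neg]
    · rfl
  · rintro (j | j | b) (k | k | c) hj hk
    · exact hf.pair_right j k fun h => hεne hj (h ▸ hk)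
    · exact Or.inl (by filter_upwards [hf.right j, hfr' k] with s h h' using h.trans h')
    · exact Or.inl (hf.right j)
    · exact Or.inr (by filter_upwards [hf.right k, hfr' j] with s h h' using h.trans h')
    · refine (hf'.pair_right j k fun h => hεne hj (h ▸ hk)).symm.imp ?_ ?_ <;>
        exact fun h => h.mono fun s hs => neg_lt_neg hs
    · exact Or.inr (hfr' j)
    · exact Or.inr (hf.right k)
    · exact Or.inl (hfr' k)
    · exact (hne hj hk).elim
  · rintro (j | j | b) (k | k | c) hj hk
    · exact hf.pair_left j k fun h => hεne hj (h ▸ hk)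
    · exact Or.inr (by filter_upwards [hf.left j, hfl' k] with s h h' using h'.trans h)
    · exact Or.inr (hf.left j)
    · exact Or.inl (by filter_upwards [hf.left k, hfl' j] with s h h' using h'.trans h)
    · refine (hf'.pair_left j k fun h => hεne hj (h ▸ hk)).symm.imp ?_ ?_ <;>
        exact fun h => h.mono fun s hs => neg_lt_neg hs
    · exact Or.inl (hfl' j)
    · exact Or.inl (hf.left k)
    · exact Or.inr (hfl' k)
    · exact (hne hj hk).elim
  -- Inside the strip, two graphs of the same family exchange their order and graphs of different
  -- families cross the level in opposite directions. On an edge, any graph paired with that edge is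
  -- in the wrong order on one side.
  · rintro ⟨j, hj⟩ ⟨k, hk⟩
    rcases hφ₀.lt_or_eq with hlt | heq
    · have hlt' : |-φ₀| < Real.pi / 2 := by rwa [abs_neg]
      refine ⟨j, k, hj, hk, ?_⟩
      have hedge : ∀ b : StripEdge φ₀, False := fun b => by
        rw [abs_lt] at hlt
        rcases b.sign_eq with h | h
        · linarith [StripEdge.eq_of_sign_one h]
        · linarith [StripEdge.eq_of_sign_neg_one h]
      rcases j with (j | j | b) <;> rcases k with (k | k | c)
      · exact hf.swap hlt k j fun h => hεne hj (h ▸ hk)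
      · exact Or.inr (by filter_upwards [hf.left j, hfl' k] with s h h' using h'.trans h)
      · exact (hedge c).elim
      · exact Or.inl (by filter_upwards [hf.right k, hfr' j] with s h h' using h.trans h')
      · refine (hf'.swap hlt' j k fun h => hεne hj (h ▸ hk)).imp ?_ ?_ <;>
          exact fun h => h.mono fun s hs => neg_lt_neg hs
      · exact (hedge c).elim
      · exact (hedge b).elim
      · exact (hedge b).elim
      · exact (hedge b).elim
    · rcases abs_eq (by positivity) |>.1 heq with h | h
      · set c : StripEdge φ₀ := ⟨true, by simp [h]⟩
        have hc : c.sign = -1 := by simp [c, StripEdge.sign]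
        refine ⟨j, Sum.inr (Sum.inr c), hj, hc, ?_⟩
        rcases j with (j | j | b)
        · exact Or.inr (hf.left j)
        · exact Or.inl (hfr' j)
        · exact (hne hj hc).elim
      · set c : StripEdge φ₀ := ⟨false, by simp [h]⟩
        have hc : c.sign = 1 := by simp [c, StripEdge.sign]
        refine ⟨Sum.inr (Sum.inr c), k, hc, hk, ?_⟩
        rcases k with (k | k | b)
        · exact Or.inl (hf.right k)
        · exact Or.inr (hfl' k)
        · exact (hne hc hk).elim

/-! ### Rays from the boundary that touch a convex body -/

namespace Scatterer

variable (S : Scatterer)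

/-- The unit vector at `S.curve s` that makes the angle `φ` with the outer normal. -/
def dirAt (s φ : ℝ) : ℂ := Complex.exp (φ * Complex.I) * S.normalAt s

/-- The point `z` in the frame at `S.curve s` whose first axis makes the angle `φ` with the
outer normal. -/
def sight (φ s : ℝ) (z : ℂ) : ℂ := (z - S.curve s) * (starRingEnd ℂ) (S.dirAt s φ)

theorem norm_dirAt (s φ : ℝ) : ‖S.dirAt s φ‖ = 1 := by
  rw [dirAt, norm_mul, norm_normalAt, Complex.norm_exp_ofReal_mul_I, one_mul]

theorem dirAt_mul_conj (s φ : ℝ) : S.dirAt s φ * (starRingEnd ℂ) (S.dirAt s φ) = 1 := by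
  rw [Complex.mul_conj, Complex.normSq_eq_norm_sq, norm_dirAt]; simp

theorem dirAt_ne_zero (s φ : ℝ) : S.dirAt s φ ≠ 0 := fun h => by
  simpa [h] using S.norm_dirAt s φ

theorem dirAt_eq_exp_mul (s φ ψ : ℝ) :
    S.dirAt s φ = Complex.exp (((φ - ψ : ℝ) : ℂ) * Complex.I) * S.dirAt s ψ := by
  rw [dirAt, dirAt, ← mul_assoc, ← Complex.exp_add]
  congr 2
  push_cast; ring

theorem continuous_dirAt : Continuous fun p : ℝ × ℝ => S.dirAt p.1 p.2 :=
  (Complex.continuous_exp.comp ((Complex.continuous_ofReal.comp continuous_snd).mul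
    continuous_const)).mul (S.continuous_normalAt.comp continuous_fst)

theorem continuous_sight (φ : ℝ) : Continuous fun p : ℝ × ℂ => S.sight φ p.1 p.2 :=
  (continuous_snd.sub (S.continuous_curve.comp continuous_fst)).mul
    (Complex.continuous_conj.comp (S.continuous_dirAt.comp (continuous_fst.prodMk continuous_const)))

theorem eq_add_sight_mul (φ s : ℝ) (z : ℂ) : z = S.curve s + S.sight φ s z * S.dirAt s φ := by
  rw [sight, mul_assoc, mul_comm ((starRingEnd ℂ) _), dirAt_mul_conj]; ring

theorem sight_add_mul (φ s : ℝ) (w : ℂ) : S.sight φ s (S.curve s + w * S.dirAt s φ) = w := by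
  rw [sight, add_sub_cancel_left, mul_assoc, dirAt_mul_conj, mul_one]

theorem norm_sight_sub (φ s : ℝ) (z w : ℂ) : ‖S.sight φ s z - S.sight φ s w‖ = ‖z - w‖ := by
  have : S.sight φ s z - S.sight φ s w = (z - w) * (starRingEnd ℂ) (S.dirAt s φ) := by
    rw [sight, sight]; ring
  rw [this, norm_mul, RCLike.norm_conj, norm_dirAt, mul_one]

theorem sight_convexCombo (φ s : ℝ) (z w : ℂ) {a b : ℝ} (hab : a + b = 1) :
    S.sight φ s (a • z + b • w) = a • S.sight φ s z + b • S.sight φ s w := by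
  have : (a : ℂ) + b = 1 := by exact_mod_cast hab
  simp only [sight, Complex.real_smul]
  linear_combination (S.curve s * (starRingEnd ℂ) (S.dirAt s φ)) * this

theorem deriv_deriv_eq (s : ℝ) : deriv (deriv S.curve) s =
    S.curvature s * Complex.I * deriv S.curve s := by
  apply Complex.ext
  · rw [deriv_deriv_re]; simp [Complex.mul_re, Complex.mul_im]
  · rw [deriv_deriv_im]; simp [Complex.mul_re, Complex.mul_im]

theorem hasDerivAt_dirAt (φ s : ℝ) : HasDerivAt (fun u => S.dirAt u φ)
    (S.curvature s * Complex.I * S.dirAt s φ) s := by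
  have h := (((S.hasStrictDerivAt_deriv s).hasDerivAt.const_mul (-Complex.I)).const_mul
    (Complex.exp (φ * Complex.I)))
  refine h.congr_deriv ?_
  rw [dirAt, normalAt, deriv_deriv_eq]; ring

/-- This is the dispersing property: as the base point moves along the boundary at a fixed angle,
translation and rotation of the frame both lower every point in front of it, at the rate cos φ plus
curvature times distance along the ray. -/
theorem hasDerivAt_sight_im (φ s : ℝ) (z : ℂ) : HasDerivAt (fun u => (S.sight φ u z).im)
    (-Real.cos φ - S.curvature s * (S.sight φ s z).re) s := by
  have h1 : HasDerivAt (fun u => (starRingEnd ℂ) (S.dirAt u φ))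
      ((starRingEnd ℂ) (S.curvature s * Complex.I * S.dirAt s φ)) s :=
    Complex.conjCLE.toContinuousLinearMap.hasFDerivAt.comp_hasDerivAt s (S.hasDerivAt_dirAt φ s)
  have h2 := ((S.hasDerivAt_curve s).const_sub z).mul h1
  have h3 := Complex.imCLM.hasFDerivAt.comp_hasDerivAt s h2
  have h4 : -deriv S.curve s * (starRingEnd ℂ) (S.dirAt s φ) +
      (z - S.curve s) * (starRingEnd ℂ) (S.curvature s * Complex.I * S.dirAt s φ) =
      -(Complex.I * (starRingEnd ℂ) (Complex.exp (φ * Complex.I))) -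
        S.curvature s * Complex.I * S.sight φ s z := by
    have h5 : S.normalAt s * (starRingEnd ℂ) (S.normalAt s) = 1 := by
      rw [Complex.mul_conj, Complex.normSq_eq_norm_sq, norm_normalAt]; simp
    have h6 : deriv S.curve s = Complex.I * S.normalAt s := by
      rw [normalAt, ← mul_assoc]; simp
    simp only [sight, h6, dirAt, map_mul, Complex.conj_I, Complex.conj_ofReal]
    linear_combination (-Complex.I * (starRingEnd ℂ) (Complex.exp (φ * Complex.I))) * h5
  refine h3.congr_deriv ?_
  rw [Complex.imCLM_apply]
  rw [h4]
  simp [Complex.mul_im, Complex.exp_ofReal_mul_I_re, Complex.exp_ofReal_mul_I_im]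

end Scatterer

theorem arctan_lt_arctan_iff_cross {w z : ℂ} (hw : 0 < w.re) (hz : 0 < z.re) :
    Real.arctan (w.im / w.re) < Real.arctan (z.im / z.re) ↔ 0 < w.re * z.im - w.im * z.re := by
  rw [Real.arctan_strictMono.lt_iff_lt, div_lt_div_iff₀ hw hz]
  constructor <;> intro h <;> linarith

theorem lt_arctan_iff_im_pos {w : ℂ} (hw : 0 < w.re) {θ : ℝ}
    (hθ : θ ∈ Ioo (-(Real.pi / 2)) (Real.pi / 2)) :
    θ < Real.arctan (w.im / w.re) ↔ 0 < w.im * Real.cos θ - w.re * Real.sin θ := by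
  have hc : 0 < Real.cos θ := Real.cos_pos_of_mem_Ioo hθ
  nth_rewrite 1 [← Real.arctan_tan hθ.1 hθ.2]
  rw [Real.arctan_strictMono.lt_iff_lt, Real.tan_eq_sin_div_cos, div_lt_div_iff₀ hc hw]
  constructor <;> intro h <;> linarith

theorem arctan_lt_iff_im_neg {w : ℂ} (hw : 0 < w.re) {θ : ℝ}
    (hθ : θ ∈ Ioo (-(Real.pi / 2)) (Real.pi / 2)) :
    Real.arctan (w.im / w.re) < θ ↔ w.im * Real.cos θ - w.re * Real.sin θ < 0 := by
  have hc : 0 < Real.cos θ := Real.cos_pos_of_mem_Ioo hθ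
  nth_rewrite 1 [← Real.arctan_tan hθ.1 hθ.2]
  rw [Real.arctan_strictMono.lt_iff_lt, Real.tan_eq_sin_div_cos, div_lt_div_iff₀ hw hc]
  constructor <;> intro h <;> linarith

namespace Scatterer

variable (S : Scatterer)

theorem continuous_sight_all : Continuous fun p : (ℝ × ℝ) × ℂ => S.sight p.1.2 p.1.1 p.2 :=
  (continuous_snd.sub (S.continuous_curve.comp (continuous_fst.comp continuous_fst))).mul
    (Complex.continuous_conj.comp (S.continuous_dirAt.comp continuous_fst))

theorem sight_im_eq (φ ψ s : ℝ) (z : ℂ) : (S.sight φ s z).im =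
    (S.sight ψ s z).im * Real.cos (φ - ψ) - (S.sight ψ s z).re * Real.sin (φ - ψ) := by
  have : S.sight φ s z =
      S.sight ψ s z * (starRingEnd ℂ) (Complex.exp (((φ - ψ : ℝ) : ℂ) * Complex.I)) := by
    rw [sight, S.dirAt_eq_exp_mul s φ ψ, map_mul, sight]; ring
  rw [this, Complex.mul_im, Complex.conj_re, Complex.conj_im, Complex.exp_ofReal_mul_I_re,
    Complex.exp_ofReal_mul_I_im]
  ring

/-- The ray that leaves `S.curve s₀` at the angle `φ₀` touches the strictly convex body `B` at
distance `t`; seen along the ray, `B` lies on the left for `σ = 1` and on the right for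
`σ = -1`. -/
structure Touches (B : Set ℂ) (s₀ φ₀ t σ : ℝ) : Prop where
  isCompact : IsCompact B
  strictConvex : StrictConvex ℝ B
  angle_le : |φ₀| ≤ Real.pi / 2
  pos : 0 < t
  mem : S.curve s₀ + t * S.dirAt s₀ φ₀ ∈ B
  sign : σ = 1 ∨ σ = -1
  side : ∀ z ∈ B, z ≠ S.curve s₀ + t * S.dirAt s₀ φ₀ → 0 < σ * (S.sight φ₀ s₀ z).im
  nontrivial : ∃ z ∈ B, z ≠ S.curve s₀ + t * S.dirAt s₀ φ₀

/-- The part of `B` within `ρ` of the point at distance `t` on a ray. -/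
def nearPart (B : Set ℂ) (s₀ φ₀ t ρ : ℝ) : Set ℂ :=
  B ∩ Metric.closedBall (S.curve s₀ + t * S.dirAt s₀ φ₀) ρ

/-- The angle of the ray from `S.curve s` that touches `B`. -/
def cut (B : Set ℂ) (s₀ φ₀ t ρ σ s : ℝ) : ℝ :=
  φ₀ + σ * sInf ((fun z => σ * Real.arctan
    ((S.sight φ₀ s z).im / max (S.sight φ₀ s z).re ((t - ρ) / 2))) '' S.nearPart B s₀ φ₀ t ρ)

variable {S} {B : Set ℂ} {s₀ φ₀ t ρ σ : ℝ}

namespace Touches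

theorem isCompact_nearPart (h : S.Touches B s₀ φ₀ t σ) : IsCompact (S.nearPart B s₀ φ₀ t ρ) :=
  h.isCompact.inter_right Metric.isClosed_closedBall

theorem mem_nearPart (h : S.Touches B s₀ φ₀ t σ) (hρ : 0 < ρ) :
    S.curve s₀ + t * S.dirAt s₀ φ₀ ∈ S.nearPart B s₀ φ₀ t ρ :=
  ⟨h.mem, Metric.mem_closedBall_self hρ.le⟩

theorem side_le (h : S.Touches B s₀ φ₀ t σ) {z : ℂ} (hz : z ∈ B) :
    0 ≤ σ * (S.sight φ₀ s₀ z).im := by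
  by_cases hne : z = S.curve s₀ + t * S.dirAt s₀ φ₀
  · rw [hne, sight_add_mul]; simp
  · exact (h.side z hz hne).le

theorem abs_re_sub_le {z : ℂ} (hz : z ∈ S.nearPart B s₀ φ₀ t ρ) :
    |(S.sight φ₀ s₀ z).re - t| ≤ ρ := by
  have h1 := S.norm_sight_sub φ₀ s₀ z (S.curve s₀ + t * S.dirAt s₀ φ₀)
  have h2 := Complex.abs_re_le_norm (S.sight φ₀ s₀ z -
    S.sight φ₀ s₀ (S.curve s₀ + t * S.dirAt s₀ φ₀))
  rw [h1, Complex.sub_re, sight_add_mul, Complex.ofReal_re, ← dist_eq_norm] at h2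
  exact h2.trans hz.2

theorem eventually_re (h : S.Touches B s₀ φ₀ t σ) (hρt : ρ < t) :
    ∀ᶠ p : ℝ × ℝ in 𝓝 (s₀, φ₀), ∀ z ∈ S.nearPart B s₀ φ₀ t ρ,
      (t - ρ) / 2 < (S.sight p.2 p.1 z).re := by
  refine h.isCompact_nearPart.eventually_forall_of_forall_eventually fun z hz => ?_
  refine (Complex.continuous_re.comp S.continuous_sight_all).continuousAt.eventually
    (lt_mem_nhds ?_)
  have := abs_le.1 (abs_re_sub_le hz)
  change _ < (S.sight φ₀ s₀ z).re
  linarith [this.1]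

theorem eventually_re_left (h : S.Touches B s₀ φ₀ t σ) (hρt : ρ < t) :
    ∀ᶠ s in 𝓝 s₀, ∀ z ∈ S.nearPart B s₀ φ₀ t ρ, (t - ρ) / 2 < (S.sight φ₀ s z).re :=
  (Continuous.prodMk_left φ₀).continuousAt.eventually (h.eventually_re hρt)

/-- Outside a ball about the contact point the body is compact and strictly on one side of the ray,
so nearby rays can meet only the near part. -/
theorem eventually_far (h : S.Touches B s₀ φ₀ t σ) (hρ : 0 < ρ) :
    ∀ᶠ p : ℝ × ℝ in 𝓝 (s₀, φ₀), ∀ z ∈ B, z ∉ S.nearPart B s₀ φ₀ t ρ →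
      0 < σ * (S.sight p.2 p.1 z).im := by
  have hK : IsCompact (B \ Metric.ball (S.curve s₀ + t * S.dirAt s₀ φ₀) ρ) :=
    h.isCompact.diff Metric.isOpen_ball
  have h1 : ∀ᶠ p : ℝ × ℝ in 𝓝 (s₀, φ₀), ∀ z ∈ B \ Metric.ball (S.curve s₀ + t * S.dirAt s₀ φ₀) ρ,
      0 < σ * (S.sight p.2 p.1 z).im := by
    refine hK.eventually_forall_of_forall_eventually fun z hz => ?_
    refine (continuous_const.mul (Complex.continuous_im.comp
      S.continuous_sight_all)).continuousAt.eventually (lt_mem_nhds ?_)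
    refine h.side z hz.1 fun he => hz.2 ?_
    rw [he]; exact Metric.mem_ball_self hρ
  filter_upwards [h1] with p hp z hz hzK
  exact hp z ⟨hz, fun hb => hzK ⟨hz, Metric.ball_subset_closedBall hb⟩⟩

/-- The lower bound imposed on the denominator makes the angle continuous for all s, and the infimum
of a jointly continuous function over a compact set depends continuously on the parameter. -/
theorem continuous_cut (h : S.Touches B s₀ φ₀ t σ) (hρt : ρ < t) :
    Continuous (S.cut B s₀ φ₀ t ρ σ) := by
  refine continuous_const.add (continuous_const.mul ?_)
  refine h.isCompact_nearPart.continuous_sInf (f := fun s z => σ * Real.arctan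
    ((S.sight φ₀ s z).im / max (S.sight φ₀ s z).re ((t - ρ) / 2))) ?_
  refine continuous_const.mul (Real.continuous_arctan.comp (Continuous.div
    (Complex.continuous_im.comp (S.continuous_sight φ₀))
    ((Complex.continuous_re.comp (S.continuous_sight φ₀)).max continuous_const) fun p => ?_))
  exact (lt_max_of_lt_right (by linarith)).ne'

theorem sign_mul_self (h : S.Touches B s₀ φ₀ t σ) : σ * σ = 1 := by
  rcases h.sign with rfl | rfl <;> norm_num

/-- Near s₀ the bound on the denominator is inactive, and compactness makes the infimum a minimum.
-/
theorem cut_spec (h : S.Touches B s₀ φ₀ t σ) (hρ : 0 < ρ) (hρt : ρ < t) :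
    ∀ᶠ s in 𝓝 s₀, (∀ z ∈ S.nearPart B s₀ φ₀ t ρ, σ * (S.cut B s₀ φ₀ t ρ σ s - φ₀) ≤
      σ * Real.arctan ((S.sight φ₀ s z).im / (S.sight φ₀ s z).re)) ∧
      ∃ z ∈ S.nearPart B s₀ φ₀ t ρ, σ * (S.cut B s₀ φ₀ t ρ σ s - φ₀) =
        σ * Real.arctan ((S.sight φ₀ s z).im / (S.sight φ₀ s z).re) := by
  filter_upwards [h.eventually_re_left hρt] with s hs
  set q : ℂ → ℝ := fun z => σ * Real.arctan
    ((S.sight φ₀ s z).im / max (S.sight φ₀ s z).re ((t - ρ) / 2)) with hq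
  have hqe : ∀ z ∈ S.nearPart B s₀ φ₀ t ρ,
      q z = σ * Real.arctan ((S.sight φ₀ s z).im / (S.sight φ₀ s z).re) := fun z hz => by
    rw [hq]; simp only; rw [max_eq_left (hs z hz).le]
  have hcut : σ * (S.cut B s₀ φ₀ t ρ σ s - φ₀) = sInf (q '' S.nearPart B s₀ φ₀ t ρ) := by
    rw [cut, add_sub_cancel_left, ← mul_assoc, h.sign_mul_self, one_mul]
  have hqc : Continuous q := by
    refine continuous_const.mul (Real.continuous_arctan.comp (Continuous.div
      (Complex.continuous_im.comp ((S.continuous_sight φ₀).comp (Continuous.prodMk_right s)))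
      ((Complex.continuous_re.comp ((S.continuous_sight φ₀).comp
        (Continuous.prodMk_right s))).max continuous_const) fun p => ?_))
    exact (lt_max_of_lt_right (by linarith)).ne'
  have hcpt := h.isCompact_nearPart (ρ := ρ) |>.image hqc
  rw [hcut]
  refine ⟨fun z hz => hqe z hz ▸ csInf_le hcpt.bddBelow (mem_image_of_mem q hz), ?_⟩
  obtain ⟨z, hz, hze⟩ := hcpt.sInf_mem ⟨_, mem_image_of_mem q (h.mem_nearPart hρ)⟩
  exact ⟨z, hz, by rw [← hze, hqe z hz]⟩

/-- At s₀ the contact point is seen at angle 0 and no other point is on the wrong side of the ray.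
-/
theorem cut_base (h : S.Touches B s₀ φ₀ t σ) (hρ : 0 < ρ) (hρt : ρ < t) :
    S.cut B s₀ φ₀ t ρ σ s₀ = φ₀ := by
  obtain ⟨h1, z, hz, h2⟩ := (h.cut_spec hρ hρt).self_of_nhds
  have h3 := h1 _ (h.mem_nearPart hρ)
  rw [sight_add_mul, Complex.ofReal_im, zero_div, Real.arctan_zero, mul_zero] at h3
  have hre := (h.eventually_re_left hρt).self_of_nhds z hz
  have h4 : 0 ≤ σ * Real.arctan ((S.sight φ₀ s₀ z).im / (S.sight φ₀ s₀ z).re) := by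
    have h5 := h.side_le hz.1
    have h6 : 0 < (S.sight φ₀ s₀ z).re := by linarith
    rcases h.sign with rfl | rfl
    · rw [one_mul] at h5 ⊢
      exact Real.arctan_nonneg.2 (div_nonneg h5 h6.le)
    · have : Real.arctan ((S.sight φ₀ s₀ z).im / (S.sight φ₀ s₀ z).re) ≤ 0 :=
        Real.arctan_le_zero.2 (div_nonpos_of_nonpos_of_nonneg (by linarith) h6.le)
      linarith
  have h5 : σ * (S.cut B s₀ φ₀ t ρ σ s₀ - φ₀) = 0 := le_antisymm h3 (h2 ▸ h4)
  rcases mul_eq_zero.1 h5 with h6 | h6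
  · rcases h.sign with rfl | rfl <;> norm_num at h6
  · linarith

theorem eventually_im_lt (h : S.Touches B s₀ φ₀ t σ) (hρt : ρ < t) :
    ∀ᶠ s in 𝓝 s₀, ∀ z ∈ S.nearPart B s₀ φ₀ t ρ,
      (s₀ < s → (S.sight φ₀ s z).im < (S.sight φ₀ s₀ z).im) ∧
      (s < s₀ → (S.sight φ₀ s₀ z).im < (S.sight φ₀ s z).im) := by
  obtain ⟨δ, hδ, hI⟩ := Metric.eventually_nhds_iff_ball.1 (h.eventually_re_left hρt)
  rw [Real.ball_eq_Ioo] at hI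
  have hcos : 0 ≤ Real.cos φ₀ :=
    Real.cos_nonneg_of_mem_Icc ⟨by linarith [(_root_.abs_le.1 h.angle_le).1], (_root_.abs_le.1 h.angle_le).2⟩
  filter_upwards [Ioo_mem_nhds (show s₀ - δ < s₀ by linarith) (show s₀ < s₀ + δ by linarith)]
    with s hs z hz
  have hanti : StrictAntiOn (fun u => (S.sight φ₀ u z).im) (Ioo (s₀ - δ) (s₀ + δ)) := by
    refine strictAntiOn_of_deriv_neg (convex_Ioo _ _)
      (fun u _ => (S.hasDerivAt_sight_im φ₀ u z).continuousAt.continuousWithinAt) fun u hu => ?_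
    rw [(S.hasDerivAt_sight_im φ₀ u z).deriv]
    rw [interior_Ioo] at hu
    have := mul_pos (S.curvature_positive u)
      (lt_trans (by linarith : (0 : ℝ) < (t - ρ) / 2) (hI u hu z hz))
    linarith
  have h0 : s₀ ∈ Ioo (s₀ - δ) (s₀ + δ) := ⟨by linarith, by linarith⟩
  exact ⟨fun hlt => hanti h0 hs hlt, fun hlt => hanti hs h0 hlt⟩

/-- All points of the near part sink as s increases. On one side of s₀ the contact point alone gives
the sign of the extremal angle; on the other side every point has moved in the same direction from
its side of the ray. -/
theorem cut_lt_iff (h : S.Touches B s₀ φ₀ t σ) (hρ : 0 < ρ) (hρt : ρ < t) : ∀ᶠ s in 𝓝 s₀,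
    (s₀ < s → S.cut B s₀ φ₀ t ρ σ s < φ₀) ∧ (s < s₀ → φ₀ < S.cut B s₀ φ₀ t ρ σ s) := by
  filter_upwards [h.cut_spec hρ hρt, h.eventually_im_lt hρt, h.eventually_re_left hρt]
    with s ⟨h1, z, hz, h2⟩ h3 hre
  have hpos : ∀ z ∈ S.nearPart B s₀ φ₀ t ρ, 0 < (S.sight φ₀ s z).re := fun z hz =>
    lt_trans (by linarith) (hre z hz)
  have h4 := h.mem_nearPart hρ
  have h5 := h1 _ h4
  have h6 := h3 _ h4
  have h7 := h3 z hz
  have h8 := h.side_le hz.1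
  have h0 : (S.sight φ₀ s₀ (S.curve s₀ + t * S.dirAt s₀ φ₀)).im = 0 := by
    rw [sight_add_mul, Complex.ofReal_im]
  rw [h0] at h6
  have key : ∀ z ∈ S.nearPart B s₀ φ₀ t ρ, ((S.sight φ₀ s z).im < 0 →
      Real.arctan ((S.sight φ₀ s z).im / (S.sight φ₀ s z).re) < 0) ∧ (0 < (S.sight φ₀ s z).im →
      0 < Real.arctan ((S.sight φ₀ s z).im / (S.sight φ₀ s z).re)) := fun z hz =>
    ⟨fun hlt => Real.arctan_lt_zero.2 (div_neg_of_neg_of_pos hlt (hpos z hz)),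
      fun hlt => Real.arctan_pos.2 (div_pos hlt (hpos z hz))⟩
  rcases h.sign with rfl | rfl
  · refine ⟨fun hs => ?_, fun hs => ?_⟩
    · linarith [(key _ h4).1 (h6.1 hs)]
    · linarith [(key _ hz).2 (by linarith [h7.2 hs])]
  · refine ⟨fun hs => ?_, fun hs => ?_⟩
    · linarith [(key _ hz).1 (by linarith [h7.1 hs])]
    · linarith [(key _ h4).2 (h6.2 hs)]

/-- The angle of the ray from `S.curve s` to a body is compared with the angle of the ray to a
reference point on the original ray. -/
theorem cut_compare (h : S.Touches B s₀ φ₀ t σ) (hρ : 0 < ρ) (hρt : ρ < t) {c η : ℝ} (hc : 0 < c)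
    (hη : ∀ z ∈ S.nearPart B s₀ φ₀ t ρ, 0 < η * (c - (S.sight φ₀ s₀ z).re)) :
    ∀ᶠ s in 𝓝 s₀,
      (0 < η * (S.sight φ₀ s₀ (S.curve s)).im → S.cut B s₀ φ₀ t ρ σ s < φ₀ + Real.arctan
        ((S.sight φ₀ s (S.curve s₀ + c * S.dirAt s₀ φ₀)).im /
          (S.sight φ₀ s (S.curve s₀ + c * S.dirAt s₀ φ₀)).re)) ∧
      (η * (S.sight φ₀ s₀ (S.curve s)).im < 0 → φ₀ + Real.arctan
        ((S.sight φ₀ s (S.curve s₀ + c * S.dirAt s₀ φ₀)).im /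
          (S.sight φ₀ s (S.curve s₀ + c * S.dirAt s₀ φ₀)).re) < S.cut B s₀ φ₀ t ρ σ s) := by
  have hcont : Continuous fun s => (S.sight φ₀ s₀ (S.curve s)).re := Complex.continuous_re.comp
    ((S.continuous_sight φ₀).comp (continuous_const.prodMk S.continuous_curve))
  have h0 : S.sight φ₀ s₀ (S.curve s₀) = 0 := by simp [sight]
  have hcontc : Continuous fun s => (S.sight φ₀ s (S.curve s₀ + c * S.dirAt s₀ φ₀)).re :=
    Complex.continuous_re.comp ((S.continuous_sight φ₀).comp (Continuous.prodMk_left _))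
  filter_upwards [h.cut_spec hρ hρt, h.eventually_re_left hρt,
    hcont.continuousAt.eventually (gt_mem_nhds (show (S.sight φ₀ s₀ (S.curve s₀)).re < c by rw [h0]; exact hc)),
    hcontc.continuousAt.eventually (lt_mem_nhds 
      (show 0 < (S.sight φ₀ s₀ (S.curve s₀ + c * S.dirAt s₀ φ₀)).re by
        rw [sight_add_mul]; exact hc))] with s ⟨h1, z, hz, h2⟩ hre he hcre
  have hpos : ∀ z ∈ S.nearPart B s₀ φ₀ t ρ, 0 < (S.sight φ₀ s z).re := fun z hz =>
    lt_trans (by linarith) (hre z hz)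
  set C := S.curve s₀ + c * S.dirAt s₀ φ₀ with hC
  set H := S.sight φ₀ s₀ (S.curve s) with hH
  -- The determinant of two vectors does not depend on the frame. In the frame at s₀ the reference
  -- point is (c, 0), so it is the height of the base point times c - re z, corrected by the height
  -- of z.
  have hcross : ∀ z, (S.sight φ₀ s z).re * (S.sight φ₀ s C).im -
      (S.sight φ₀ s z).im * (S.sight φ₀ s C).re =
      H.im * (c - (S.sight φ₀ s₀ z).re) - (S.sight φ₀ s₀ z).im * (c - H.re) := by
    intro z
    have e1 : ∀ w : ℂ, S.sight φ₀ s w = (S.sight φ₀ s₀ w - H) *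
        (S.dirAt s₀ φ₀ * (starRingEnd ℂ) (S.dirAt s φ₀)) := fun w => by
      have := S.dirAt_mul_conj s₀ φ₀
      simp only [hH, sight]
      linear_combination (-(w - S.curve s) * (starRingEnd ℂ) (S.dirAt s φ₀)) * this
    have e2 : ∀ w u : ℂ, w.re * u.im - w.im * u.re = ((starRingEnd ℂ) w * u).im := fun w u => by
      simp [Complex.mul_im]; ring
    have e3 : (starRingEnd ℂ) (S.sight φ₀ s z) * S.sight φ₀ s C =
        (starRingEnd ℂ) (S.sight φ₀ s₀ z - H) * (S.sight φ₀ s₀ C - H) := by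
      rw [e1 z, e1 C]
      have h3 := S.dirAt_mul_conj s₀ φ₀
      have h4 := S.dirAt_mul_conj s φ₀
      simp only [map_mul, Complex.conj_conj]
      linear_combination ((starRingEnd ℂ) (S.sight φ₀ s₀ z - H) * (S.sight φ₀ s₀ C - H)) *
        (S.dirAt s φ₀ * (starRingEnd ℂ) (S.dirAt s φ₀) * h3 + h4)
    rw [e2, e3, hC, sight_add_mul]
    simp only [map_sub, Complex.mul_im, Complex.sub_re, Complex.sub_im, Complex.conj_re,
      Complex.conj_im, Complex.ofReal_re, Complex.ofReal_im]
    ring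
  have hlt : ∀ z ∈ S.nearPart B s₀ φ₀ t ρ,
      0 < H.im * (c - (S.sight φ₀ s₀ z).re) - (S.sight φ₀ s₀ z).im * (c - H.re) →
      Real.arctan ((S.sight φ₀ s z).im / (S.sight φ₀ s z).re) <
        Real.arctan ((S.sight φ₀ s C).im / (S.sight φ₀ s C).re) := fun z hz hp =>
    (arctan_lt_arctan_iff_cross (hpos z hz) hcre).2 (by rw [hcross]; exact hp)
  have hgt : ∀ z ∈ S.nearPart B s₀ φ₀ t ρ,
      H.im * (c - (S.sight φ₀ s₀ z).re) - (S.sight φ₀ s₀ z).im * (c - H.re) < 0 →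
      Real.arctan ((S.sight φ₀ s C).im / (S.sight φ₀ s C).re) <
        Real.arctan ((S.sight φ₀ s z).im / (S.sight φ₀ s z).re) := fun z hz hp =>
    (arctan_lt_arctan_iff_cross hcre (hpos z hz)).2 (by linarith [hcross z])
  have h4 := h.mem_nearPart hρ
  have h5 := h1 _ h4
  have h6 := h.side_le hz.1
  have hl := hlt _ h4
  have hg := hgt _ h4
  have hη4 := hη _ h4
  simp only [sight_add_mul, Complex.ofReal_re, Complex.ofReal_im] at hl hg hη4
  have hηz := hη z hz
  have hprod : ∀ a b : ℝ, 0 < η * a → 0 < η * b → 0 < a * b := fun a b ha hb => by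
    have := mul_pos ha hb
    have h7 : η * a * (η * b) = η ^ 2 * (a * b) := by ring
    rw [h7] at this
    exact pos_of_mul_pos_right this (sq_nonneg η)
  have hprod' : ∀ a b : ℝ, η * a < 0 → 0 < η * b → a * b < 0 := fun a b ha hb => by
    have := hprod (-a) b (by linarith) hb
    linarith
  have hce : 0 < c - H.re := by linarith
  rcases h.sign with rfl | rfl
  · refine ⟨fun hh => ?_, fun hh => ?_⟩
    · have := hl (by linarith [hprod _ _ hh hη4])
      linarith
    · have := hgt z hz (by nlinarith [hprod' _ _ hh hηz])
      linarith
  · refine ⟨fun hh => ?_, fun hh => ?_⟩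
    · have := hlt z hz (by nlinarith [hprod _ _ hh hηz])
      linarith
    · have := hg (by linarith [hprod' _ _ hh hη4])
      linarith

end Touches

end Scatterer

namespace Scatterer

variable {S : Scatterer} {B : Set ℂ} {s₀ φ₀ t ρ σ : ℝ}

theorem mem_interior_of_between {A : Set ℂ} (hA : StrictConvex ℝ A) {p v : ℂ} (hv : v ≠ 0)
    {a b s : ℝ} (ha : p + a * v ∈ A) (hb : p + b * v ∈ A) (has : a < s) (hsb : s < b) :
    p + s * v ∈ interior A := by
  have hne : p + a * v ≠ p + b * v := fun h => by
    have h1 : (a : ℂ) = b := mul_right_cancel₀ hv (add_left_cancel h)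
    have h2 : a = b := by exact_mod_cast h1
    linarith
  have hab : b - a ≠ 0 := by linarith
  have h := hA ha hb hne (a := (b - s) / (b - a)) (b := (s - a) / (b - a))
    (div_pos (by linarith) (by linarith)) (div_pos (by linarith) (by linarith))
    (by field_simp; ring)
  convert h using 1
  simp only [Complex.real_smul]
  have hab' : (b : ℂ) - a ≠ 0 := by exact_mod_cast hab
  push_cast
  field_simp
  ring

theorem eq_add_re_mul {s φ : ℝ} {z : ℂ} (h : (S.sight φ s z).im = 0) :
    z = S.curve s + ((S.sight φ s z).re : ℝ) * S.dirAt s φ := by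
  nth_rewrite 1 [S.eq_add_sight_mul φ s z]
  congr 2
  apply Complex.ext <;> simp [h]

/-- The interior of A is connected and misses the whole line: the forward ray by assumption, the
backward ray because convexity would then put the base point into A. So it lies on one side, and
strict convexity extends this to all points but the contact point. -/
theorem exists_touches {A : Set ℂ} (hc : IsCompact A) (hA : StrictConvex ℝ A)
    (hne : (interior A).Nonempty) (hφ : |φ₀| ≤ Real.pi / 2) (ht : 0 < t)
    (hmem : S.curve s₀ + t * S.dirAt s₀ φ₀ ∈ A) (hs : S.curve s₀ ∉ A)
    (hclear : ∀ u : ℝ, 0 < u → S.curve s₀ + u * S.dirAt s₀ φ₀ ∉ interior A) :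
    ∃ σ, S.Touches A s₀ φ₀ t σ := by
  have hline : ∀ z ∈ interior A, (S.sight φ₀ s₀ z).im ≠ 0 := by
    intro z hz h0
    have h1 := eq_add_re_mul h0
    set u := (S.sight φ₀ s₀ z).re
    rcases lt_or_ge 0 u with hu | hu
    · exact hclear u hu (h1 ▸ hz)
    · refine hs ?_
      rcases hu.lt_or_eq with hu | hu
      · have := mem_interior_of_between hA (S.dirAt_ne_zero s₀ φ₀) (h1 ▸ interior_subset hz) hmem
          hu ht
        simpa using interior_subset this
      · rw [hu] at h1
        simpa [h1] using interior_subset hz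
  have hcont : Continuous fun z => (S.sight φ₀ s₀ z).im :=
    Complex.continuous_im.comp ((S.continuous_sight φ₀).comp (Continuous.prodMk_right s₀))
  have hpre : IsPreconnected (interior A) := hA.convex.interior.isPreconnected
  obtain ⟨z₁, hz₁⟩ := hne
  obtain ⟨σ, hσ, hσ1⟩ : ∃ σ : ℝ, (σ = 1 ∨ σ = -1) ∧ 0 < σ * (S.sight φ₀ s₀ z₁).im := by
    rcases (hline z₁ hz₁).lt_or_gt with h | h
    · exact ⟨-1, Or.inr rfl, by linarith⟩
    · exact ⟨1, Or.inl rfl, by linarith⟩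
  have hint : ∀ z ∈ interior A, 0 < σ * (S.sight φ₀ s₀ z).im := by
    intro z hz
    by_contra hle
    obtain ⟨w, hw, hw0⟩ := hpre.intermediate_value hz hz₁
      (f := fun z => σ * (S.sight φ₀ s₀ z).im) (continuous_const.mul hcont).continuousOn
      ⟨not_lt.1 hle, hσ1.le⟩
    rcases mul_eq_zero.1 hw0 with h | h
    · rcases hσ with rfl | rfl <;> norm_num at h
    · exact hline w hw h
  refine ⟨σ, hc, hA, hφ, ht, hmem, hσ, fun z hz hne => ?_, ?_⟩
  · have h1 := hint _ (hA hz hmem hne (a := 1 / 2) (b := 1 / 2) (by norm_num) (by norm_num)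
      (by norm_num))
    rw [sight_convexCombo _ _ _ _ _ (by norm_num), sight_add_mul, Complex.add_im,
      Complex.smul_im, Complex.smul_im, Complex.ofReal_im, smul_zero, add_zero, smul_eq_mul] at h1
    linarith
  · refine ⟨z₁, interior_subset hz₁, fun h => ?_⟩
    rw [h] at hz₁
    exact hclear t ht hz₁

namespace Touches

/-- A point on the segment from the contact point to another point of B, close to the contact point,
lies strictly on the side of the body, and still does for nearby rays. -/
theorem eventually_left (h : S.Touches B s₀ φ₀ t σ) (hρ : 0 < ρ) :
    ∃ z ∈ S.nearPart B s₀ φ₀ t ρ, ∀ᶠ p : ℝ × ℝ in 𝓝 (s₀, φ₀),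
      0 < σ * (S.sight p.2 p.1 z).im := by
  obtain ⟨w, hw, hne⟩ := h.nontrivial
  set z₀ := S.curve s₀ + t * S.dirAt s₀ φ₀ with hz₀
  have hcont : Continuous fun a : ℝ => (1 - a) • z₀ + a • w := by fun_prop
  have h1 : ∀ᶠ a in 𝓝[>] (0 : ℝ), (1 - a) • z₀ + a • w ∈ Metric.closedBall z₀ ρ :=
    nhdsWithin_le_nhds (hcont.continuousAt (x := 0) (by
      simpa using Metric.closedBall_mem_nhds z₀ hρ))
  obtain ⟨a, ha, ha1, ha0⟩ := (h1.and (Ioo_mem_nhdsGT (zero_lt_one (α := ℝ)))).exists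
  have hmem : (1 - a) • z₀ + a • w ∈ B := h.strictConvex.convex h.mem hw (by linarith)
    (by linarith) (by ring)
  refine ⟨_, ⟨hmem, ha⟩, (continuous_const.mul (Complex.continuous_im.comp
    (S.continuous_sight_all.comp (Continuous.prodMk_left _)))).continuousAt.eventually
      (lt_mem_nhds ?_)⟩
  change 0 < σ * (S.sight φ₀ s₀ _).im
  rw [sight_convexCombo _ _ _ _ _ (by ring), hz₀, sight_add_mul, Complex.add_im,
    Complex.smul_im, Complex.smul_im, Complex.ofReal_im, smul_zero, zero_add, smul_eq_mul]
  have := mul_pos ha1 (h.side w hw hne)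
  linarith

/-- The cut is the extremal angle at which points of B are seen. Beyond it B has points on both
sides of the ray, so convexity makes the ray cross B; before it all of B lies strictly on one side.
-/
theorem eventually_hit_iff (h : S.Touches B s₀ φ₀ t σ) (hρ : 0 < ρ) (hρt : ρ < t) :
    ∀ᶠ p : ℝ × ℝ in 𝓝 (s₀, φ₀),
      ((∃ u : ℝ, 0 < u ∧ S.curve p.1 + u * S.dirAt p.1 p.2 ∈ B) ↔
        0 ≤ σ * (p.2 - S.cut B s₀ φ₀ t ρ σ p.1)) ∧
      ((∃ u : ℝ, 0 < u ∧ S.curve p.1 + u * S.dirAt p.1 p.2 ∈ interior B) ↔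
        0 < σ * (p.2 - S.cut B s₀ φ₀ t ρ σ p.1)) := by
  have hfst : Tendsto (Prod.fst : ℝ × ℝ → ℝ) (𝓝 (s₀, φ₀)) (𝓝 s₀) := continuous_fst.continuousAt
  obtain ⟨z₁, hz₁, hleft⟩ := h.eventually_left hρ
  have hθ : ∀ᶠ p : ℝ × ℝ in 𝓝 (s₀, φ₀), p.2 - φ₀ ∈ Ioo (-(Real.pi / 2)) (Real.pi / 2) :=
    (continuous_snd.sub continuous_const).continuousAt.eventually
      (Ioo_mem_nhds (by simp [Real.pi_pos]) (by simp [Real.pi_pos]))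
  filter_upwards [hfst.eventually (h.cut_spec hρ hρt), hfst.eventually (h.eventually_re_left hρt),
    h.eventually_re hρt, h.eventually_far hρ, hleft, hθ] with ⟨s, φ⟩ ⟨h1, zm, hzm, h2⟩ hre₀ hre
      hfar hz₁' hθ'
  simp only at hre hfar hz₁' hθ' h1 h2 hre₀ ⊢
  have hpos₀ : ∀ z ∈ S.nearPart B s₀ φ₀ t ρ, 0 < (S.sight φ₀ s z).re := fun z hz =>
    lt_trans (by linarith) (hre₀ z hz)
  have hpos : ∀ z ∈ S.nearPart B s₀ φ₀ t ρ, 0 < (S.sight φ s z).re := fun z hz =>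
    lt_trans (by linarith) (hre z hz)
  have hlt : ∀ z ∈ S.nearPart B s₀ φ₀ t ρ, σ * (S.sight φ s z).im < 0 ↔
      σ * Real.arctan ((S.sight φ₀ s z).im / (S.sight φ₀ s z).re) < σ * (φ - φ₀) := by
    intro z hz
    rw [S.sight_im_eq φ φ₀]
    rcases h.sign with rfl | rfl
    · rw [one_mul, one_mul, one_mul, arctan_lt_iff_im_neg (hpos₀ z hz) hθ']
    · rw [neg_one_mul, neg_one_mul, neg_one_mul, neg_lt_neg_iff, neg_lt_zero,
        lt_arctan_iff_im_pos (hpos₀ z hz) hθ']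
  have hgt : ∀ z ∈ S.nearPart B s₀ φ₀ t ρ, 0 < σ * (S.sight φ s z).im ↔
      σ * (φ - φ₀) < σ * Real.arctan ((S.sight φ₀ s z).im / (S.sight φ₀ s z).re) := by
    intro z hz
    rw [S.sight_im_eq φ φ₀]
    rcases h.sign with rfl | rfl
    · rw [one_mul, one_mul, one_mul, lt_arctan_iff_im_pos (hpos₀ z hz) hθ']
    · rw [neg_one_mul, neg_one_mul, neg_one_mul, neg_lt_neg_iff, neg_pos,
        arctan_lt_iff_im_neg (hpos₀ z hz) hθ']
  have hσ0 : ∀ {a : ℝ}, σ * a = 0 → a = 0 := fun ha => by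
    rcases h.sign with rfl | rfl <;> linarith
  have hzero : ∀ {w : ℂ} {u : ℝ}, w = S.curve s + u * S.dirAt s φ → (S.sight φ s w).im = 0 :=
    fun hw => by rw [hw, sight_add_mul, Complex.ofReal_im]
  have hnear : ∀ z ∈ B, σ * (S.sight φ s z).im ≤ 0 → z ∈ S.nearPart B s₀ φ₀ t ρ := by
    intro z hz hle
    by_contra hn
    exact (hfar z hz hn).not_ge hle
  have hsplit : σ * (φ - S.cut B s₀ φ₀ t ρ σ s) =
      σ * (φ - φ₀) - σ * (S.cut B s₀ φ₀ t ρ σ s - φ₀) := by ring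
  have hstrict : 0 < σ * (φ - S.cut B s₀ φ₀ t ρ σ s) →
      ∃ u : ℝ, 0 < u ∧ S.curve s + u * S.dirAt s φ ∈ interior B := by
    intro hlt0
    have h3 : σ * (S.sight φ s zm).im < 0 := (hlt zm hzm).2 (by linarith)
    have hcont : Continuous fun a : ℝ => σ * (S.sight φ s ((1 - a) • zm + a • z₁)).im :=
      continuous_const.mul (Complex.continuous_im.comp ((S.continuous_sight φ).comp
        (continuous_const.prodMk (by fun_prop))))
    -- The chord from the extremal point to a point on the other side crosses the ray, at an
    -- interior point of B by strict convexity.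
    obtain ⟨a, ⟨ha0, ha1⟩, ha⟩ := intermediate_value_Ioo zero_le_one hcont.continuousOn
      (show (0 : ℝ) ∈ Ioo _ _ by constructor <;> simpa)
    have hne : zm ≠ z₁ := fun he => by rw [he] at h3; linarith
    have hint := h.strictConvex hzm.1 hz₁.1 hne (a := 1 - a) (b := a) (by linarith) ha0 (by ring)
    have h4 := hσ0 ha
    exact ⟨_, hpos _ (hnear _ (interior_subset hint) ha.le), eq_add_re_mul h4 ▸ hint⟩
  refine ⟨⟨fun ⟨u, hu, hmem⟩ => ?_, fun hle => ?_⟩, ⟨fun ⟨u, hu, hmem⟩ => ?_, hstrict⟩⟩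
  · have h0 : (S.sight φ s _).im = 0 := hzero (w := S.curve s + u * S.dirAt s φ) rfl
    have hz := hnear _ hmem (by rw [h0, mul_zero])
    have h3 := h1 _ hz
    have h4 := (hgt _ hz).not.1 (by rw [h0, mul_zero]; exact lt_irrefl 0)
    linarith
  · rcases hle.lt_or_eq with hlt0 | heq
    · obtain ⟨u, hu, hm⟩ := hstrict hlt0
      exact ⟨u, hu, interior_subset hm⟩
    · have h3 := (hlt zm hzm).not.2 (by linarith)
      have h4 := (hgt zm hzm).not.2 (by linarith)
      have h5 := hσ0 (le_antisymm (not_lt.1 h4) (not_lt.1 h3))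
      exact ⟨_, hpos zm hzm, eq_add_re_mul h5 ▸ hzm.1⟩
  -- An interior point can be pushed across the ray to its free side within B, which makes the
  -- inequality for the cut strict.
  · set w := S.curve s + u * S.dirAt s φ with hw
    have hcont : Continuous fun a : ℝ => w + (-(σ * a) : ℝ) * Complex.I * S.dirAt s φ := by
      fun_prop
    have h2 : ∀ᶠ a in 𝓝[>] (0 : ℝ), w + (-(σ * a) : ℝ) * Complex.I * S.dirAt s φ ∈ interior B :=
      nhdsWithin_le_nhds (hcont.continuousAt (x := 0) (by
        simpa only [mul_zero, neg_zero, Complex.ofReal_zero, zero_mul, add_zero] using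
          isOpen_interior.mem_nhds hmem))
    obtain ⟨a, ha, ha0⟩ := (h2.and self_mem_nhdsWithin).exists
    have him : σ * (S.sight φ s (w + (-(σ * a) : ℝ) * Complex.I * S.dirAt s φ)).im = -a := by
      have : w + (-(σ * a) : ℝ) * Complex.I * S.dirAt s φ =
          S.curve s + (u + (-(σ * a) : ℝ) * Complex.I) * S.dirAt s φ := by rw [hw]; ring
      rw [this, sight_add_mul]
      simp only [Complex.add_im, Complex.ofReal_im, Complex.mul_im, Complex.ofReal_re,
        Complex.I_im, Complex.I_re]
      linear_combination (-a) * h.sign_mul_self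
    have hz := hnear _ (interior_subset ha) (by rw [him]; exact (neg_neg_of_pos ha0).le)
    have h3 := h1 _ hz
    have h4 := (hlt _ hz).1 (by rw [him]; exact neg_neg_of_pos ha0)
    linarith

end Touches

/-- The sign of the height of the boundary curve over a ray that leaves it. -/
theorem eventually_height (hφ : |φ₀| ≤ Real.pi / 2) : ∃ η : ℝ,
    (∀ᶠ s in 𝓝[>] s₀, 0 < η * (S.sight φ₀ s₀ (S.curve s)).im) ∧
    ((∀ᶠ s in 𝓝[<] s₀, 0 < η * (S.sight φ₀ s₀ (S.curve s)).im) ∨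
      (∀ᶠ s in 𝓝[<] s₀, η * (S.sight φ₀ s₀ (S.curve s)).im < 0)) ∧
    (|φ₀| < Real.pi / 2 → ∀ᶠ s in 𝓝[<] s₀, η * (S.sight φ₀ s₀ (S.curve s)).im < 0) := by
  have hd : HasDerivAt (fun s => (S.sight φ₀ s₀ (S.curve s)).im) (Real.cos φ₀) s₀ := by
    have h1 : HasDerivAt (fun s => (S.curve s - S.curve s₀) * (starRingEnd ℂ) (S.dirAt s₀ φ₀))
        (deriv S.curve s₀ * (starRingEnd ℂ) (S.dirAt s₀ φ₀)) s₀ :=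
      ((S.hasDerivAt_curve s₀).sub_const _).mul_const _
    refine (Complex.imCLM.hasFDerivAt.comp_hasDerivAt s₀ h1).congr_deriv ?_
    have h5 : S.normalAt s₀ * (starRingEnd ℂ) (S.normalAt s₀) = 1 := by
      rw [Complex.mul_conj, Complex.normSq_eq_norm_sq, norm_normalAt]; simp
    have h6 : deriv S.curve s₀ = Complex.I * S.normalAt s₀ := by
      rw [normalAt, ← mul_assoc]; simp
    have h7 : deriv S.curve s₀ * (starRingEnd ℂ) (S.dirAt s₀ φ₀) =
        Complex.I * (starRingEnd ℂ) (Complex.exp (φ₀ * Complex.I)) := by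
      rw [h6, dirAt, map_mul]
      linear_combination (Complex.I * (starRingEnd ℂ) (Complex.exp (φ₀ * Complex.I))) * h5
    rw [Complex.imCLM_apply, h7]
    simp [Complex.mul_im, Complex.exp_ofReal_mul_I_re]
  have h0 : (S.sight φ₀ s₀ (S.curve s₀)).im = 0 := by simp [sight]
  -- A transversal ray is crossed by the boundary curve, since the height has derivative cos φ₀ > 0.
  -- A tangent ray leaves the curve on one side, by strict convexity.
  rcases hφ.lt_or_eq with hlt | heq
  · have hcos : 0 < Real.cos φ₀ := Real.cos_pos_of_mem_Ioo (abs_lt.1 hlt)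
    have h1 := hasDerivAt_iff_tendsto_slope_left_right.1 hd
    have hl : ∀ᶠ s in 𝓝[<] s₀, (1 : ℝ) * (S.sight φ₀ s₀ (S.curve s)).im < 0 := by
      filter_upwards [h1.1.eventually (lt_mem_nhds hcos), self_mem_nhdsWithin] with s hs hs'
      rw [slope_def_field, h0, sub_zero] at hs
      rw [one_mul]
      by_contra hn
      exact hs.not_ge (div_nonpos_of_nonneg_of_nonpos (not_lt.1 hn) (sub_nonpos.2 (le_of_lt hs')))
    refine ⟨1, ?_, Or.inr hl, fun _ => hl⟩
    filter_upwards [h1.2.eventually (lt_mem_nhds hcos), self_mem_nhdsWithin] with s hs hs'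
    rw [slope_def_field, h0, sub_zero] at hs
    rw [one_mul]
    exact (div_pos_iff_of_pos_right (sub_pos.2 hs')).1 hs
  · have hne : ∀ᶠ s in 𝓝[≠] s₀, S.curve s ≠ S.curve s₀ :=
      (S.hasDerivAt_curve s₀).eventually_ne fun h => by
        have := S.norm_deriv_curve s₀
        rw [h, norm_zero] at this
        exact zero_ne_one this
    obtain ⟨η, hη⟩ : ∃ η : ℝ, ∀ s, η * (S.sight φ₀ s₀ (S.curve s)).im =
        -inner ℝ (S.normalAt s₀) (S.curve s - S.curve s₀) := by
      rcases (abs_eq (by positivity)).1 heq with h | h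
      · refine ⟨1, fun s => ?_⟩
        rw [sight, dirAt, h, Complex.ofReal_div, Complex.ofReal_ofNat, Complex.exp_pi_div_two_mul_I]
        simp [Complex.mul_im, Complex.mul_re]
      · refine ⟨-1, fun s => ?_⟩
        rw [sight, dirAt, h, Complex.ofReal_neg, Complex.ofReal_div, Complex.ofReal_ofNat,
          ← neg_div, Complex.exp_neg_pi_div_two_mul_I]
        simp [Complex.mul_im, Complex.mul_re]
    have hp : ∀ᶠ s in 𝓝[≠] s₀, 0 < η * (S.sight φ₀ s₀ (S.curve s)).im := hne.mono fun s hs => by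
      rw [hη]
      exact neg_pos.2 (S.inner_normalAt_lt (S.curve_mem_body s) hs)
    exact ⟨η, hp.filter_mono (nhdsWithin_mono _ fun s hs => ne_of_gt hs),
      Or.inl (hp.filter_mono (nhdsWithin_mono _ fun s hs => ne_of_lt hs)),
      fun h => absurd heq h.ne⟩

/-- Bodies that a ray touches at different distances give rise to a crossing family. -/
theorem crossingFamily_cut {ι : Type*} {B : ι → Set ℂ} {t σ : ι → ℝ}
    (h : ∀ j, S.Touches (B j) s₀ φ₀ (t j) (σ j)) (hφ : |φ₀| ≤ Real.pi / 2) (hρ : 0 < ρ)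
    (hρt : ∀ j, ρ < t j) (hsep : ∀ j k, j ≠ k → 2 * ρ < |t j - t k|) :
    CrossingFamily s₀ φ₀ fun j => S.cut (B j) s₀ φ₀ (t j) ρ (σ j) := by
  have hlt : ∀ j k, t j < t k → j ≠ k → ∀ᶠ s in 𝓝 s₀,
      (0 < (S.sight φ₀ s₀ (S.curve s)).im →
        S.cut (B j) s₀ φ₀ (t j) ρ (σ j) s < S.cut (B k) s₀ φ₀ (t k) ρ (σ k) s) ∧
      ((S.sight φ₀ s₀ (S.curve s)).im < 0 →
        S.cut (B k) s₀ φ₀ (t k) ρ (σ k) s < S.cut (B j) s₀ φ₀ (t j) ρ (σ j) s) := by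
    intro j k hjk hne
    have h1 := hsep j k hne
    rw [abs_sub_comm, abs_of_pos (sub_pos.2 hjk)] at h1
    -- A reference point halfway between the contact points lies beyond the nearer body and before
    -- the farther one, so its angle separates the two cuts.
    have hc : 0 < (t j + t k) / 2 := by linarith [(h j).pos, (h k).pos]
    filter_upwards [(h j).cut_compare hρ (hρt j) hc (η := 1) fun z hz => by
        linarith [(abs_le.1 (Touches.abs_re_sub_le hz)).2],
      (h k).cut_compare hρ (hρt k) hc (η := -1) fun z hz => by
        linarith [(abs_le.1 (Touches.abs_re_sub_le hz)).1]] with s hj hk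
    exact ⟨fun hp => (hj.1 (by linarith)).trans (hk.2 (by linarith)),
      fun hp => (hk.1 (by linarith)).trans (hj.2 (by linarith))⟩
  obtain ⟨η, hr, hl, hs⟩ := S.eventually_height (s₀ := s₀) hφ
  have hη : η ≠ 0 := fun h0 => by
    obtain ⟨s, hs⟩ := hr.exists
    simp [h0] at hs
  -- The sign τ combines which contact point is nearer with the sign of η.
  have hord : ∀ j k, j ≠ k → ∃ τ : ℝ, (τ = 1 ∨ τ = -1) ∧ ∀ᶠ s in 𝓝 s₀,
      (0 < τ * (η * (S.sight φ₀ s₀ (S.curve s)).im) →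
        S.cut (B j) s₀ φ₀ (t j) ρ (σ j) s < S.cut (B k) s₀ φ₀ (t k) ρ (σ k) s) ∧
      (τ * (η * (S.sight φ₀ s₀ (S.curve s)).im) < 0 →
        S.cut (B k) s₀ φ₀ (t k) ρ (σ k) s < S.cut (B j) s₀ φ₀ (t j) ρ (σ j) s) := by
    intro j k hne
    have htne : t j ≠ t k := fun he => by
      have := hsep j k hne
      rw [he, sub_self, abs_zero] at this
      linarith
    rcases htne.lt_or_gt with hjk | hjk <;> rcases hη.lt_or_gt with hη' | hη'
    · refine ⟨-1, Or.inr rfl, (hlt j k hjk hne).mono fun s hs => ⟨fun hp => hs.1 ?_, fun hp => hs.2 ?_⟩⟩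
      · exact pos_of_mul_pos_right (a := -η) (by linarith) (by linarith)
      · exact neg_of_mul_neg_right (a := -η) (by linarith) (by linarith)
    · refine ⟨1, Or.inl rfl, (hlt j k hjk hne).mono fun s hs => ⟨fun hp => hs.1 ?_, fun hp => hs.2 ?_⟩⟩
      · exact pos_of_mul_pos_right (a := η) (by linarith) (by linarith)
      · exact neg_of_mul_neg_right (a := η) (by linarith) (by linarith)
    · refine ⟨1, Or.inl rfl, (hlt k j hjk hne.symm).mono fun s hs =>
        ⟨fun hp => hs.2 ?_, fun hp => hs.1 ?_⟩⟩
      · exact neg_of_mul_neg_right (a := -η) (by linarith) (by linarith)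
      · exact pos_of_mul_pos_right (a := -η) (by linarith) (by linarith)
    · refine ⟨-1, Or.inr rfl, (hlt k j hjk hne.symm).mono fun s hs =>
        ⟨fun hp => hs.2 ?_, fun hp => hs.1 ?_⟩⟩
      · exact neg_of_mul_neg_right (a := η) (by linarith) (by linarith)
      · exact pos_of_mul_pos_right (a := η) (by linarith) (by linarith)
  refine ⟨fun j => Eventually.of_forall fun s => ((h j).continuous_cut (hρt j)).continuousAt,
    fun j => (h j).cut_base hρ (hρt j), fun j => ?_, fun j => ?_, fun j k hne => ?_,
    fun j k hne => ?_, fun hlt j k hne => ?_⟩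
  · filter_upwards [nhdsWithin_le_nhds ((h j).cut_lt_iff hρ (hρt j)), self_mem_nhdsWithin]
      with s hs hs' using hs.1 hs'
  · filter_upwards [nhdsWithin_le_nhds ((h j).cut_lt_iff hρ (hρt j)), self_mem_nhdsWithin]
      with s hs hs' using hs.2 hs'
  · obtain ⟨τ, rfl | rfl, hτ⟩ := hord j k hne
    · refine Or.inl ?_
      filter_upwards [nhdsWithin_le_nhds hτ, hr] with s hs hs' using hs.1 (by linarith)
    · refine Or.inr ?_
      filter_upwards [nhdsWithin_le_nhds hτ, hr] with s hs hs' using hs.2 (by linarith)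
  · obtain ⟨τ, rfl | rfl, hτ⟩ := hord j k hne <;> rcases hl with hl | hl
    · refine Or.inl ?_
      filter_upwards [nhdsWithin_le_nhds hτ, hl] with s hs hs' using hs.1 (by linarith)
    · refine Or.inr ?_
      filter_upwards [nhdsWithin_le_nhds hτ, hl] with s hs hs' using hs.2 (by linarith)
    · refine Or.inr ?_
      filter_upwards [nhdsWithin_le_nhds hτ, hl] with s hs hs' using hs.2 (by linarith)
    · refine Or.inl ?_
      filter_upwards [nhdsWithin_le_nhds hτ, hl] with s hs hs' using hs.1 (by linarith)
  · obtain ⟨τ, rfl | rfl, hτ⟩ := hord j k hne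
    · refine Or.inl ?_
      filter_upwards [nhdsWithin_le_nhds hτ, hr] with s hs hs' using hs.1 (by linarith)
    · refine Or.inr ?_
      filter_upwards [nhdsWithin_le_nhds hτ, hs hlt] with s hs hs' using hs.1 (by linarith)

end Scatterer

/-! ### Local description of the sets with given labels -/

namespace SinaiTable

variable {Q : SinaiTable}

/-- The ray of a particle that leaves `x` meets the obstacle `κ`. -/
def Meets (x : Q.PhaseSpace) (κ : Fin Q.D × (ℤ × ℤ)) : Prop :=
  ∃ u : ℝ, 0 < u ∧ Q.position x + u * Q.velocity x ∈ Q.obstacle κ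

/-- The ray of a particle that leaves `x` meets the interior of the obstacle `κ`. -/
def MeetsInterior (x : Q.PhaseSpace) (κ : Fin Q.D × (ℤ × ℤ)) : Prop :=
  ∃ u : ℝ, 0 < u ∧ Q.position x + u * Q.velocity x ∈ interior (Q.obstacle κ)

theorem interior_obstacle_nonempty (κ : Fin Q.D × (ℤ × ℤ)) : (interior (Q.obstacle κ)).Nonempty := by
  obtain ⟨z, hz⟩ := (Q.scatterer κ.1).interior_nonempty
  exact ⟨z + latticeVector κ.2, mem_interior_obstacle.2 (by rwa [add_sub_cancel_right])⟩

theorem mem_interior_obstacle_of_between {x : Q.PhaseSpace} {κ : Fin Q.D × (ℤ × ℤ)} {a b s : ℝ}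
    (ha : Q.position x + a * Q.velocity x ∈ Q.obstacle κ)
    (hb : Q.position x + b * Q.velocity x ∈ Q.obstacle κ) (has : a < s) (hsb : s < b) :
    Q.position x + s * Q.velocity x ∈ interior (Q.obstacle κ) :=
  Scatterer.mem_interior_of_between (strictConvex_obstacle κ) (velocity_ne_zero x) ha hb has hsb

/-- At a tangential collision the line of flight is the supporting line of the obstacle. Otherwise
the incoming velocity points strictly inwards and the prolonged flight enters the interior. -/
theorem T_mem_grazingSet_iff (hQ : Q.FiniteHorizon) (x : Q.PhaseSpace) :
    Q.T x ∈ Q.grazingSet ↔ ¬MeetsInterior x (label x) := by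
  have hw := weakCollision_T hQ x
  have hT : (Q.T x).1 = (label x).1 := T_fst hQ x
  have hs := hw.velocity_sub
  constructor
  · rintro hg ⟨u, hu, hmem⟩
    have hmem' := mem_interior_obstacle.1 hmem
    rw [← hT] at hmem'
    set z := Q.position x + u * Q.velocity x - latticeVector (label x).2 with hz
    have hzp : z - Q.position (Q.T x) = ((u - flight x : ℝ) : ℂ) * Q.velocity x := by
      rw [hz]; push_cast; linear_combination hw.position_eq
    have hne : z ≠ Q.position (Q.T x) := fun h => by
      rw [h] at hmem'
      exact (position_mem_frontier (Q.T x)).2 hmem'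
    have h1 := inner_normal_lt (Q.T x) (interior_subset hmem') hne
    have h2 := inner_velocity_normal (Q.T x)
    rw [velocity_T_of_grazing hQ hg, (mem_grazingSet_iff _).1 hg, real_inner_comm] at h2
    rw [hzp, ← Complex.real_smul, real_inner_smul_right, h2, mul_zero] at h1
    exact lt_irrefl _ h1
  · intro hn
    rw [mem_grazingSet_iff]
    by_contra hc
    have hpos := lt_of_le_of_ne (cos_angle_nonneg (Q.T x)) (Ne.symm hc)
    have h1 := inner_velocity_normal (Q.T x)
    have h2 : inner ℝ (Q.normal (Q.T x)) (Q.velocity x) < 0 := by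
      have h3 := congr_arg (fun w => inner ℝ w (Q.normal (Q.T x))) hs
      have h4 : inner ℝ (Q.normal (Q.T x)) (Q.normal (Q.T x)) = (1 : ℝ) := by
        rw [real_inner_self_eq_norm_sq, norm_normal]; norm_num
      rw [real_inner_comm]
      simp only [inner_add_left] at h3
      rw [← Complex.real_smul, real_inner_smul_left, h4, h1] at h3
      linarith
    obtain ⟨ε, hε, hint⟩ := exists_mem_interior (Q.T x) h2
    refine hn ⟨flight x + ε, by linarith [hw.pos], mem_interior_obstacle.2 ?_⟩
    rw [hT] at hint
    refine Set.mem_of_eq_of_mem ?_ hint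
    push_cast
    linear_combination hw.position_eq

/-- In the limit a particle still hits the obstacle that it hits first. -/
theorem exists_tendsto_flight (hQ : Q.FiniteHorizon) {𝒰 : Ultrafilter Q.PhaseSpace}
    {X : Q.PhaseSpace} (h𝒰 : ↑𝒰 ≤ 𝓝 X) {κ : Fin Q.D × (ℤ × ℤ)}
    (hκ : ∀ᶠ x in 𝒰, label x = κ) :
    ∃ (t : ℝ) (Y : Q.PhaseSpace), Y.1 = κ.1 ∧ Tendsto flight (𝒰 : Filter Q.PhaseSpace) (𝓝 t) ∧
      WeakCollision X Y t κ.2 := by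
  obtain ⟨Y, hY⟩ := 𝒰.exists_tendsto Q.T
  obtain ⟨t, ht, hw⟩ := WeakCollision.exists_tendsto hQ (m := κ.2) (x := id) h𝒰 hY
    (hκ.mono fun a ha => ha ▸ weakCollision_T hQ a)
  obtain ⟨a, h1, h2⟩ := ((eventually_index_eq hY).and hκ).exists
  exact ⟨t, Y, by rw [← h1, T_fst hQ, h2], ht, hw⟩

/-- The obstacle is bounded, so the hit times stay in a compact interval, and it is closed, so the
limit is again a point of it. -/
theorem exists_tendsto_meets {𝒰 : Ultrafilter Q.PhaseSpace} {X : Q.PhaseSpace} (h𝒰 : ↑𝒰 ≤ 𝓝 X)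
    {κ : Fin Q.D × (ℤ × ℤ)} {u : Q.PhaseSpace → ℝ}
    (hu : ∀ᶠ x in 𝒰, 0 < u x ∧ Q.position x + u x * Q.velocity x ∈ Q.obstacle κ) :
    ∃ u' : ℝ, Tendsto u 𝒰 (𝓝 u') ∧ Q.position X + u' * Q.velocity X ∈ Q.obstacle κ := by
  obtain ⟨C, hC⟩ := (isCompact_obstacle κ).isBounded.exists_norm_le
  obtain ⟨R, hR⟩ := (isCompact_univ.image continuous_position (X := Q.PhaseSpace)).isBounded.exists_norm_le
  obtain ⟨u', -, hu'⟩ := 𝒰.exists_tendsto_of_isCompact (f := u) (isCompact_Icc (a := 0) (b := C + R))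
    (hu.mono fun x hx => ⟨hx.1.le, by
      have h1 : ((u x : ℝ) : ℂ) * Q.velocity x =
        (Q.position x + u x * Q.velocity x) - Q.position x := by ring
      have h2 := congr_arg norm h1
      rw [norm_mul, norm_velocity, mul_one, Complex.norm_real, Real.norm_of_nonneg hx.1.le] at h2
      rw [h2]
      exact (norm_sub_le _ _).trans (add_le_add (hC _ hx.2) (hR _ ⟨x, mem_univ _, rfl⟩))⟩)
  have hlim : Tendsto (fun x => Q.position x + u x * Q.velocity x) 𝒰
      (𝓝 (Q.position X + u' * Q.velocity X)) := ((continuous_position.tendsto X).mono_left h𝒰).add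
    (((Complex.continuous_ofReal.tendsto u').comp hu').mul
      ((continuous_velocity.tendsto X).mono_left h𝒰))
  exact ⟨u', hu', (isClosed_obstacle κ).mem_of_tendsto hlim (hu.mono fun x hx => hx.2)⟩

/-- Near a point whose orbit reaches the obstacle `κ` at time `t` without entering an obstacle,
the particle hits `κ` first if and only if it meets `κ` and misses the obstacles that are touched
before the time `t`. -/
theorem eventually_label_iff (hQ : Q.FiniteHorizon) {X Y : Q.PhaseSpace} {t : ℝ}
    {κ : Fin Q.D × (ℤ × ℤ)} (hY : Y.1 = κ.1) (hw : WeakCollision X Y t κ.2) :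
    ∀ᶠ x in 𝓝 X, label x = κ ↔ Meets x κ ∧
      ∀ l ∈ {l | ∃ u ∈ Ioo 0 t, Q.position X + u * Q.velocity X ∈ Q.obstacle l}, ¬Meets x l := by
  have hκt : Q.position X + t * Q.velocity X ∈ Q.obstacle κ := by
    rw [hw.position_eq, show κ = (Y.1, κ.2) by rw [hY]]
    exact position_add_mem_obstacle Y κ.2
  have hdis : ∀ {z : ℂ} {l l' : Fin Q.D × (ℤ × ℤ)}, z ∈ Q.obstacle l → z ∈ Q.obstacle l' → l = l' := by
    intro z l l' h h'
    by_contra hne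
    exact Set.disjoint_left.1 (disjoint_obstacle hne) h h'
  set J := {l | ∃ u ∈ Ioo 0 t, Q.position X + u * Q.velocity X ∈ Q.obstacle l} with hJ
  have hJfin : J.Finite := by
    refine (Q.finite_obstacle_meets (‖Q.position X‖ + t)).subset ?_
    rintro l ⟨u, hu, hm⟩
    refine ⟨_, hm, (norm_add_le _ _).trans ?_⟩
    rw [norm_mul, norm_velocity, mul_one, Complex.norm_real, Real.norm_of_nonneg hu.1.le]
    linarith [hu.2]
  rw [Filter.Eventually, mem_iff_ultrafilter]
  intro 𝒰 h𝒰
  change ∀ᶠ x in (𝒰 : Filter Q.PhaseSpace), _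
  rcases 𝒰.em (fun x => label x = κ) with hlab | hlab
  · obtain ⟨t', Y', hY', ht', hw'⟩ := exists_tendsto_flight hQ h𝒰 hlab
    have hκt' : Q.position X + t' * Q.velocity X ∈ Q.obstacle κ := by
      rw [hw'.position_eq, show κ = (Y'.1, κ.2) by rw [hY']]
      exact position_add_mem_obstacle Y' κ.2
    -- Two different hit times of the strictly convex κ would put the longer free flight into its
    -- interior.
    have htt : t' = t := by
      rcases lt_trichotomy t' t with h | h | h
      · exact absurd (mem_interior_obstacle_of_between hκt' hκt (s := (t' + t) / 2)
          (by linarith) (by linarith)) (hw.clear _ ⟨by linarith [hw.pos, hw'.pos], by linarith⟩ _)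
      · exact h
      · exact absurd (mem_interior_obstacle_of_between hκt hκt' (s := (t' + t) / 2)
          (by linarith) (by linarith)) (hw'.clear _ ⟨by linarith [hw.pos, hw'.pos], by linarith⟩ _)
    subst htt
    -- If rays close to X met l although κ is hit first, then in the limit l would be met at time t'
    -- or later and also touched before, so the free flight would run through its interior.
    have hmiss : ∀ l ∈ J, ∀ᶠ x in (𝒰 : Filter Q.PhaseSpace), ¬Meets x l := by
      intro l hl
      rw [Ultrafilter.eventually_not]
      intro hm
      obtain ⟨u₁, hu₁, hu₁m⟩ := hl
      have hch : ∀ x : Q.PhaseSpace, ∃ u : ℝ, Meets x l →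
          0 < u ∧ Q.position x + u * Q.velocity x ∈ Q.obstacle l := fun x => by
        by_cases h : Meets x l
        · exact ⟨h.choose, fun _ => h.choose_spec⟩
        · exact ⟨0, fun h' => absurd h' h⟩
      choose u hu using hch
      obtain ⟨u', hu', hm'⟩ := exists_tendsto_meets h𝒰 (hm.mono fun x hx => hu x hx)
      have hle : t' ≤ u' := le_of_tendsto_of_tendsto ht' hu' ((hm.and hlab).mono fun x hx => by
        by_contra hlt
        exact (firstHit_label hQ x).2.2 _ ⟨(hu x hx.1).1, not_le.1 hlt⟩ l (hu x hx.1).2)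
      have h1 := mem_interior_obstacle_of_between hu₁m hm' (s := (u₁ + t') / 2)
        (by linarith [hu₁.2]) (by linarith [hu₁.2])
      exact hw.clear _ ⟨by linarith [hu₁.1, hw.pos], by linarith [hu₁.2]⟩ _ h1
    filter_upwards [hlab, (eventually_all_finite hJfin).2 hmiss] with x hx hx'
    have hf := firstHit_label hQ x
    rw [hx] at hf
    exact ⟨fun _ => ⟨⟨_, hf.1, hf.2.1⟩, hx'⟩, fun _ => hx⟩
  · obtain ⟨F, hF, hFm⟩ := exists_finite_labels hQ
    obtain ⟨κ', -, hκ'⟩ := 𝒰.exists_eventually_eq (f := fun a => label a) hF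
      (Eventually.of_forall fun a => hFm _)
    have hne : κ' ≠ κ := fun h => by
      obtain ⟨x, h1, h2⟩ := (hlab.and hκ').exists
      exact h1 (h2.trans h)
    -- If nearby rays meet κ but hit κ' first, the limit ray reaches κ' before time t, so κ' is
    -- among the obstacles that are touched earlier and is not missed.
    have hnot : ∀ᶠ x in (𝒰 : Filter Q.PhaseSpace), ¬(Meets x κ ∧ ∀ l ∈ J, ¬Meets x l) := by
      rw [Ultrafilter.eventually_not]
      intro hm
      obtain ⟨t', Y', hY', ht', hw'⟩ := exists_tendsto_flight hQ h𝒰 hκ'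
      have hκt' : Q.position X + t' * Q.velocity X ∈ Q.obstacle κ' := by
        rw [hw'.position_eq, show κ' = (Y'.1, κ'.2) by rw [hY']]
        exact position_add_mem_obstacle Y' κ'.2
      have hch : ∀ x : Q.PhaseSpace, ∃ u : ℝ, Meets x κ →
          0 < u ∧ Q.position x + u * Q.velocity x ∈ Q.obstacle κ := fun x => by
        by_cases h : Meets x κ
        · exact ⟨h.choose, fun _ => h.choose_spec⟩
        · exact ⟨0, fun h' => absurd h' h⟩
      choose u hu using hch
      obtain ⟨u', hu', hm'⟩ := exists_tendsto_meets h𝒰 (hm.mono fun x hx => hu x hx.1)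
      have hle : t' ≤ u' := le_of_tendsto_of_tendsto ht' hu' ((hm.and hκ').mono fun x hx => by
        by_contra hlt
        exact (firstHit_label hQ x).2.2 _ ⟨(hu x hx.1.1).1, not_le.1 hlt⟩ κ (hu x hx.1.1).2)
      have hlt : t' < u' := lt_of_le_of_ne hle fun h => hne (hdis hκt' (h ▸ hm'))
      have ht't : t' < t := by
        by_contra hge
        have hgt : t < t' := lt_of_le_of_ne (not_lt.1 hge) fun h => hne (hdis hκt' (h ▸ hκt))
        have h1 := mem_interior_obstacle_of_between hκt hm' (s := (t + t') / 2)
          (by linarith) (by linarith)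
        exact hw'.clear _ ⟨by linarith [hw.pos, hw'.pos], by linarith⟩ _ h1
      obtain ⟨x, hx, hx'⟩ := (hm.and hκ').exists
      have hf := firstHit_label hQ x
      rw [hx'] at hf
      exact hx.2 κ' ⟨t', ⟨hw'.pos, ht't⟩, hκt'⟩ ⟨_, hf.1, hf.2.1⟩
    filter_upwards [hlab, hnot] with x hx hx'
    exact ⟨fun h => absurd h hx, fun h => absurd h hx'⟩

end SinaiTable

namespace SinaiTable

variable {Q : SinaiTable}

theorem exists_spacing {ι : Type*} [Finite ι] {t : ι → ℝ} (h0 : ∀ j, 0 < t j)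
    (hinj : Function.Injective t) :
    ∃ ρ : ℝ, 0 < ρ ∧ (∀ j, ρ < t j) ∧ ∀ j k, j ≠ k → 2 * ρ < |t j - t k| := by
  have h1 : ∀ᶠ ρ in 𝓝[>] (0 : ℝ), ∀ j, ρ < t j :=
    eventually_all.2 fun j => nhdsWithin_le_nhds (gt_mem_nhds (h0 j))
  have h2 : ∀ᶠ ρ in 𝓝[>] (0 : ℝ), ∀ j k, j ≠ k → 2 * ρ < |t j - t k| := by
    refine eventually_all.2 fun j => eventually_all.2 fun k => ?_
    by_cases hjk : j = k
    · exact Eventually.of_forall fun _ h => absurd hjk h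
    · have hp : 0 < |t j - t k| / 2 := by
        have := abs_pos.2 (sub_ne_zero.2 (hinj.ne hjk)); linarith
      filter_upwards [nhdsWithin_le_nhds (gt_mem_nhds hp)] with ρ hρ _
      have : ρ < |t j - t k| / 2 := hρ
      linarith
  obtain ⟨ρ, h3, h4, h5⟩ := (h1.and (h2.and self_mem_nhdsWithin)).exists
  exact ⟨ρ, h5, h3, h4⟩

theorem eventually_meetsInterior {X : Q.PhaseSpace} {κ : Fin Q.D × (ℤ × ℤ)}
    (h : MeetsInterior X κ) : ∀ᶠ x in 𝓝 X, MeetsInterior x κ := by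
  obtain ⟨u, hu, hm⟩ := h
  have hcont : Continuous fun x => Q.position x + u * Q.velocity x :=
    continuous_position.add (continuous_const.mul continuous_velocity)
  filter_upwards [hcont.continuousAt.eventually (isOpen_interior.mem_nhds hm)] with x hx
  exact ⟨u, hu, hx⟩

theorem MeetsInterior.meets {x : Q.PhaseSpace} {κ : Fin Q.D × (ℤ × ℤ)} (h : MeetsInterior x κ) :
    Meets x κ := by
  obtain ⟨u, hu, hm⟩ := h
  exact ⟨u, hu, interior_subset hm⟩

/-- Near each point the set of points with a given label is bounded by a crossing family of
graphs over the arclength coordinate. -/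
theorem exists_cuts (hQ : Q.FiniteHorizon) (i : Fin Q.D) (s₀ : ℝ)
    (φ₀ : Icc (-(Real.pi / 2)) (Real.pi / 2)) (κ : Fin Q.D × (ℤ × ℤ)) :
    (∀ᶠ x in 𝓝 (phasePoint (Q := Q) i s₀ φ₀), label x ≠ κ) ∨
    ∃ (G : Set (Fin Q.D × (ℤ × ℤ))) (f : G → ℝ → ℝ) (ε : G → ℝ) (strict : G → Prop),
      G.Finite ∧ (∀ j, ε j = 1 ∨ ε j = -1) ∧ CrossingFamily s₀ φ₀ f ∧
      ∀ᶠ p : ℝ × Icc (-(Real.pi / 2)) (Real.pi / 2) in 𝓝 (s₀, φ₀),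
        (label (phasePoint (Q := Q) i p.1 p.2) = κ ↔
          ∀ j, SatisfiesCut (f j p.1) (ε j) (strict j) p.2) ∧
        (label (phasePoint (Q := Q) i p.1 p.2) = κ ∧
            Q.T (phasePoint i p.1 p.2) ∉ Q.grazingSet ↔
          ∀ j, SatisfiesCut (f j p.1) (ε j) True p.2) := by
  classical
  set X := phasePoint (Q := Q) i s₀ φ₀ with hX
  by_cases hfreq : ∀ᶠ x in 𝓝 X, label x ≠ κ
  · exact Or.inl hfreq
  refine Or.inr ?_
  obtain ⟨t₀, Y, hY, hw⟩ : ∃ (t : ℝ) (Y : Q.PhaseSpace), Y.1 = κ.1 ∧ WeakCollision X Y t κ.2 := by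
    have h1 : ¬∀ 𝒰 : Ultrafilter Q.PhaseSpace, (𝒰 : Filter _) ≤ 𝓝 X → {x | label x ≠ κ} ∈ 𝒰 :=
      fun h => hfreq (mem_iff_ultrafilter.2 h)
    push Not at h1
    obtain ⟨𝒰, h𝒰, hn⟩ := h1
    obtain ⟨t, Y, h2, -, h3⟩ := exists_tendsto_flight hQ h𝒰 (κ := κ) (by
      have := Ultrafilter.compl_mem_iff_notMem.2 hn
      filter_upwards [this] with x hx using not_not.1 hx)
    exact ⟨t, Y, h2, h3⟩
  have hκt : Q.position X + t₀ * Q.velocity X ∈ Q.obstacle κ := by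
    rw [hw.position_eq, show κ = (Y.1, κ.2) by rw [hY]]
    exact position_add_mem_obstacle Y κ.2
  have hdis : ∀ {z : ℂ} {l l' : Fin Q.D × (ℤ × ℤ)}, z ∈ Q.obstacle l → z ∈ Q.obstacle l' → l = l' := by
    intro z l l' h h'
    by_contra hne
    exact Set.disjoint_left.1 (disjoint_obstacle hne) h h'
  set J := {l | ∃ u ∈ Ioo 0 t₀, Q.position X + u * Q.velocity X ∈ Q.obstacle l} with hJ
  have hκJ : κ ∉ J := fun ⟨u, hu, hm⟩ =>
    hw.clear ((u + t₀) / 2) ⟨by linarith [hu.1, hw.pos], by linarith [hu.2]⟩ _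
      (mem_interior_obstacle_of_between hm hκt (by linarith [hu.2]) (by linarith [hu.2]))
  have hJclear : ∀ l ∈ J, ¬MeetsInterior X l := by
    rintro l ⟨u, hu, hm⟩ ⟨u', hu', hm'⟩
    rcases lt_or_ge u' t₀ with h | h
    · exact hw.clear u' ⟨hu', h⟩ _ hm'
    · exact hw.clear ((u + t₀) / 2) ⟨by linarith [hu.1, hw.pos], by linarith [hu.2]⟩ _
        (mem_interior_obstacle_of_between hm (interior_subset hm') (by linarith [hu.2])
          (by linarith [hu.2]))
  -- If the ray of X enters the interior of κ, nearby rays meet κ automatically; κ contributes a cut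
  -- only if it is merely touched.
  set G : Set (Fin Q.D × (ℤ × ℤ)) := {l | l ∈ J ∨ (l = κ ∧ ¬MeetsInterior X κ)} with hG
  have hGfin : G.Finite := by
    refine (Q.finite_obstacle_meets (‖Q.position X‖ + t₀)).subset ?_
    have hb : ∀ u : ℝ, 0 < u → u ≤ t₀ → ‖Q.position X + u * Q.velocity X‖ ≤ ‖Q.position X‖ + t₀ := by
      intro u hu hu'
      refine (norm_add_le _ _).trans ?_
      rw [norm_mul, norm_velocity, mul_one, Complex.norm_real, Real.norm_of_nonneg hu.le]
      linarith
    rintro l (⟨u, hu, hm⟩ | ⟨rfl, -⟩)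
    · exact ⟨_, hm, hb u hu.1 hu.2.le⟩
    · exact ⟨_, hκt, hb t₀ hw.pos le_rfl⟩
  have : Finite G := hGfin
  have hmeet : ∀ l : G, ∃ u : ℝ, 0 < u ∧ Q.position X + u * Q.velocity X ∈ Q.obstacle l := by
    rintro ⟨l, ⟨u, hu, hm⟩ | ⟨rfl, -⟩⟩
    · exact ⟨u, hu.1, hm⟩
    · exact ⟨t₀, hw.pos, hκt⟩
  choose t ht0 htm using hmeet
  have hinj : Function.Injective t := fun j k hjk => Subtype.ext (hdis (htm j) (hjk ▸ htm k))
  have htouch : ∀ l : G, ∃ σ, (Q.scatterer i).Touches (Q.obstacle l) s₀ φ₀ (t l) σ := by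
    intro l
    refine Scatterer.exists_touches (isCompact_obstacle _) (strictConvex_obstacle _)
      (interior_obstacle_nonempty _) (abs_le.2 φ₀.2) (ht0 l) (htm l) (fun h => ?_) fun u hu h => ?_
    · have h1 := hdis h (position_mem_obstacle X)
      refine ray_notMem_start X (ht0 l) (h1 ▸ htm l)
    · rcases l with ⟨l, h' | ⟨rfl, h'⟩⟩
      · exact hJclear l h' ⟨u, hu, h⟩
      · exact h' ⟨u, hu, h⟩
  choose σ hσ using htouch
  obtain ⟨ρ, hρ, hρt, hsep⟩ := exists_spacing ht0 hinj
  refine ⟨G, fun l => (Q.scatterer i).cut (Q.obstacle l) s₀ φ₀ (t l) ρ (σ l),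
    -- The target κ must be met, the obstacles touched before it must be missed: the sign is
    -- reversed for them and their inequality is strict.
    fun l => if (l : Fin Q.D × (ℤ × ℤ)) = κ then σ l else -σ l,
    fun l => (l : Fin Q.D × (ℤ × ℤ)) ≠ κ, hGfin, fun l => ?_,
    Scatterer.crossingFamily_cut hσ (abs_le.2 φ₀.2) hρ hρt hsep, ?_⟩
  · rcases (hσ l).sign with h | h <;> simp only [h] <;> split_ifs <;> norm_num
  have hchart : Tendsto (fun p : ℝ × Icc (-(Real.pi / 2)) (Real.pi / 2) =>
      phasePoint (Q := Q) i p.1 p.2) (𝓝 (s₀, φ₀)) (𝓝 X) := by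
    rw [hX, nhds_phasePoint, nhds_prod_eq]
    exact tendsto_map
  have hcoe : Tendsto (fun p : ℝ × Icc (-(Real.pi / 2)) (Real.pi / 2) => (p.1, (p.2 : ℝ)))
      (𝓝 (s₀, φ₀)) (𝓝 (s₀, (φ₀ : ℝ))) :=
    (continuous_fst.prodMk (continuous_subtype_val.comp continuous_snd)).continuousAt
  have hcut := eventually_all.2 fun l : G => hcoe.eventually ((hσ l).eventually_hit_iff hρ (hρt l))
  have hint : ∀ᶠ x in 𝓝 X, MeetsInterior X κ → MeetsInterior x κ := by
    by_cases h : MeetsInterior X κ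
    · exact (eventually_meetsInterior h).mono fun x hx _ => hx
    · exact Eventually.of_forall fun x hx => absurd hx h
  filter_upwards [hchart.eventually (eventually_label_iff hQ hY hw), hcut,
    hchart.eventually hint] with ⟨s, φ⟩ hlab hcut hint
  simp only at hlab hcut hint ⊢
  set x := phasePoint (Q := Q) i s φ with hx
  have hc1 : ∀ l : G, Meets x l ↔ 0 ≤ σ l * (φ - (Q.scatterer i).cut (Q.obstacle l) s₀ φ₀ (t l) ρ
    (σ l) s) := fun l => (hcut l).1
  have hc2 : ∀ l : G, MeetsInterior x l ↔ 0 < σ l * (φ - (Q.scatterer i).cut (Q.obstacle l) s₀ φ₀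
    (t l) ρ (σ l) s) := fun l => (hcut l).2
  have hGJ : ∀ l : G, (l : Fin Q.D × (ℤ × ℤ)) ≠ κ → (l : Fin Q.D × (ℤ × ℤ)) ∈ J := fun l hl =>
    l.2.resolve_right fun h => hl h.1
  have hmiss : ∀ (l : G) (c : Prop), (l : Fin Q.D × (ℤ × ℤ)) ≠ κ → (c ↔ True) →
      (SatisfiesCut ((Q.scatterer i).cut (Q.obstacle l) s₀ φ₀ (t l) ρ (σ l) s)
        (if (l : Fin Q.D × (ℤ × ℤ)) = κ then σ l else -σ l) c φ ↔ ¬Meets x l) := by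
    intro l c hl hcl
    rw [if_neg hl, hc1 l, SatisfiesCut, hcl]
    constructor
    · intro h h'
      have := h.2 trivial
      linarith
    · intro h
      exact ⟨by linarith, fun _ => by linarith⟩
  have hgraze : label x = κ → (Q.T x ∉ Q.grazingSet ↔ MeetsInterior x κ) := fun h => by
    rw [T_mem_grazingSet_iff hQ, h, not_not]
  constructor
  · rw [hlab]
    constructor
    · intro ⟨h1, h2⟩ l
      by_cases hl : (l : Fin Q.D × (ℤ × ℤ)) = κ
      · rw [if_pos hl]
        exact ⟨(hc1 l).1 (hl ▸ h1), fun h => absurd hl h⟩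
      · exact (hmiss l _ hl (iff_true_intro hl)).2 (h2 _ (hGJ l hl))
    · intro h
      refine ⟨?_, fun l hl => ?_⟩
      · by_cases hm : MeetsInterior X κ
        · exact (hint hm).meets
        · have := (h ⟨κ, Or.inr ⟨rfl, hm⟩⟩).1
          rw [if_pos rfl] at this
          exact (hc1 ⟨κ, Or.inr ⟨rfl, hm⟩⟩).2 this
      · have hne : l ≠ κ := fun he => hκJ (he ▸ hl)
        exact (hmiss ⟨l, Or.inl hl⟩ _ hne (iff_true_intro hne)).1 (h ⟨l, Or.inl hl⟩)
  · constructor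
    · intro ⟨h1, h2⟩ l
      have h3 := (hgraze h1).1 h2
      by_cases hl : (l : Fin Q.D × (ℤ × ℤ)) = κ
      · rw [if_pos hl]
        have h4 := (hc2 l).1 (hl ▸ h3)
        exact ⟨h4.le, fun _ => h4⟩
      · exact (hmiss l _ hl Iff.rfl).2 ((hlab.1 h1).2 _ (hGJ l hl))
    · intro h
      have h3 : MeetsInterior x κ := by
        by_cases hm : MeetsInterior X κ
        · exact hint hm
        · have := (h ⟨κ, Or.inr ⟨rfl, hm⟩⟩).2 trivial
          rw [if_pos rfl] at this
          exact (hc2 ⟨κ, Or.inr ⟨rfl, hm⟩⟩).2 this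
      have h1 : label x = κ := hlab.2 ⟨h3.meets, fun l hl => by
        have hne : l ≠ κ := fun he => hκJ (he ▸ hl)
        exact (hmiss ⟨l, Or.inl hl⟩ _ hne Iff.rfl).1 (h ⟨l, Or.inl hl⟩)⟩
      exact ⟨h1, (hgraze h1).2 h3⟩

end SinaiTable

/-- The strip is written with the same kind of cuts as the label sets. Only the edge through the
base level matters locally, and there is none if the level is inside the strip. -/
theorem eventually_strip {s₀ φ₀ : ℝ} (hφ₀ : |φ₀| ≤ Real.pi / 2) : ∀ᶠ p : ℝ × ℝ in 𝓝 (s₀, φ₀),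
    (|p.2| ≤ Real.pi / 2 ↔ ∀ b : StripEdge φ₀, SatisfiesCut φ₀ b.sign False p.2) ∧
    (|p.2| < Real.pi / 2 ↔ ∀ b : StripEdge φ₀, SatisfiesCut φ₀ b.sign True p.2) := by
  have hpi := Real.pi_pos
  have h1 : ∀ᶠ φ in 𝓝 φ₀, (φ₀ < Real.pi / 2 → φ < Real.pi / 2) ∧
      (-(Real.pi / 2) < φ₀ → -(Real.pi / 2) < φ) := by
    refine Eventually.and ?_ ?_
    · by_cases h : φ₀ < Real.pi / 2
      · exact (gt_mem_nhds h).mono fun _ h' _ => h'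
      · exact Eventually.of_forall fun _ h' => absurd h' h
    · by_cases h : -(Real.pi / 2) < φ₀
      · exact (lt_mem_nhds h).mono fun _ h' _ => h'
      · exact Eventually.of_forall fun _ h' => absurd h' h
  have h2 : Tendsto (Prod.snd : ℝ × ℝ → ℝ) (𝓝 (s₀, φ₀)) (𝓝 φ₀) := continuous_snd.continuousAt
  filter_upwards [h2.eventually h1] with ⟨s, φ⟩ ⟨h3, h4⟩
  have h5 := abs_le.1 hφ₀
  simp only [abs_le, abs_lt]
  rcases h5.2.lt_or_eq with hr | hr
  · rcases h5.1.lt_or_eq with hl | hl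
    · have hemp : IsEmpty (StripEdge φ₀) := ⟨fun b => by
        rcases b.sign_eq with h | h
        · linarith [StripEdge.eq_of_sign_one h]
        · linarith [StripEdge.eq_of_sign_neg_one h]⟩
      exact ⟨⟨fun _ => isEmptyElim, fun _ => ⟨(h4 hl).le, (h3 hr).le⟩⟩,
        ⟨fun _ => isEmptyElim, fun _ => ⟨h4 hl, h3 hr⟩⟩⟩
    · set c : StripEdge φ₀ := ⟨false, by simp [hl]⟩
      have hc : ∀ b : StripEdge φ₀, b.sign = 1 := fun b => b.sign_eq.resolve_right fun h => by
        linarith [StripEdge.eq_of_sign_neg_one h]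
      refine ⟨⟨fun h b => ?_, fun h => ?_⟩, ⟨fun h b => ?_, fun h => ?_⟩⟩
      · rw [hc b]; exact ⟨by linarith [h.1], False.elim⟩
      · have := (h c).1
        rw [hc c] at this
        exact ⟨by linarith, (h3 hr).le⟩
      · rw [hc b]; exact ⟨by linarith [h.1], fun _ => by linarith [h.1]⟩
      · have := (h c).2 trivial
        rw [hc c] at this
        exact ⟨by linarith, h3 hr⟩
  · set c : StripEdge φ₀ := ⟨true, by simp [hr]⟩
    have hc : ∀ b : StripEdge φ₀, b.sign = -1 := fun b => b.sign_eq.resolve_left fun h => by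
      linarith [StripEdge.eq_of_sign_one h]
    have hl : -(Real.pi / 2) < φ₀ := by linarith
    refine ⟨⟨fun h b => ?_, fun h => ?_⟩, ⟨fun h b => ?_, fun h => ?_⟩⟩
    · rw [hc b]; exact ⟨by linarith [h.2], False.elim⟩
    · have := (h c).1
      rw [hc c] at this
      exact ⟨(h4 hl).le, by linarith⟩
    · rw [hc b]; exact ⟨by linarith [h.2], fun _ => by linarith [h.2]⟩
    · have := (h c).2 trivial
      rw [hc c] at this
      exact ⟨h4 hl, by linarith⟩

namespace SinaiTable

variable {Q : SinaiTable}

/-- A set that is bounded near a point by crossing families is locally connected there. -/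
theorem exists_isPreconnected_of_cuts {A : Set Q.PhaseSpace} {i : Fin Q.D} {s₀ : ℝ}
    {φ₀ : Icc (-(Real.pi / 2)) (Real.pi / 2)} {ι ι' : Type*} [Finite ι] [Finite ι']
    {f : ι → ℝ → ℝ} {f' : ι' → ℝ → ℝ} (hf : CrossingFamily s₀ φ₀ f)
    (hf' : CrossingFamily s₀ (-φ₀) f') {ε : ι → ℝ} {ε' : ι' → ℝ}
    (hε : ∀ j, ε j = 1 ∨ ε j = -1) (hε' : ∀ j, ε' j = 1 ∨ ε' j = -1)
    {strict : ι → Prop} {strict' : ι' → Prop} {edge : Prop}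
    (hA : ∀ᶠ p : ℝ × Icc (-(Real.pi / 2)) (Real.pi / 2) in 𝓝 (s₀, φ₀),
      phasePoint (Q := Q) i p.1 p.2 ∈ A ↔
        (∀ j, SatisfiesCut (f j p.1) (ε j) (strict j) p.2) ∧
        (∀ j, SatisfiesCut (-f' j p.1) (ε' j) (strict' j) p.2) ∧
        ∀ b : StripEdge φ₀, SatisfiesCut φ₀ b.sign edge p.2) :
    ∃ U ∈ 𝓝 (phasePoint (Q := Q) i s₀ φ₀), ∃ C, IsPreconnected C ∧ C ⊆ A ∧ U ∩ A ⊆ C := by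
  have hpi : -(Real.pi / 2) ≤ Real.pi / 2 := by linarith [Real.pi_pos]
  -- The projection of the angle onto the strip extends the chart to the plane, where the wedge
  -- lemma applies.
  set pr : ℝ × ℝ → ℝ × Icc (-(Real.pi / 2)) (Real.pi / 2) :=
    fun p => (p.1, projIcc _ _ hpi p.2) with hpr
  have hprc : Continuous pr := continuous_fst.prodMk (continuous_projIcc.comp continuous_snd)
  have hpr0 : pr (s₀, φ₀) = (s₀, φ₀) := by simp [hpr]
  have hprv : ∀ p : ℝ × Icc (-(Real.pi / 2)) (Real.pi / 2), pr (p.1, (p.2 : ℝ)) = p := fun p => by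
    simp [hpr]
  have hU : ∀ᶠ p in 𝓝 (s₀, (φ₀ : ℝ)), _ :=
    ((hprc.tendsto _).eventually (hpr0.symm ▸ hA)).and (eventually_strip (abs_le.2 φ₀.2))
  obtain ⟨V, hV, hVU, hVc⟩ := exists_isPreconnected_of_crossingFamily hf hf' hε hε'
    (abs_le.2 φ₀.2) strict strict' edge hU
  set W := V ∩ {p | (∀ j, SatisfiesCut (f j p.1) (ε j) (strict j) p.2) ∧
        (∀ j, SatisfiesCut (-f' j p.1) (ε' j) (strict' j) p.2) ∧
        ∀ b : StripEdge φ₀, SatisfiesCut φ₀ b.sign edge p.2} with hW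
  have hchart : Continuous fun p : ℝ × ℝ => phasePoint (Q := Q) i (pr p).1 (pr p).2 :=
    (continuous_phasePoint i).comp (((AddCircle.continuous_mk' _).comp
      (continuous_fst.comp hprc)).prodMk (continuous_snd.comp hprc))
  have hcoe : Tendsto (fun p : ℝ × Icc (-(Real.pi / 2)) (Real.pi / 2) => (p.1, (p.2 : ℝ)))
      (𝓝 (s₀, φ₀)) (𝓝 (s₀, (φ₀ : ℝ))) :=
    (continuous_fst.prodMk (continuous_subtype_val.comp continuous_snd)).continuousAt
  refine ⟨(fun p : ℝ × Icc (-(Real.pi / 2)) (Real.pi / 2) => phasePoint (Q := Q) i p.1 p.2) ''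
    ((fun p => (p.1, (p.2 : ℝ))) ⁻¹' V), ?_,
    (fun p => phasePoint (Q := Q) i (pr p).1 (pr p).2) '' W, hVc.image _ hchart.continuousOn, ?_, ?_⟩
  · rw [nhds_phasePoint, ← nhds_prod_eq]
    exact image_mem_map (hcoe hV)
  · rintro _ ⟨⟨s, φ⟩, ⟨hp, hc1, hc2, hc3⟩, rfl⟩
    obtain ⟨h1, h2, h3⟩ := hVU hp
    have hφ : φ ∈ Icc (-(Real.pi / 2)) (Real.pi / 2) :=
      abs_le.1 (h2.2 fun b => ⟨(hc3 b).1, False.elim⟩)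
    have hpe : pr (s, φ) = (s, ⟨φ, hφ⟩) := hprv (s, ⟨φ, hφ⟩)
    rw [hpe] at h1
    change phasePoint i ((pr (s, φ)).1 : ℝ) (pr (s, φ)).2 ∈ A
    rw [hpe]
    exact h1.2 ⟨hc1, hc2, hc3⟩
  · rintro _ ⟨⟨p, hp, rfl⟩, hmem⟩
    obtain ⟨h1, -⟩ := hVU hp
    simp only [hprv] at h1
    refine ⟨(p.1, (p.2 : ℝ)), ⟨hp, h1.1 hmem⟩, by simp only [hprv]⟩

/-- The previous label of (r, φ) is the next label of (r, -φ), so its cuts are mirror images of a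
crossing family. -/
theorem exists_isPreconnected_bilabel (hQ : Q.FiniteHorizon) (X : Q.PhaseSpace)
    (κ' κ : Fin Q.D × (ℤ × ℤ)) : ∃ U ∈ 𝓝 X, ∃ C, IsPreconnected C ∧
      C ⊆ {x | Q.bilabel x = (κ', κ)} ∧ U ∩ {x | Q.bilabel x = (κ', κ)} ⊆ C := by
  obtain ⟨s₀, φ₀, hX⟩ := phasePoint_surjective X
  generalize X.1 = i at hX
  subst hX
  have hneg : -(φ₀ : ℝ) ∈ Icc (-(Real.pi / 2)) (Real.pi / 2) := by
    constructor <;> linarith [φ₀.2.1, φ₀.2.2]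
  rcases exists_cuts hQ i s₀ φ₀ κ with h | ⟨G, f, ε, strict, hG, hε, hf, hcut⟩
  · exact ⟨_, h, ∅, isPreconnected_empty, empty_subset _,
      fun x hx => (hx.1 (Prod.ext_iff.1 hx.2).2).elim⟩
  rcases exists_cuts hQ i s₀ ⟨-(φ₀ : ℝ), hneg⟩ κ' with h | ⟨G', f', ε', strict', hG', hε', hf', hcut'⟩
  · have h' : ∀ᶠ x in 𝓝 (phasePoint (Q := Q) i s₀ φ₀), label (flip x) ≠ κ' :=
      (continuous_flip.tendsto (phasePoint (Q := Q) i s₀ φ₀)).eventually h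
    exact ⟨_, h', ∅, isPreconnected_empty, empty_subset _,
      fun x hx => (hx.1 (Prod.ext_iff.1 hx.2).1).elim⟩
  have : Finite G := hG
  have : Finite G' := hG'
  have hmir : Tendsto (fun p : ℝ × Icc (-(Real.pi / 2)) (Real.pi / 2) =>
      ((p.1, ⟨-(p.2 : ℝ), by constructor <;> linarith [p.2.2.1, p.2.2.2]⟩) :
        ℝ × Icc (-(Real.pi / 2)) (Real.pi / 2))) (𝓝 (s₀, φ₀)) (𝓝 (s₀, ⟨-(φ₀ : ℝ), hneg⟩)) :=
    (continuous_fst.prodMk (Continuous.subtype_mk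
      (continuous_subtype_val.comp continuous_snd).neg _)).continuousAt
  refine exists_isPreconnected_of_cuts hf hf' (ε' := fun j => -ε' j) hε (fun j => ?_)
    (strict := strict) (strict' := strict') (edge := False) ?_
  · rcases hε' j with h | h <;> simp [h]
  have hstr : ∀ᶠ p : ℝ × Icc (-(Real.pi / 2)) (Real.pi / 2) in 𝓝 (s₀, φ₀), _ :=
    (show Tendsto (fun p : ℝ × Icc (-(Real.pi / 2)) (Real.pi / 2) => (p.1, (p.2 : ℝ)))
      (𝓝 (s₀, φ₀)) (𝓝 (s₀, (φ₀ : ℝ))) from (continuous_fst.prodMk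
        (continuous_subtype_val.comp continuous_snd)).continuousAt).eventually
          (eventually_strip (abs_le.2 φ₀.2))
  filter_upwards [hcut, hmir.eventually hcut', hstr] with ⟨s, φ⟩ h1 h2 h3
  replace h1 := h1.1
  replace h2 := h2.1
  replace h3 := h3.1
  simp only at h1 h2 h3 ⊢
  have h4 : ∀ j, SatisfiesCut (f' j s) (ε' j) (strict' j) (-(φ : ℝ)) ↔
      SatisfiesCut (-f' j s) (-ε' j) (strict' j) φ := fun j => by
    rw [SatisfiesCut, SatisfiesCut,
      show ε' j * (-(φ : ℝ) - f' j s) = -ε' j * (φ - -f' j s) by ring]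
  change (label (flip (phasePoint (Q := Q) i s φ)), label (phasePoint (Q := Q) i s φ)) = (κ', κ) ↔ _
  rw [Prod.mk.injEq, h1]
  have h5 : label (flip (phasePoint (Q := Q) i s φ)) = κ' ↔ _ := h2
  rw [h5]
  simp only [h4]
  constructor
  · exact fun h => ⟨h.2, h.1, h3.1 (abs_le.2 φ.2)⟩
  · exact fun h => ⟨h.2.1, h.1⟩

theorem mem_singularSet_one {x : Q.PhaseSpace} :
    x ∈ Q.singularSet 1 ↔ x ∈ Q.grazingSet ∨ Q.T x ∈ Q.grazingSet := by
  simp only [singularSet, mem_iUnion, mem_preimage, mem_Iic, exists_prop]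
  constructor
  · rintro ⟨n, hn, h⟩
    interval_cases n
    · exact Or.inl h
    · exact Or.inr h
  · rintro (h | h)
    · exact ⟨0, zero_le_one, h⟩
    · exact ⟨1, le_rfl, h⟩

/-- Removing S_1 removes the edges of the strip and the tangential next collisions, which makes all
cuts strict. -/
theorem exists_isPreconnected_label (hQ : Q.FiniteHorizon) (X : Q.PhaseSpace)
    (κ : Fin Q.D × (ℤ × ℤ)) : ∃ U ∈ 𝓝 X, ∃ C, IsPreconnected C ∧
      C ⊆ {x | label x = κ ∧ x ∉ Q.singularSet 1} ∧
      U ∩ {x | label x = κ ∧ x ∉ Q.singularSet 1} ⊆ C := by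
  obtain ⟨s₀, φ₀, hX⟩ := phasePoint_surjective X
  generalize X.1 = i at hX
  subst hX
  rcases exists_cuts hQ i s₀ φ₀ κ with h | ⟨G, f, ε, strict, hG, hε, hf, hcut⟩
  · exact ⟨_, h, ∅, isPreconnected_empty, empty_subset _, fun x hx => (hx.1 hx.2.1).elim⟩
  have : Finite G := hG
  refine exists_isPreconnected_of_cuts hf (CrossingFamily.of_isEmpty s₀ (-φ₀) (ι := Empty)
    fun j => j.elim) (ε' := fun j => j.elim) hε (fun j => j.elim) (strict := fun _ => True)
    (strict' := fun j => j.elim) (edge := True) ?_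
  have hstr : ∀ᶠ p : ℝ × Icc (-(Real.pi / 2)) (Real.pi / 2) in 𝓝 (s₀, φ₀), _ :=
    (show Tendsto (fun p : ℝ × Icc (-(Real.pi / 2)) (Real.pi / 2) => (p.1, (p.2 : ℝ)))
      (𝓝 (s₀, φ₀)) (𝓝 (s₀, (φ₀ : ℝ))) from (continuous_fst.prodMk
        (continuous_subtype_val.comp continuous_snd)).continuousAt).eventually
          (eventually_strip (abs_le.2 φ₀.2))
  filter_upwards [hcut, hstr] with ⟨s, φ⟩ h2 h3
  replace h2 := h2.2
  replace h3 := h3.2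
  simp only at h2 h3 ⊢
  have h4 : phasePoint (Q := Q) i s φ ∉ Q.grazingSet ↔ |(φ : ℝ)| < Real.pi / 2 := by
    change ¬(|(φ : ℝ)| = Real.pi / 2) ↔ _
    exact ⟨fun h => lt_of_le_of_ne (abs_le.2 φ.2) h, fun h => h.ne⟩
  rw [mem_singularSet_one, not_or, ← h2, ← h3, h4]
  constructor
  · exact fun h => ⟨⟨h.1, h.2.2⟩, fun j => j.elim, h.2.1⟩
  · exact fun h => ⟨h.1.1, h.2.2, h.1.2⟩

theorem exists_nhds_forall {β : Type*} {L : Set β} (hL : L.Finite) {X : Q.PhaseSpace}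
    {A : β → Set Q.PhaseSpace} {q : Q.PhaseSpace → Q.PhaseSpace → Prop}
    (h : ∀ b ∈ L, ∃ U ∈ 𝓝 X, ∀ y ∈ U ∩ A b, ∀ z ∈ U ∩ A b, q y z) :
    ∃ U ∈ 𝓝 X, ∀ b ∈ L, ∀ y ∈ U, ∀ z ∈ U, y ∈ A b → z ∈ A b → q y z := by
  choose! U hU hq using h
  exact ⟨⋂ b ∈ L, U b, (biInter_mem hL).2 hU, fun b hb y hy z hz hyA hzA =>
    hq b hb y ⟨mem_iInter₂.1 hy b hb, hyA⟩ z ⟨mem_iInter₂.1 hz b hb, hzA⟩⟩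

/-- Near X the points with given labels lie in one connected set of such points, hence in one cell;
finitely many pairs of labels allow a common neighbourhood. -/
theorem exists_nhds_cell_eq (hQ : Q.FiniteHorizon) (X : Q.PhaseSpace) :
    ∃ U ∈ 𝓝 X, ∀ y ∈ U, ∀ z ∈ U, Q.bilabel y = Q.bilabel z → Q.cell y = Q.cell z := by
  obtain ⟨F, hF, hFm⟩ := exists_finite_labels hQ
  obtain ⟨U, hU, h⟩ := exists_nhds_forall (X := X) (hF.prod hF) (A := fun b => {x | Q.bilabel x = b})
    (q := fun y z => Q.cell y = Q.cell z) fun b _ => by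
      obtain ⟨U, hU, C, hC, hCs, hUC⟩ := exists_isPreconnected_bilabel hQ X b.1 b.2
      refine ⟨U, hU, fun y hy z hz => ?_⟩
      have hsub : C ⊆ Q.cell y := by
        have h1 : Q.bilabel y = b := hy.2
        have : C ⊆ Q.bilabel ⁻¹' {Q.bilabel y} := fun w hw => by
          rw [h1]; exact hCs hw
        exact hC.subset_connectedComponentIn (hUC hy) this
      exact (cell_eq_of_mem (hsub (hUC hz))).symm
  exact ⟨U, hU, fun y hy z hz hyz => h (Q.bilabel y) ⟨hFm _, hFm _⟩ y hy z hz rfl hyz.symm⟩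

theorem exists_nhds_component_eq (hQ : Q.FiniteHorizon) (X : Q.PhaseSpace) :
    ∃ U ∈ 𝓝 X, ∀ y ∈ U, ∀ z ∈ U, y ∉ Q.singularSet 1 → z ∉ Q.singularSet 1 → label y = label z →
      z ∈ connectedComponentIn (Q.singularSet 1)ᶜ y := by
  obtain ⟨F, hF, hFm⟩ := exists_finite_labels hQ
  obtain ⟨U, hU, h⟩ := exists_nhds_forall (X := X) hF
    (A := fun b => {x | label x = b ∧ x ∉ Q.singularSet 1})
    (q := fun y z => z ∈ connectedComponentIn (Q.singularSet 1)ᶜ y) fun b _ => by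
      obtain ⟨U, hU, C, hC, hCs, hUC⟩ := exists_isPreconnected_label hQ X b
      exact ⟨U, hU, fun y hy z hz =>
        hC.subset_connectedComponentIn (hUC hy) (fun w hw => (hCs hw).2) (hUC hz)⟩
  exact ⟨U, hU, fun y hy z hz hyS hzS hyz =>
    h (label y) (hFm _) y hy z hz ⟨rfl, hyS⟩ ⟨hyz.symm, hzS⟩⟩

end SinaiTable

/-! ### Finiteness of the partitions and uniform local statements -/

theorem finite_image_of_factors {X Y Z : Type*} {D : Set X} {c : X → Y} {f : X → Z}
    (hc : (c '' D).Finite) (h : ∀ y ∈ D, ∀ z ∈ D, c y = c z → f y = f z) : (f '' D).Finite := by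
  obtain ⟨D', hD', hbij⟩ := (surjOn_image c D).exists_bijOn_subset
  have hfin : D'.Finite := Finite.of_finite_image (hbij.image_eq.symm ▸ hc) hbij.injOn
  refine (hfin.image f).subset ?_
  rintro _ ⟨x, hx, rfl⟩
  obtain ⟨x', hx', hxx'⟩ := hbij.surjOn (mem_image_of_mem c hx)
  exact ⟨x', hx', h x' (hD' hx') x hx hxx'⟩

namespace SinaiTable

variable {Q : SinaiTable}

/-- A finite subcover by neighbourhoods in which the two labels determine the cell: the cell is a
function of a colour and the labels. -/
theorem finite_range_cell (hQ : Q.FiniteHorizon) : (range Q.cell).Finite := by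
  obtain ⟨F, hF, hFm⟩ := exists_finite_labels hQ
  obtain ⟨N, c, hc⟩ := exists_coloring (exists_nhds_cell_eq hQ)
  rw [← image_univ]
  refine finite_image_of_factors (c := fun x => (c x, Q.bilabel x)) ?_ fun y _ z _ h =>
    hc y z (Prod.ext_iff.1 h).1 (Prod.ext_iff.1 h).2
  refine (finite_univ.prod (hF.prod hF)).subset ?_
  rintro _ ⟨x, -, rfl⟩
  exact ⟨mem_univ _, hFm _, hFm _⟩

theorem finite_domains (hQ : Q.FiniteHorizon) : (Q.domains 1).Finite := by
  obtain ⟨F, hF, hFm⟩ := exists_finite_labels hQ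
  obtain ⟨N, c, hc⟩ := exists_coloring (exists_nhds_component_eq hQ)
  have h : ((fun x => connectedComponentIn (Q.singularSet 1)ᶜ x) '' (Q.singularSet 1)ᶜ).Finite := by
    refine finite_image_of_factors (c := fun x => (c x, label x)) ?_ fun y hy z hz h =>
      connectedComponentIn_eq
        (hc y z (Prod.ext_iff.1 h).1 hy hz (Prod.ext_iff.1 h).2)
    refine (finite_univ.prod hF).subset ?_
    rintro _ ⟨x, -, rfl⟩
    exact ⟨mem_univ _, hFm _⟩
  refine h.subset ?_
  rintro A ⟨x, hx, rfl⟩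
  exact ⟨x, hx, rfl⟩

/-- Points whose orbits are close for three collisions have the same cell at the middle one. -/
theorem exists_cell_eq_of_distance (hQ : Q.FiniteHorizon) : ∃ ε : ℝ, 0 < ε ∧ ∀ x y,
    Q.distance x y ≤ ε → Q.distance (Q.T x) (Q.T y) ≤ ε → label x = label y ∧
      (Q.distance (Q.T (Q.T x)) (Q.T (Q.T y)) ≤ ε → Q.cell (Q.T x) = Q.cell (Q.T y)) := by
  obtain ⟨ε₁, hε₁, h1⟩ := exists_label_eq_of_distance hQ
  obtain ⟨ε₂, hε₂, h2⟩ := exists_of_distance_le (exists_nhds_cell_eq hQ)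
  obtain ⟨ε₃, hε₃, h3⟩ := exists_index_eq_of_distance_lt Q
  refine ⟨min (min ε₁ ε₂) (ε₃ / 2), lt_min (lt_min hε₁ hε₂) (by linarith), fun x y h h' => ?_⟩
  simp only [le_min_iff] at h h' ⊢
  have hl := h1 x y h.1.1 h'.1.1
  refine ⟨hl, fun h'' => h2 _ _ h'.1.2 ?_⟩
  -- The previous label of T x consists of the scatterer of x and the opposite of the translation in
  -- the label of x.
  rw [bilabel, bilabel, label_flip_T hQ, label_flip_T hQ, hl, h3 x y (by linarith [h.2]),
    h1 _ _ h'.1.1 h''.1.1]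

theorem distance_nonneg (x y : Q.PhaseSpace) : 0 ≤ Q.distance x y := by
  rw [distance]
  split_ifs
  · exact dist_nonneg
  · exact mul_nonneg (by positivity) (Real.iSup_nonneg fun _ => Metric.diam_nonneg)

/-- A piecewise Hölder function is uniformly Hölder on close points that lie on the same side of
the singularities. -/
theorem IsPiecewiseHolder.exists_uniform (hQ : Q.FiniteHorizon) {g : Q.PhaseSpace → ℝ} {α : ℝ}
    (hg : Q.IsPiecewiseHolder α g) : ∃ C ε : ℝ, 0 ≤ C ∧ 0 < ε ∧ ∀ x y, Q.distance x y ≤ ε →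
      x ∉ Q.singularSet 1 → y ∉ Q.singularSet 1 → label x = label y →
        |g x - g y| ≤ C * Q.distance x y ^ α := by
  obtain ⟨ε, hε, h1⟩ := exists_of_distance_le (exists_nhds_component_eq hQ)
  choose! C hC using hg
  have hfin := (finite_domains hQ).image C
  obtain ⟨B, hB⟩ := hfin.bddAbove
  refine ⟨max B 0, ε, le_max_right _ _, hε, fun x y hxy hx hy hl => ?_⟩
  have hA : connectedComponentIn (Q.singularSet 1)ᶜ x ∈ Q.domains 1 := ⟨x, hx, rfl⟩
  refine (hC _ hA x (mem_connectedComponentIn hx) y (h1 x y hxy hx hy hl)).trans ?_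
  gcongr
  · exact Real.rpow_nonneg (distance_nonneg x y) α
  · exact (hB (mem_image_of_mem C hA)).trans (le_max_left _ _)

end SinaiTable

/-! ### Exponential growth rates in the extended nonnegative numbers -/

/-- The real exponential function with values in the extended nonnegative numbers. -/
def expENN (a : ℝ) : ℝ≥0∞ := ENNReal.ofReal (Real.exp a)

theorem expENN_add (a b : ℝ) : expENN (a + b) = expENN a * expENN b := by
  rw [expENN, Real.exp_add, ENNReal.ofReal_mul (Real.exp_pos a).le, expENN, expENN]

theorem expENN_mono {a b : ℝ} (h : a ≤ b) : expENN a ≤ expENN b :=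
  ENNReal.ofReal_le_ofReal (Real.exp_le_exp.2 h)

theorem expENN_zero : expENN 0 = 1 := by simp [expENN]

theorem expENN_ne_zero (a : ℝ) : expENN a ≠ 0 := by simp [expENN, Real.exp_pos]

theorem expENN_ne_top (a : ℝ) : expENN a ≠ ∞ := ENNReal.ofReal_ne_top

theorem expENN_mul_neg (a : ℝ) : expENN a * expENN (-a) = 1 := by
  rw [← expENN_add, add_neg_cancel, expENN_zero]

theorem log_expENN (a : ℝ) : ENNReal.log (expENN a) = (a : EReal) := by
  rw [ENNReal.log_pos_real (expENN_ne_zero a) (expENN_ne_top a), expENN,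
    ENNReal.toReal_ofReal (Real.exp_pos a).le, Real.log_exp]

theorem eventually_le_expENN {C : ℝ≥0∞} (hC : C ≠ ∞) (k : ℕ) {δ : ℝ} (hδ : 0 < δ) :
    ∀ᶠ n : ℕ in atTop, C * (n : ℝ≥0∞) ^ k ≤ expENN (n * δ) := by
  have h1 : Tendsto (fun n : ℕ => C.toReal * ((n : ℝ) ^ k * Real.exp (-δ * n))) atTop (𝓝 0) := by
    have h2 := ((Real.tendsto_pow_mul_exp_neg_atTop_nhds_zero k).comp
      (tendsto_natCast_atTop_atTop.const_mul_atTop hδ)).const_mul (C.toReal / δ ^ k)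
    rw [mul_zero] at h2
    refine h2.congr fun n => ?_
    simp only [Function.comp_apply, mul_pow, neg_mul]
    field_simp
  filter_upwards [h1.eventually (gt_mem_nhds one_pos)] with n hn
  have h3 : C * (n : ℝ≥0∞) ^ k = ENNReal.ofReal (C.toReal * (n : ℝ) ^ k) := by
    rw [ENNReal.ofReal_mul ENNReal.toReal_nonneg, ENNReal.ofReal_toReal hC,
      ENNReal.ofReal_pow (Nat.cast_nonneg n), ENNReal.ofReal_natCast]
  rw [h3]
  refine ENNReal.ofReal_le_ofReal ?_
  have h4 : C.toReal * (n : ℝ) ^ k = C.toReal * ((n : ℝ) ^ k * Real.exp (-δ * n)) *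
      Real.exp (n * δ) := by
    rw [mul_assoc, mul_assoc, ← Real.exp_add, show -δ * n + n * δ = 0 by ring, Real.exp_zero, mul_one]
  rw [h4]
  exact mul_le_of_le_one_left (Real.exp_pos _).le hn.le

theorem limsup_log_div_le {a : ℕ → ℝ≥0∞} {P : ℝ}
    (h : ∀ δ > 0, ∀ᶠ n : ℕ in atTop, a n ≤ expENN (n * (P + δ))) :
    limsup (fun n : ℕ => ENNReal.log (a n) / (n : EReal)) atTop ≤ (P : EReal) := by
  refine EReal.le_of_forall_lt_iff_le.1 fun z hz => ?_
  have hz' : P < z := EReal.coe_lt_coe_iff.1 hz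
  refine limsup_le_of_le (by isBoundedDefault) ?_
  filter_upwards [h (z - P) (by linarith), eventually_gt_atTop 0] with n hn hn0
  have h1 := ENNReal.log_monotone hn
  rw [log_expENN] at h1
  have hn0' : (0 : EReal) < n := by exact_mod_cast hn0
  rw [EReal.div_le_iff_le_mul hn0' (EReal.natCast_ne_top n)]
  refine h1.trans (le_of_eq ?_)
  rw [show (n : ℝ) * (P + (z - P)) = n * z by ring, EReal.coe_mul]
  rfl

theorem le_limsup_log_div {a : ℕ → ℝ≥0∞} {P : ℝ}
    (h : ∀ δ > 0, ∀ᶠ n : ℕ in atTop, expENN (n * (P - δ)) ≤ a n) :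
    (P : EReal) ≤ limsup (fun n : ℕ => ENNReal.log (a n) / (n : EReal)) atTop := by
  refine EReal.ge_of_forall_gt_iff_ge.1 fun z hz => ?_
  have hz' : z < P := EReal.coe_lt_coe_iff.1 hz
  refine le_limsup_of_frequently_le (Eventually.frequently ?_) (by isBoundedDefault)
  filter_upwards [h (P - z) (by linarith), eventually_gt_atTop 0] with n hn hn0
  have h1 := ENNReal.log_monotone hn
  rw [log_expENN] at h1
  have hn0' : (0 : EReal) < n := by exact_mod_cast hn0
  rw [EReal.le_div_iff_mul_le hn0' (EReal.natCast_ne_top n)]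
  refine le_trans (le_of_eq ?_) h1
  rw [show (n : ℝ) * (P - (P - z)) = z * n by ring, EReal.coe_mul]
  rfl

/-- The map φ is at most as many to one as there are values of c, so each term on the right is used
at most that often. -/
theorem tsum_le_card_mul_tsum {α β ι : Type*} [Finite ι] {φ : α → β} {c : α → ι}
    (hinj : ∀ a b, φ a = φ b → c a = c b → a = b) {f : α → ℝ≥0∞} {h : β → ℝ≥0∞}
    (hfh : ∀ a, f a ≤ h (φ a)) : ∑' a, f a ≤ Nat.card ι * ∑' b, h b := by
  have := Fintype.ofFinite ι
  calc ∑' a, f a ≤ ∑' a, (fun p : β × ι => h p.1) (φ a, c a) := ENNReal.tsum_le_tsum hfh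
    _ ≤ ∑' p : β × ι, h p.1 := ENNReal.tsum_comp_le_tsum_of_injective
        (fun a b hab => hinj a b (Prod.ext_iff.1 hab).1 (Prod.ext_iff.1 hab).2) _
    _ = Nat.card ι * ∑' b, h b := by
        rw [ENNReal.tsum_prod', ← ENNReal.tsum_mul_left]
        refine tsum_congr fun b => ?_
        simp [tsum_fintype, Nat.card_eq_fintype_card]

theorem tsum_le_tsum_of_injective {α β : Type*} {φ : α → β} (hinj : Function.Injective φ)
    {f : α → ℝ≥0∞} {h : β → ℝ≥0∞} (hfh : ∀ a, f a ≤ h (φ a)) : ∑' a, f a ≤ ∑' b, h b :=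
  (ENNReal.tsum_le_tsum hfh).trans (ENNReal.tsum_comp_le_tsum_of_injective hinj h)

/-! ### Partition sums and the existence of the pressure -/

namespace SinaiTable

variable {Q : SinaiTable} {g : Q.PhaseSpace → ℝ} {G : ℝ}

variable (Q) in
/-- The points whose first `n + 1` collisions lie in the same cells as those of `x`. -/
def atom (n : ℕ) (x : Q.PhaseSpace) : Set Q.PhaseSpace :=
  {y | ∀ i ≤ n, Q.cell (Q.T^[i] y) = Q.cell (Q.T^[i] x)}

theorem mem_atom_self (n : ℕ) (x : Q.PhaseSpace) : x ∈ Q.atom n x := fun _ _ => rfl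

theorem atom_eq_iff {n : ℕ} {x y : Q.PhaseSpace} : Q.atom n x = Q.atom n y ↔
    ∀ i ≤ n, Q.cell (Q.T^[i] x) = Q.cell (Q.T^[i] y) := by
  constructor
  · exact fun h => (h ▸ mem_atom_self n x : x ∈ Q.atom n y)
  · intro h
    ext z
    exact forall₂_congr fun i hi => by rw [h i hi]

theorem atom_eq_of_mem {n : ℕ} {x y : Q.PhaseSpace} (h : y ∈ Q.atom n x) :
    Q.atom n y = Q.atom n x := atom_eq_iff.2 h

theorem partition_eq (hQ : Q.FiniteHorizon) (n : ℕ) : Q.partition n = range (Q.atom n) := by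
  ext A
  rw [partition, basePartition_eq hQ]
  constructor
  · rintro ⟨⟨x, hx⟩, a, ha, rfl⟩
    refine ⟨x, ?_⟩
    ext y
    simp only [mem_iInter, mem_preimage, mem_Iic] at hx ⊢
    refine forall₂_congr fun i hi => ?_
    obtain ⟨w, hw⟩ := ha i hi
    have h1 := hx i hi
    rw [← hw] at h1 ⊢
    rw [cell_eq_of_mem h1]
    exact ⟨fun h => h ▸ mem_cell_self _, fun h => cell_eq_of_mem h⟩
  · rintro ⟨x, rfl⟩
    refine ⟨⟨x, mem_atom_self n x⟩, fun i => Q.cell (Q.T^[i] x), fun i _ => ⟨_, rfl⟩, ?_⟩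
    ext y
    simp only [mem_iInter, mem_preimage, mem_Iic]
    exact forall₂_congr fun i _ => ⟨fun h => h ▸ mem_cell_self _, fun h => cell_eq_of_mem h⟩

/-- The element of the partition that contains `x`. -/
def atomOf (hQ : Q.FiniteHorizon) (n : ℕ) (x : Q.PhaseSpace) : Q.partition n :=
  ⟨Q.atom n x, partition_eq hQ n ▸ mem_range_self x⟩

theorem atomOf_eq_iff (hQ : Q.FiniteHorizon) {n : ℕ} {x y : Q.PhaseSpace} :
    atomOf hQ n x = atomOf hQ n y ↔ ∀ i ≤ n, Q.cell (Q.T^[i] x) = Q.cell (Q.T^[i] y) := by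
  rw [atomOf, atomOf, Subtype.mk.injEq, atom_eq_iff]

theorem atomOf_of_mem (hQ : Q.FiniteHorizon) {n : ℕ} {A : Q.partition n} {x : Q.PhaseSpace}
    (hx : x ∈ (A : Set Q.PhaseSpace)) : atomOf hQ n x = A := by
  obtain ⟨A, hA⟩ := A
  rw [partition_eq hQ] at hA
  obtain ⟨y, rfl⟩ := hA
  exact Subtype.ext (atom_eq_of_mem hx)

theorem finite_partition (hQ : Q.FiniteHorizon) (n : ℕ) : Finite (Q.partition n) := by
  have := (finite_range_cell hQ).to_subtype
  refine Finite.of_injective (β := Fin (n + 1) → range Q.cell)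
    (fun A i => ⟨Q.cell (Q.T^[i] A.2.1.some), mem_range_self _⟩) fun A B h => ?_
  rw [← atomOf_of_mem hQ A.2.1.some_mem, ← atomOf_of_mem hQ B.2.1.some_mem, atomOf_eq_iff]
  intro i hi
  exact congr_arg Subtype.val (congr_fun h ⟨i, by omega⟩)

variable (Q) in
/-- The sum `∑_{A ∈ P_0^n} sup_A exp (S_n g)`. -/
def partitionSum (g : Q.PhaseSpace → ℝ) (n : ℕ) : ℝ≥0∞ :=
  ∑' A : Q.partition n, ⨆ x ∈ (A : Set Q.PhaseSpace), Q.weight g n x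

theorem weight_eq (n : ℕ) (x : Q.PhaseSpace) :
    Q.weight g n x = expENN (birkhoffSum Q.T g n x) := rfl

theorem weight_add (n m : ℕ) (x : Q.PhaseSpace) :
    Q.weight g (n + m) x = Q.weight g n x * Q.weight g m (Q.T^[n] x) := by
  rw [weight_eq, birkhoffSum_add, expENN_add, weight_eq, weight_eq]

theorem weight_le {s : ℝ} (hs : ∀ x, g x ≤ s) (n : ℕ) (x : Q.PhaseSpace) :
    Q.weight g n x ≤ expENN (n * s) := by
  refine expENN_mono ?_
  rw [birkhoffSum]
  simpa using Finset.sum_le_card_nsmul (Finset.range n) (fun i => g (Q.T^[i] x)) s fun i _ => hs _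

theorem le_weight (hG : ∀ x, |g x| ≤ G) (n : ℕ) (x : Q.PhaseSpace) :
    expENN (n * -G) ≤ Q.weight g n x := by
  refine expENN_mono ?_
  rw [birkhoffSum]
  simpa using Finset.card_nsmul_le_sum (Finset.range n) (fun i => g (Q.T^[i] x)) (-G)
    fun i _ => (abs_le.1 (hG _)).1

/-- Prolonging an orbit segment by k steps at either end changes its Birkhoff sum by at most 2 k G.
-/
theorem weight_iterate_le (hG : ∀ x, |g x| ≤ G) (k n : ℕ) (x : Q.PhaseSpace) :
    Q.weight g n (Q.T^[k] x) ≤ expENN (2 * k * G) * Q.weight g (n + 2 * k) x := by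
  have h1 : Q.weight g (n + 2 * k) x =
      Q.weight g k x * Q.weight g n (Q.T^[k] x) * Q.weight g k (Q.T^[k + n] x) := by
    rw [show n + 2 * k = k + n + k by ring, weight_add, weight_add]
  have h2 : expENN (k * -G) * Q.weight g n (Q.T^[k] x) * expENN (k * -G) ≤
      Q.weight g (n + 2 * k) x := by
    rw [h1]
    gcongr
    · exact le_weight hG k x
    · exact le_weight hG k _
  calc Q.weight g n (Q.T^[k] x) = expENN (2 * k * G) *
        (expENN (k * -G) * Q.weight g n (Q.T^[k] x) * expENN (k * -G)) := by
        have h3 : expENN (2 * k * G) * (expENN (k * -G) * expENN (k * -G)) = 1 := by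
          rw [← expENN_add, ← expENN_add, ← expENN_zero]
          congr 1; ring
        calc _ = expENN (2 * k * G) * (expENN (k * -G) * expENN (k * -G)) *
              Q.weight g n (Q.T^[k] x) := by rw [h3, one_mul]
          _ = _ := by ring
    _ ≤ _ := by gcongr

theorem partitionSum_ne_top (hQ : Q.FiniteHorizon) (hG : ∀ x, |g x| ≤ G) (n : ℕ) :
    Q.partitionSum g n ≠ ∞ := by
  have := finite_partition hQ n
  have := Fintype.ofFinite (Q.partition n)
  rw [partitionSum, tsum_fintype]
  refine (ENNReal.sum_lt_top.2 fun A _ => ?_).ne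
  exact lt_of_le_of_lt (iSup₂_le fun x _ => weight_le (fun x => (abs_le.1 (hG x)).2) n x)
    (expENN_ne_top _).lt_top

theorem weight_le_iSup_atomOf (hQ : Q.FiniteHorizon) (n : ℕ) (x : Q.PhaseSpace) :
    Q.weight g n x ≤ ⨆ y ∈ (atomOf hQ n x : Set Q.PhaseSpace), Q.weight g n y :=
  le_iSup₂_of_le x (mem_atom_self n x) le_rfl

theorem le_partitionSum (hQ : Q.FiniteHorizon) (hG : ∀ x, |g x| ≤ G) (n : ℕ) :
    expENN (n * -G) ≤ Q.partitionSum g n := by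
  have x : Q.PhaseSpace := Classical.arbitrary _
  exact ((le_weight hG n x).trans (weight_le_iSup_atomOf hQ n x)).trans
    (ENNReal.le_tsum (atomOf hQ n x))

/-- An element of length n + m is determined by its first n + 1 cells together with the m + 1 cells
from time n on, and the weights multiply. -/
theorem partitionSum_add_le (hQ : Q.FiniteHorizon) (n m : ℕ) :
    Q.partitionSum g (n + m) ≤ Q.partitionSum g n * Q.partitionSum g m := by
  have h : Q.partitionSum g n * Q.partitionSum g m = ∑' p : Q.partition n × Q.partition m,
      (⨆ x ∈ (p.1 : Set Q.PhaseSpace), Q.weight g n x) *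
        ⨆ x ∈ (p.2 : Set Q.PhaseSpace), Q.weight g m x := by
    rw [ENNReal.tsum_prod', partitionSum, ← ENNReal.tsum_mul_right]
    exact tsum_congr fun A => ENNReal.tsum_mul_left.symm
  rw [h, partitionSum]
  refine tsum_le_tsum_of_injective (φ := fun A => (atomOf hQ n A.2.1.some,
    atomOf hQ m (Q.T^[n] A.2.1.some))) (fun A B hAB => ?_) fun A => iSup₂_le fun x hx => ?_
  · obtain ⟨h1, h2⟩ := Prod.ext_iff.1 hAB
    rw [atomOf_eq_iff] at h1 h2
    rw [← atomOf_of_mem hQ A.2.1.some_mem, ← atomOf_of_mem hQ B.2.1.some_mem, atomOf_eq_iff]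
    intro i hi
    rcases le_total i n with h | h
    · exact h1 i h
    · have := h2 (i - n) (by omega)
      rwa [← Function.iterate_add_apply, ← Function.iterate_add_apply, Nat.sub_add_cancel h] at this
  · have hA := (atomOf_of_mem hQ hx).trans (atomOf_of_mem hQ A.2.1.some_mem).symm
    rw [atomOf_eq_iff] at hA
    rw [weight_add]
    have h1 : atomOf hQ n A.2.1.some = atomOf hQ n x :=
      (atomOf_eq_iff hQ).2 fun i hi => (hA i (by omega)).symm
    have h2 : atomOf hQ m (Q.T^[n] A.2.1.some) = atomOf hQ m (Q.T^[n] x) :=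
      (atomOf_eq_iff hQ).2 fun i hi => by
        rw [← Function.iterate_add_apply, ← Function.iterate_add_apply]
        exact (hA (i + n) (by omega)).symm
    simp only [h1, h2]
    exact mul_le_mul' (weight_le_iSup_atomOf hQ n x) (weight_le_iSup_atomOf hQ m _)

theorem partitionSum_ne_zero (hQ : Q.FiniteHorizon) (hG : ∀ x, |g x| ≤ G) (n : ℕ) :
    Q.partitionSum g n ≠ 0 := fun h =>
  expENN_ne_zero _ (nonpos_iff_eq_zero.1 (h ▸ le_partitionSum hQ hG n))

/-- The limit that defines the pressure exists; it bounds the partition sums from below. -/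
theorem exists_pressure (hQ : Q.FiniteHorizon) (hG : ∀ x, |g x| ≤ G) : ∃ P : ℝ,
    Tendsto (Q.pressureSeq g) atTop (𝓝 (P : EReal)) ∧
    (∀ n : ℕ, expENN (n * P) ≤ Q.partitionSum g n) ∧
    ∀ δ > 0, ∀ᶠ n : ℕ in atTop, Q.partitionSum g n ≤ expENN (n * (P + δ)) := by
  set u : ℕ → ℝ := fun n => Real.log (Q.partitionSum g n).toReal with hu
  have hpos : ∀ n, 0 < (Q.partitionSum g n).toReal := fun n =>
    ENNReal.toReal_pos (partitionSum_ne_zero hQ hG n) (partitionSum_ne_top hQ hG n)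
  have heq : ∀ n, Q.partitionSum g n = expENN (u n) := fun n => by
    rw [expENN, hu, Real.exp_log (hpos n), ENNReal.ofReal_toReal (partitionSum_ne_top hQ hG n)]
  have hmono : ∀ {a b : ℝ}, expENN a ≤ expENN b → a ≤ b := fun h => by
    rw [expENN, expENN, ENNReal.ofReal_le_ofReal_iff (Real.exp_pos _).le] at h
    exact Real.exp_le_exp.1 h
  have hsub : Subadditive u := fun n m => hmono (by
    rw [expENN_add, ← heq, ← heq, ← heq]
    exact partitionSum_add_le hQ n m)
  have hlow : ∀ n : ℕ, n * -G ≤ u n := fun n => hmono (by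
    rw [← heq]
    exact le_partitionSum hQ hG n)
  have hbdd : BddBelow (range fun n => u n / n) := by
    refine ⟨min (-G) 0, ?_⟩
    rintro _ ⟨n, rfl⟩
    rcases Nat.eq_zero_or_pos n with rfl | hn
    · simp
    · refine (min_le_left _ _).trans ?_
      rw [le_div_iff₀ (by exact_mod_cast hn)]
      linarith [hlow n]
  -- Fekete's lemma: the limit is also the infimum of u n / n, which gives the lower bound for every
  -- n and not only asymptotically.
  have hlim := hsub.tendsto_lim hbdd
  refine ⟨hsub.lim, ?_, fun n => ?_, fun δ hδ => ?_⟩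
  · refine ((continuous_coe_real_ereal.tendsto _).comp hlim).congr fun n => ?_
    change ((u n / n : ℝ) : EReal) = ENNReal.log (Q.partitionSum g n) / (n : EReal)
    rw [heq, log_expENN, EReal.coe_div]
    rfl
  · rw [heq]
    refine expENN_mono ?_
    rcases Nat.eq_zero_or_pos n with rfl | hn
    · have := hsub 0 0
      simp only [add_zero] at this
      simp only [CharP.cast_eq_zero, zero_mul]
      linarith
    · have h1 := hsub.lim_le_div hbdd hn.ne'
      rw [le_div_iff₀ (by exact_mod_cast hn)] at h1
      linarith
  · filter_upwards [hlim.eventually (gt_mem_nhds (show hsub.lim < hsub.lim + δ by linarith)),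
      eventually_gt_atTop 0] with n hn hn0
    rw [heq]
    refine expENN_mono ?_
    rw [div_lt_iff₀ (by exact_mod_cast hn0)] at hn
    linarith

end SinaiTable

/-! ### Separated and spanning sets: upper bounds, and the lower bound for separated sets -/

namespace SinaiTable

variable {Q : SinaiTable} {g : Q.PhaseSpace → ℝ} {G : ℝ}

theorem bowenDistance_le_iff {n : ℕ} {ε : ℝ} {x y : Q.PhaseSpace} :
    Q.bowenDistance n x y ≤ ε ↔ ∀ i ≤ n, Q.distance (Q.T^[i] x) (Q.T^[i] y) ≤ ε := by
  rw [bowenDistance, Finset.sup'_le_iff]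
  simp

/-- Orbits that share the cells for a long time are close in the middle. -/
theorem exists_bowenDistance_le (hQ : Q.FiniteHorizon) {ε : ℝ} (hε : 0 < ε) : ∃ k : ℕ,
    ∀ (n : ℕ) (x y : Q.PhaseSpace), atomOf hQ (n + 2 * k) x = atomOf hQ (n + 2 * k) y →
      Q.bowenDistance n (Q.T^[k] x) (Q.T^[k] y) ≤ ε := by
  obtain ⟨k, hk⟩ := exists_expansive hQ hε
  refine ⟨k, fun n x y h => bowenDistance_le_iff.2 fun j hj => ?_⟩
  rw [atomOf_eq_iff] at h
  have h1 := hk (Q.T^[j] x) (Q.T^[j] y) (index_eq_of_cell_eq (h j (by omega))) fun i hi => by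
    rw [← Function.iterate_add_apply, ← Function.iterate_add_apply]
    exact label_eq_of_cell_eq (h (i + j) (by omega))
  rw [← Function.iterate_add_apply, ← Function.iterate_add_apply] at h1 ⊢
  rw [add_comm j k]
  exact h1.le

theorem exists_preimage_iterate (hQ : Q.FiniteHorizon) (k : ℕ) (x : Q.PhaseSpace) :
    ∃ y, Q.T^[k] y = x := ((bijective_T hQ).2.iterate k) x

/-- Growth of the shifted partition sums. -/
theorem eventually_mul_partitionSum_le (hQ : Q.FiniteHorizon) (hG : ∀ x, |g x| ≤ G) {P : ℝ}
    (hP : ∀ δ > 0, ∀ᶠ n : ℕ in atTop, Q.partitionSum g n ≤ expENN (n * (P + δ))) (k : ℕ) {δ : ℝ}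
    (hδ : 0 < δ) : ∀ᶠ n : ℕ in atTop,
      expENN (2 * k * G) * Q.partitionSum g (n + 2 * k) ≤ expENN (n * (P + δ)) := by
  have hC : expENN (2 * k * G) * Q.partitionSum g (2 * k) ≠ ∞ :=
    ENNReal.mul_ne_top (expENN_ne_top _) (partitionSum_ne_top hQ hG _)
  filter_upwards [hP (δ / 2) (by linarith),
    eventually_le_expENN hC 0 (show 0 < δ / 2 by linarith)] with n h1 h2
  rw [pow_zero, mul_one] at h2
  calc expENN (2 * k * G) * Q.partitionSum g (n + 2 * k)
      ≤ expENN (2 * k * G) * (Q.partitionSum g n * Q.partitionSum g (2 * k)) :=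
        mul_le_mul_right (partitionSum_add_le hQ n (2 * k)) _
    _ = (expENN (2 * k * G) * Q.partitionSum g (2 * k)) * Q.partitionSum g n := by ring
    _ ≤ expENN (n * (δ / 2)) * expENN (n * (P + δ / 2)) := mul_le_mul' h2 h1
    _ = expENN (n * (P + δ)) := by rw [← expENN_add]; congr 1; ring

/-- Shifted back by k, two different points of a separated set lie in different elements of length n
+ 2 k, since points of one element are Bowen-close after k steps. -/
theorem sepPressure_le (hQ : Q.FiniteHorizon) (hG : ∀ x, |g x| ≤ G) {P : ℝ}
    (hP : ∀ δ > 0, ∀ᶠ n : ℕ in atTop, Q.partitionSum g n ≤ expENN (n * (P + δ))) :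
    Q.sepPressure g ≤ (P : EReal) := by
  refine iSup₂_le fun ε hε => limsup_log_div_le fun δ hδ => ?_
  obtain ⟨k, hk⟩ := exists_bowenDistance_le hQ hε
  filter_upwards [eventually_mul_partitionSum_le hQ hG hP k hδ] with n hn
  refine iSup₂_le fun E hE => le_trans ?_ hn
  choose p hp using exists_preimage_iterate hQ k
  rw [partitionSum, ← ENNReal.tsum_mul_left]
  refine tsum_le_tsum_of_injective (φ := fun x : E => atomOf hQ (n + 2 * k) (p x))
    (fun x y hxy => ?_) fun x => ?_
  · by_contra hne
    have h1 := hk n _ _ hxy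
    rw [hp, hp] at h1
    exact (hE x x.2 y y.2 fun h => hne (Subtype.ext h)).not_ge h1
  · calc Q.weight g n x = Q.weight g n (Q.T^[k] (p x)) := by rw [hp]
      _ ≤ expENN (2 * k * G) * Q.weight g (n + 2 * k) (p x) := weight_iterate_le hG k n _
      _ ≤ _ := mul_le_mul_right (weight_le_iSup_atomOf hQ _ _) _

/-- The k-th iterates of one point from each element of length n + 2 k form a spanning set, because
T is surjective. -/
theorem spanPressure_le (hQ : Q.FiniteHorizon) (hG : ∀ x, |g x| ≤ G) {P : ℝ}
    (hP : ∀ δ > 0, ∀ᶠ n : ℕ in atTop, Q.partitionSum g n ≤ expENN (n * (P + δ))) :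
    Q.spanPressure g ≤ (P : EReal) := by
  refine iSup₂_le fun ε hε => limsup_log_div_le fun δ hδ => ?_
  obtain ⟨k, hk⟩ := exists_bowenDistance_le hQ hε
  filter_upwards [eventually_mul_partitionSum_le hQ hG hP k hδ] with n hn
  set r : Q.partition (n + 2 * k) → Q.PhaseSpace := fun A => Q.T^[k] A.2.1.some with hr
  have hspan : Q.IsSpanning n ε (range r) := fun x => by
    obtain ⟨y, rfl⟩ := exists_preimage_iterate hQ k x
    exact ⟨_, mem_range_self (atomOf hQ (n + 2 * k) y),
      hk n _ _ (atomOf_of_mem hQ (atomOf hQ (n + 2 * k) y).2.1.some_mem).symm⟩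
  refine (iInf₂_le _ hspan).trans (le_trans ?_ hn)
  rw [partitionSum, ← ENNReal.tsum_mul_left]
  have hch : ∀ x : range r, ∃ A, r A = x := fun x => x.2
  choose a ha using hch
  refine tsum_le_tsum_of_injective (φ := a) (fun x y hxy => Subtype.ext ?_) fun x => ?_
  · rw [← ha x, ← ha y, hxy]
  · calc Q.weight g n x = Q.weight g n (Q.T^[k] (a x).2.1.some) := by rw [← ha x]
      _ ≤ expENN (2 * k * G) * Q.weight g (n + 2 * k) (a x).2.1.some := weight_iterate_le hG k n _
      _ ≤ _ := mul_le_mul_right 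
          (le_iSup₂_of_le (f := fun y (_ : y ∈ (a x : Set Q.PhaseSpace)) => Q.weight g (n + 2 * k) y)
            _ (a x).2.1.some_mem le_rfl) _

/-- The supremum over an element need not be attained; a point that attains half of it costs a
factor 2. -/
theorem exists_representatives (hG : ∀ x, |g x| ≤ G) (n : ℕ) :
    ∃ r : Q.partition n → Q.PhaseSpace, (∀ A : Q.partition n, r A ∈ (A : Set Q.PhaseSpace)) ∧
      Q.partitionSum g n ≤ 2 * ∑' A, Q.weight g n (r A) := by
  have h : ∀ A : Q.partition n, ∃ x ∈ (A : Set Q.PhaseSpace),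
      (⨆ y ∈ (A : Set Q.PhaseSpace), Q.weight g n y) ≤ 2 * Q.weight g n x := by
    intro A
    obtain ⟨x₀, hx₀⟩ := A.2.1
    set s := ⨆ y ∈ (A : Set Q.PhaseSpace), Q.weight g n y with hs
    have h0 : s ≠ 0 := fun h => expENN_ne_zero (birkhoffSum Q.T g n x₀) (nonpos_iff_eq_zero.1
      (h ▸ (le_iSup₂_of_le x₀ hx₀ le_rfl : Q.weight g n x₀ ≤ s)))
    have htop : s ≠ ∞ := (lt_of_le_of_lt (iSup₂_le fun x _ =>
      weight_le (fun x => (abs_le.1 (hG x)).2) n x) (expENN_ne_top _).lt_top).ne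
    have h1 := ENNReal.half_lt_self h0 htop
    rw [hs, lt_iSup_iff] at h1
    obtain ⟨x, hx⟩ := h1
    obtain ⟨hxA, hx⟩ := lt_iSup_iff.1 hx
    refine ⟨x, hxA, ?_⟩
    rw [mul_comm]
    exact (ENNReal.div_le_iff two_ne_zero ENNReal.ofNat_ne_top).1 hx.le
  choose r hr h2 using h
  refine ⟨r, hr, ?_⟩
  rw [← ENNReal.tsum_mul_left]
  exact ENNReal.tsum_le_tsum h2

/-- Bowen-close points share the cells, except perhaps at both ends. -/
theorem exists_cell_eq_of_bowenDistance (hQ : Q.FiniteHorizon) : ∃ ε₀ : ℝ, 0 < ε₀ ∧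
    ∀ (n : ℕ) (x y : Q.PhaseSpace), Q.bowenDistance n x y ≤ ε₀ →
      (∀ i < n, label (Q.T^[i] x) = label (Q.T^[i] y)) ∧
      ∀ i, 0 < i → i < n → Q.cell (Q.T^[i] x) = Q.cell (Q.T^[i] y) := by
  obtain ⟨ε₀, hε₀, h⟩ := exists_cell_eq_of_distance hQ
  refine ⟨ε₀, hε₀, fun n x y hxy => ?_⟩
  rw [bowenDistance_le_iff] at hxy
  constructor
  · intro i hi
    have h1 := hxy (i + 1) hi
    rw [Function.iterate_succ_apply', Function.iterate_succ_apply'] at h1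
    exact (h _ _ (hxy i hi.le) h1).1
  · intro i hi0 hi
    obtain ⟨j, rfl⟩ : ∃ j, i = j + 1 := ⟨i - 1, by omega⟩
    have h1 := hxy (j + 1) (by omega)
    have h2 := hxy (j + 1 + 1) (by omega)
    rw [Function.iterate_succ_apply', Function.iterate_succ_apply'] at h1
    rw [Function.iterate_succ_apply', Function.iterate_succ_apply' Q.T (j + 1),
      Function.iterate_succ_apply', Function.iterate_succ_apply' Q.T j] at h2
    rw [Function.iterate_succ_apply', Function.iterate_succ_apply']
    exact (h _ _ (hxy j (by omega)) h1).2 h2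

variable (Q) in
/-- The first and the last cell of an orbit segment. -/
def endCells (n : ℕ) (x : Q.PhaseSpace) : range Q.cell × range Q.cell :=
  (⟨Q.cell x, mem_range_self _⟩, ⟨Q.cell (Q.T^[n] x), mem_range_self _⟩)

theorem eq_of_endCells (hQ : Q.FiniteHorizon) {n : ℕ} {r : Q.partition n → Q.PhaseSpace}
    (hr : ∀ A : Q.partition n, r A ∈ (A : Set Q.PhaseSpace)) {A B : Q.partition n}
    (h1 : Q.endCells n (r A) = Q.endCells n (r B))
    (h2 : ∀ i, 0 < i → i < n → Q.cell (Q.T^[i] (r A)) = Q.cell (Q.T^[i] (r B))) : A = B := by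
  rw [← atomOf_of_mem hQ (hr A), ← atomOf_of_mem hQ (hr B), atomOf_eq_iff]
  intro i hi
  rcases Nat.eq_zero_or_pos i with rfl | hi0
  · exact congr_arg Subtype.val (Prod.ext_iff.1 h1).1
  · rcases hi.lt_or_eq with hlt | rfl
    · exact h2 i hi0 hlt
    · exact congr_arg Subtype.val (Prod.ext_iff.1 h1).2

/-- Representatives with the same end cells are separated, since Bowen-close points share all inner
cells and would represent the same element. Summing over the finitely many pairs of end cells loses
only a constant factor. -/
theorem le_sepPressure (hQ : Q.FiniteHorizon) (hG : ∀ x, |g x| ≤ G) {P : ℝ}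
    (hP : ∀ n : ℕ, expENN (n * P) ≤ Q.partitionSum g n) : (P : EReal) ≤ Q.sepPressure g := by
  obtain ⟨ε₀, hε₀, hcell⟩ := exists_cell_eq_of_bowenDistance hQ
  have := (finite_range_cell hQ).to_subtype
  have := Fintype.ofFinite (range Q.cell × range Q.cell)
  set K : ℝ≥0∞ := ((Nat.card (range Q.cell × range Q.cell) : ℕ) : ℝ≥0∞) with hK
  have hC : 2 * K ≠ ∞ := ENNReal.mul_ne_top ENNReal.ofNat_ne_top (ENNReal.natCast_ne_top _)
  refine le_trans (le_limsup_log_div fun δ hδ => ?_) (le_iSup₂ (f := fun ε _ => Q.sepRate g ε) ε₀ hε₀)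
  filter_upwards [eventually_le_expENN hC 0 hδ] with n hn
  rw [pow_zero, mul_one] at hn
  set S := ⨆ (E : Set Q.PhaseSpace) (_ : Q.IsSeparated n ε₀ E), ∑' x : E, Q.weight g n x with hS
  obtain ⟨r, hr, hZ⟩ := exists_representatives hG n
  have hclass : ∀ c : range Q.cell × range Q.cell,
      ∑' A : {A // Q.endCells n (r A) = c}, Q.weight g n (r A) ≤ S := by
    intro c
    set E : Set Q.PhaseSpace := range fun A : {A // Q.endCells n (r A) = c} => r A with hE
    have hsep : Q.IsSeparated n ε₀ E := by
      rintro _ ⟨A, rfl⟩ _ ⟨B, rfl⟩ hne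
      by_contra hle
      refine hne (congr_arg r (eq_of_endCells hQ hr (A.2.trans B.2.symm) ?_))
      exact (hcell n _ _ (not_lt.1 hle)).2
    have hinj : Function.Injective fun A : {A // Q.endCells n (r A) = c} =>
        (⟨r A, mem_range_self A⟩ : E) := fun A B h => Subtype.ext (by
      have hAB : r A = r B := congr_arg Subtype.val h
      rw [← atomOf_of_mem hQ (hr A), ← atomOf_of_mem hQ (hr B), hAB])
    exact (tsum_le_tsum_of_injective hinj (h := fun x : E => Q.weight g n x)
      fun A => le_rfl).trans (le_iSup₂_of_le E hsep le_rfl)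
  have hsum : ∑' A, Q.weight g n (r A) ≤ K * S := by
    rw [← (Equiv.sigmaFiberEquiv fun A => Q.endCells n (r A)).tsum_eq, ENNReal.tsum_sigma',
      tsum_fintype]
    refine (Finset.sum_le_card_nsmul _ _ _ fun c _ => hclass c).trans (le_of_eq ?_)
    rw [hK, Nat.card_eq_fintype_card, Finset.card_univ, nsmul_eq_mul]
  have h1 : expENN (n * P) ≤ expENN (n * δ) * S := by
    calc expENN (n * P) ≤ 2 * (K * S) := (hP n).trans (hZ.trans (mul_le_mul_right hsum 2))
      _ = 2 * K * S := by ring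
      _ ≤ _ := mul_le_mul_left hn S
  calc expENN (n * (P - δ)) = expENN (n * P) * expENN (-(n * δ)) := by
        rw [← expENN_add]; congr 1; ring
    _ ≤ expENN (n * δ) * S * expENN (-(n * δ)) := mul_le_mul_left h1 _
    _ = expENN (n * δ) * expENN (-(n * δ)) * S := by ring
    _ = S := by rw [expENN_mul_neg, one_mul]

end SinaiTable

/-! ### Grazing collisions and the lower bound for spanning sets -/

namespace SinaiTable

variable {Q : SinaiTable} {g : Q.PhaseSpace → ℝ} {G : ℝ}

variable (Q) in
open Classical in
/-- The inner times of an orbit segment with a grazing collision. -/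
def grazingTimes (n : ℕ) (x : Q.PhaseSpace) : Finset ℕ :=
  (Finset.Ico 1 n).filter fun i => Q.T^[i] x ∈ Q.grazingSet

theorem mem_grazingTimes {n i : ℕ} {x : Q.PhaseSpace} :
    i ∈ Q.grazingTimes n x ↔ (0 < i ∧ i < n) ∧ Q.T^[i] x ∈ Q.grazingSet := by
  classical
  rw [grazingTimes, Finset.mem_filter, Finset.mem_Ico, Nat.succ_le_iff]

/-- The first two grazing times are used: at least m further ones follow before time n, so the
distance l of the first two is at most n - m. -/
theorem exists_two_grazingTimes {n m : ℕ} {x : Q.PhaseSpace}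
    (h : m + 2 ≤ (Q.grazingTimes n x).card) : ∃ i l, 0 < i ∧ 0 < l ∧ i + l < n ∧ l + m ≤ n ∧
      Q.T^[i] x ∈ Q.grazingSet ∧ Q.T^[i + l] x ∈ Q.grazingSet := by
  set V := Q.grazingTimes n x with hV
  have hne : V.Nonempty := Finset.card_pos.1 (by omega)
  set i := V.min' hne with hi
  have hiV : i ∈ V := V.min'_mem hne
  have hcard : (V.erase i).card = V.card - 1 := Finset.card_erase_of_mem hiV
  have hne' : (V.erase i).Nonempty := Finset.card_pos.1 (by omega)
  set j := (V.erase i).min' hne' with hj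
  have hjV : j ∈ V.erase i := (V.erase i).min'_mem hne'
  have hcard' : ((V.erase i).erase j).card = V.card - 2 := by
    rw [Finset.card_erase_of_mem hjV, hcard]; omega
  have hsub : (V.erase i).erase j ⊆ Finset.Ioo j n := by
    intro k hk
    obtain ⟨hkj, hk'⟩ := Finset.mem_erase.1 hk
    have h1 := (V.erase i).min'_le k hk'
    have h2 := (mem_grazingTimes.1 (Finset.mem_of_mem_erase hk')).1.2
    exact Finset.mem_Ioo.2 ⟨lt_of_le_of_ne h1 (Ne.symm hkj), h2⟩
  have h3 := Finset.card_le_card hsub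
  rw [Nat.card_Ioo] at h3
  obtain ⟨hji, hjV'⟩ := Finset.mem_erase.1 hjV
  have hij : i < j := lt_of_le_of_ne (V.min'_le j hjV') (Ne.symm hji)
  have h4 := mem_grazingTimes.1 hiV
  have h5 := mem_grazingTimes.1 hjV'
  refine ⟨i, j - i, h4.1.1, by omega, by omega, by omega, h4.2, ?_⟩
  rw [Nat.add_sub_cancel' hij.le]
  exact h5.2

variable (Q) in
/-- The elements of the partition that share their inner cells with an orbit segment that has many
grazing collisions. -/
def grazingAtoms (n m : ℕ) (r : Q.partition n → Q.PhaseSpace) : Set (Q.partition n) :=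
  {A | ∃ z, (∀ i, 0 < i → i < n → Q.cell (Q.T^[i] z) = Q.cell (Q.T^[i] (r A))) ∧
    m + 2 ≤ (Q.grazingTimes n z).card}

theorem sigma_atomOf_inj (hQ : Q.FiniteHorizon) {k : ℕ} {l l' : Fin k} {x y : Q.PhaseSpace}
    (h : (⟨l, atomOf hQ l x⟩ : Σ l : Fin k, Q.partition l) = ⟨l', atomOf hQ l' y⟩) :
    l = l' ∧ ∀ i ≤ (l : ℕ), Q.cell (Q.T^[i] x) = Q.cell (Q.T^[i] y) := by
  obtain ⟨rfl, h2⟩ := Sigma.mk.inj_iff.1 h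
  exact ⟨rfl, (atomOf_eq_iff hQ).1 (eq_of_heq h2)⟩

/-- The weight of the orbit segments with many grazing collisions: such a segment is determined by
a shorter one between two grazing collisions. -/
theorem exists_tsum_grazingAtoms_le (hQ : Q.FiniteHorizon) : ∃ K : ℕ,
    ∀ (g : Q.PhaseSpace → ℝ) (s : ℝ), (∀ x, g x ≤ s) → ∀ (n m : ℕ)
      (r : Q.partition n → Q.PhaseSpace), (∀ A : Q.partition n, r A ∈ (A : Set Q.PhaseSpace)) →
      ∑' A : Q.grazingAtoms n m r, Q.weight g n (r A) ≤ (n * K : ℕ) *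
        ∑ l : Fin (n + 1 - m), expENN ((n - (l : ℕ)) * s) * Q.partitionSum g l := by
  obtain ⟨N, col, hcol⟩ := exists_coloring (exists_nhds_grazingClose (Q := Q))
  have := (finite_range_cell hQ).to_subtype
  refine ⟨Nat.card (Fin N × Fin N × (range Q.cell × range Q.cell)), fun g s hs n m r hr => ?_⟩
  have hch : ∀ A : Q.grazingAtoms n m r, ∃ (z : Q.PhaseSpace) (i : Fin n) (l : Fin (n + 1 - m)),
      (∀ i, 0 < i → i < n → Q.cell (Q.T^[i] z) = Q.cell (Q.T^[i] (r A))) ∧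
      0 < (i : ℕ) ∧ 0 < (l : ℕ) ∧ (i : ℕ) + l < n ∧
      Q.T^[i] z ∈ Q.grazingSet ∧ Q.T^[(i : ℕ) + l] z ∈ Q.grazingSet := by
    intro A
    obtain ⟨z, hz, hcard⟩ := A.2
    obtain ⟨i, l, hi, hl, hil, hlm, h1, h2⟩ := exists_two_grazingTimes hcard
    exact ⟨z, ⟨i, by omega⟩, ⟨l, by omega⟩, hz, hi, hl, hil, h1, h2⟩
  choose z i l hz hi hl hil hg1 hg2 using hch
  -- An element is encoded by the segment of its representative between two grazing times of z, the
  -- starting time, the colours of the two grazing points and the end cells. The weight outside the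
  -- segment is at most exp(s) per step.
  have key := tsum_le_card_mul_tsum
    (φ := fun A => (⟨l A, atomOf hQ (l A) (Q.T^[i A] (r A))⟩ :
      Σ l : Fin (n + 1 - m), Q.partition l))
    (c := fun A => (i A, col (Q.T^[i A] (z A)), col (Q.T^[(i A : ℕ) + l A] (z A)),
      Q.endCells n (r A)))
    (f := fun A : Q.grazingAtoms n m r => Q.weight g n (r A))
    (h := fun p : Σ l : Fin (n + 1 - m), Q.partition l => expENN ((n - (p.1 : ℕ)) * s) *
      ⨆ x ∈ (p.2 : Set Q.PhaseSpace), Q.weight g p.1 x) ?_ ?_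
  · refine key.trans (le_of_eq ?_)
    rw [Nat.card_prod, Nat.card_fin, ENNReal.tsum_sigma', tsum_fintype]
    congr 1
    refine Finset.sum_congr rfl fun l _ => ?_
    change ∑' b : Q.partition l, expENN ((n - (l : ℕ)) * s) *
      ⨆ x ∈ (b : Set Q.PhaseSpace), Q.weight g l x = _
    rw [partitionSum, ENNReal.tsum_mul_left]
  · intro A B hφ hc
    obtain ⟨hle, hcells⟩ := sigma_atomOf_inj hQ hφ
    simp only [Prod.mk.injEq] at hc
    obtain ⟨hie, hc1, hc2, hc3⟩ := hc
    have hzA := hz A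
    have hzB := hz B
    have hgA1 := hg1 A
    have hgA2 := hg2 A
    rw [hie, hle] at hc2
    rw [hie] at hc1 hcells
    rw [hie] at hgA1
    rw [hie, hle] at hgA2
    rw [hle] at hcells
    have hlab : ∀ j < (l B : ℕ), label (Q.T^[j] (Q.T^[i B] (z A))) =
        label (Q.T^[j] (Q.T^[i B] (z B))) := by
      intro j hj
      have h1 := hcells j hj.le
      rw [← Function.iterate_add_apply, ← Function.iterate_add_apply] at h1 ⊢
      have h2 := hi B
      have h3 := hil B
      refine label_eq_of_cell_eq ?_
      rw [hzA _ (by omega) (by omega), hzB _ (by omega) (by omega), h1]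
    -- The segments have the same labels, and equal colours make their grazing ends close, so the
    -- orbits of the two witnesses coincide. They carry the inner cells of the two elements; the end
    -- cells do the rest.
    have heq : Q.T^[i B] (z A) = Q.T^[i B] (z B) := by
      have hswap : ∀ w, Q.T^[l B] (Q.T^[i B] w) = Q.T^[(i B : ℕ) + l B] w := fun w => by
        rw [← Function.iterate_add_apply, add_comm]
      refine eq_of_grazingClose hQ (hl B) hlab hgA1 (hg1 B) ?_ ?_ (hcol _ _ hc1) (hcol _ _ ?_)
      · rw [hswap]; exact hgA2
      · rw [hswap]; exact hg2 B
      · rw [hswap, hswap]; exact hc2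
    have hzz : z A = z B := (bijective_T hQ).1.iterate _ heq
    refine Subtype.ext (eq_of_endCells hQ hr hc3 fun k hk0 hk => ?_)
    rw [← hzA k hk0 hk, ← hzB k hk0 hk, hzz]
  · intro A
    have h1 := hil A
    have h2 : Q.weight g n (r A) = Q.weight g (i A) (r A) *
        (Q.weight g (l A) (Q.T^[i A] (r A)) *
          Q.weight g (n - i A - l A) (Q.T^[l A] (Q.T^[i A] (r A)))) := by
      rw [← weight_add, ← weight_add]
      congr 1
      omega
    rw [h2]
    calc _ ≤ expENN ((i A : ℕ) * s) * (Q.weight g (l A) (Q.T^[i A] (r A)) *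
          expENN ((n - i A - l A : ℕ) * s)) := by
          gcongr
          · exact weight_le hs _ _
          · exact weight_le hs _ _
      _ = expENN ((n - (l A : ℕ)) * s) * Q.weight g (l A) (Q.T^[i A] (r A)) := by
          have h3 : ((n - i A - l A : ℕ) : ℝ) = n - (i A : ℕ) - (l A : ℕ) := by
            rw [Nat.cast_sub (by omega), Nat.cast_sub (by omega)]
          have h4 : ((n : ℝ) - (l A : ℕ)) * s = (i A : ℕ) * s + (n - i A - l A : ℕ) * s := by
            rw [h3]; ring
          rw [h4, expENN_add]; ring
      _ ≤ _ := mul_le_mul_right (weight_le_iSup_atomOf hQ _ _) _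

/-- A time i at which the orbit is in S_1 has a grazing collision at i or at i + 1. Each alternative
adds one end time, 0 or n, to the inner grazing times. -/
theorem card_singular_times_le [DecidablePred fun x : Q.PhaseSpace => x ∈ Q.singularSet 1] (n : ℕ)
    (x : Q.PhaseSpace) :
    ((Finset.range n).filter fun i => Q.T^[i] x ∈ Q.singularSet 1).card ≤
      2 * ((Q.grazingTimes n x).card + 1) := by
  classical
  have hsub : ((Finset.range n).filter fun i => Q.T^[i] x ∈ Q.singularSet 1) ⊆
      insert 0 (Q.grazingTimes n x) ∪ (insert n (Q.grazingTimes n x)).image (fun i => i - 1) := by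
    intro i hi
    obtain ⟨h1, h2⟩ := Finset.mem_filter.1 hi
    rw [Finset.mem_range] at h1
    rw [mem_singularSet_one, ← Function.iterate_succ_apply' Q.T i x] at h2
    rcases h2 with h2 | h2
    · refine Finset.mem_union_left _ (Finset.mem_insert.2 ?_)
      rcases Nat.eq_zero_or_pos i with h0 | h0
      · exact Or.inl h0
      · exact Or.inr (mem_grazingTimes.2 ⟨⟨h0, h1⟩, h2⟩)
    · refine Finset.mem_union_right _ (Finset.mem_image.2 ⟨i + 1, Finset.mem_insert.2 ?_, rfl⟩)
      rcases (Nat.succ_le_of_lt h1).eq_or_lt with h0 | h0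
      · exact Or.inl h0
      · exact Or.inr (mem_grazingTimes.2 ⟨⟨i.succ_pos, h0⟩, h2⟩)
  refine (Finset.card_le_card hsub).trans ((Finset.card_union_le _ _).trans ?_)
  have h1 := Finset.card_insert_le 0 (Q.grazingTimes n x)
  have h2 := (Finset.card_image_le (s := insert n (Q.grazingTimes n x)) (f := fun i => i - 1)).trans
    (Finset.card_insert_le n (Q.grazingTimes n x))
  omega

/-- Birkhoff sums along close orbits differ little if both have few grazing collisions. -/
theorem birkhoffSum_le_of_close (hG : ∀ x, |g x| ≤ G) (hG0 : 0 ≤ G) {τ : ℝ} (hτ : 0 ≤ τ) {n m : ℕ}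
    {x y : Q.PhaseSpace}
    (h : ∀ i < n, Q.T^[i] x ∉ Q.singularSet 1 → Q.T^[i] y ∉ Q.singularSet 1 →
      |g (Q.T^[i] x) - g (Q.T^[i] y)| ≤ τ)
    (hx : (Q.grazingTimes n x).card ≤ m + 1) (hy : (Q.grazingTimes n y).card ≤ m + 1) :
    birkhoffSum Q.T g n x ≤ birkhoffSum Q.T g n y + (n * τ + 2 * G * (4 * m + 8)) := by
  classical
  set E := ((Finset.range n).filter fun i => Q.T^[i] x ∈ Q.singularSet 1) ∪
    ((Finset.range n).filter fun i => Q.T^[i] y ∈ Q.singularSet 1) with hE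
  have hcard : E.card ≤ 4 * m + 8 := by
    refine (Finset.card_union_le _ _).trans ?_
    have h1 := card_singular_times_le n x
    have h2 := card_singular_times_le n y
    omega
  have hEr : E ⊆ Finset.range n :=
    Finset.union_subset (Finset.filter_subset _ _) (Finset.filter_subset _ _)
  have hterm : ∀ i ∈ Finset.range n, g (Q.T^[i] x) ≤
      g (Q.T^[i] y) + (τ + if i ∈ E then 2 * G else 0) := by
    intro i hi
    split_ifs with hiE
    · linarith [(abs_le.1 (hG (Q.T^[i] x))).2, (abs_le.1 (hG (Q.T^[i] y))).1]
    · simp only [hE, Finset.mem_union, Finset.mem_filter, not_or, not_and] at hiE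
      have := h i (Finset.mem_range.1 hi) (hiE.1 hi) (hiE.2 hi)
      linarith [(abs_le.1 this).2]
  have hsum := Finset.sum_le_sum hterm
  rw [Finset.sum_add_distrib, Finset.sum_add_distrib, Finset.sum_const, Finset.card_range,
    nsmul_eq_mul, ← Finset.sum_filter, Finset.sum_const, nsmul_eq_mul,
    Finset.filter_mem_eq_inter, Finset.inter_eq_right.2 hEr] at hsum
  have h3 : (E.card : ℝ) * (2 * G) ≤ 2 * G * (4 * m + 8) := by
    have : (E.card : ℝ) ≤ 4 * m + 8 := by exact_mod_cast hcard
    nlinarith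
  rw [birkhoffSum, birkhoffSum]
  linarith

theorem exists_forall_partitionSum_le (hQ : Q.FiniteHorizon) (hG : ∀ x, |g x| ≤ G) {a : ℝ}
    (h : ∀ᶠ n : ℕ in atTop, Q.partitionSum g n ≤ expENN (n * a)) :
    ∃ C : ℝ≥0∞, C ≠ ∞ ∧ ∀ n : ℕ, Q.partitionSum g n ≤ C * expENN (n * a) := by
  obtain ⟨N, hN⟩ := eventually_atTop.1 h
  -- The constant absorbs the finitely many exceptional n.
  refine ⟨1 + ∑ n ∈ Finset.range N, Q.partitionSum g n * expENN (-(n * a)), ?_, fun n => ?_⟩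
  · refine ENNReal.add_ne_top.2 ⟨ENNReal.one_ne_top, (ENNReal.sum_lt_top.2 fun n _ => ?_).ne⟩
    exact (ENNReal.mul_ne_top (partitionSum_ne_top hQ hG n) (expENN_ne_top _)).lt_top
  · rcases lt_or_ge n N with hn | hn
    · calc Q.partitionSum g n
          = Q.partitionSum g n * expENN (-(n * a)) * expENN (n * a) := by
            rw [mul_assoc, mul_comm (expENN (-_)), expENN_mul_neg, mul_one]
        _ ≤ _ := by
            refine mul_le_mul_left (le_add_left ?_) _
            exact Finset.single_le_sum (f := fun n : ℕ => Q.partitionSum g n * expENN (-(n * a)))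
              (fun _ _ => zero_le) (Finset.mem_range.2 hn)
    · refine (hN n hn).trans ?_
      nth_rewrite 1 [← one_mul (expENN (n * a))]
      exact mul_le_mul_left le_self_add _

end SinaiTable

namespace SinaiTable

variable {Q : SinaiTable} {g : Q.PhaseSpace → ℝ} {G : ℝ}

/-- Orbit segments with a positive frequency of grazing collisions carry little weight. -/
theorem exists_eventually_tsum_grazingAtoms_le (hQ : Q.FiniteHorizon) (hG : ∀ x, |g x| ≤ G) {P s : ℝ}
    (hs : ∀ x, g x ≤ s) (hsP : s < P)
    (hP : ∀ δ > 0, ∀ᶠ n : ℕ in atTop, Q.partitionSum g n ≤ expENN (n * (P + δ))) {η : ℝ}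
    (hη : 0 < η) : ∀ᶠ n : ℕ in atTop, ∀ m : ℕ, η * n ≤ m →
      ∀ r : Q.partition n → Q.PhaseSpace, (∀ A : Q.partition n, r A ∈ (A : Set Q.PhaseSpace)) →
        4 * ∑' A : Q.grazingAtoms n m r, Q.weight g n (r A) ≤ expENN (n * P) := by
  obtain ⟨K, hK⟩ := exists_tsum_grazingAtoms_le hQ
  -- As l ≤ (1 - η) n, replacing at least η n steps of rate P + δ by steps of rate s lowers the
  -- exponent n (P + δ) by at least η n (P - s) = 2 n δ, which leaves at most n (P - δ). The
  -- remaining n δ pays for the polynomial factor.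
  set δ := η * (P - s) / 2 with hδ
  have hδ0 : 0 < δ := by have := mul_pos hη (sub_pos.2 hsP); positivity
  obtain ⟨C, hC, hZ⟩ := exists_forall_partitionSum_le hQ hG (hP δ hδ0)
  have hC' : 4 * ((K : ℝ≥0∞) * (2 * C)) ≠ ∞ :=
    ENNReal.mul_ne_top ENNReal.ofNat_ne_top (ENNReal.mul_ne_top (ENNReal.natCast_ne_top K)
      (ENNReal.mul_ne_top ENNReal.ofNat_ne_top hC))
  filter_upwards [eventually_le_expENN hC' 2 hδ0, eventually_gt_atTop 0] with n hn hn0 m hm r hr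
  have hterm : ∀ l : Fin (n + 1 - m), expENN ((n - (l : ℕ)) * s) * Q.partitionSum g l ≤
      C * expENN (n * (P - δ)) := by
    intro l
    have hl : ((l : ℕ) : ℝ) + m ≤ n := by
      have := l.2
      exact_mod_cast (by omega : (l : ℕ) + m ≤ n)
    calc expENN ((n - (l : ℕ)) * s) * Q.partitionSum g l
        ≤ expENN ((n - (l : ℕ)) * s) * (C * expENN ((l : ℕ) * (P + δ))) := mul_le_mul_right (hZ l) _
      _ = C * expENN ((n - (l : ℕ)) * s + (l : ℕ) * (P + δ)) := by rw [expENN_add]; ring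
      _ ≤ C * expENN (n * (P - δ)) := by
          refine mul_le_mul_right (expENN_mono ?_) C
          have h1 : 0 ≤ (n - (l : ℕ) - η * n) * (P + δ - s) :=
            mul_nonneg (by linarith) (by linarith)
          have h2 : 0 ≤ η * n * δ := by positivity
          have h3 : η * n * (P - s) = 2 * (n * δ) := by rw [hδ]; ring
          nlinarith
  have hcard : (n + 1 - m : ℕ) ≤ 2 * n := by omega
  calc 4 * ∑' A : Q.grazingAtoms n m r, Q.weight g n (r A)
      ≤ 4 * ((n * K : ℕ) * ∑ l : Fin (n + 1 - m), expENN ((n - (l : ℕ)) * s) *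
          Q.partitionSum g l) := mul_le_mul_right (hK g s hs n m r hr) _
    _ ≤ 4 * ((n * K : ℕ) * ((2 * n : ℕ) * (C * expENN (n * (P - δ))))) := by
        refine mul_le_mul_right (mul_le_mul_right ?_ _) _
        refine (Finset.sum_le_card_nsmul _ _ _ fun l _ => hterm l).trans ?_
        rw [Finset.card_univ, Fintype.card_fin, nsmul_eq_mul]
        exact mul_le_mul_left (by exact_mod_cast hcard) _
    _ = 4 * (K * (2 * C)) * (n : ℝ≥0∞) ^ 2 * expENN (n * (P - δ)) := by push_cast; ring
    _ ≤ expENN (n * δ) * expENN (n * (P - δ)) := mul_le_mul_left hn _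
    _ = expENN (n * P) := by rw [← expENN_add]; congr 1; ring

/-- Elements whose inner cells are shared by an orbit with many grazing collisions have small total
weight. For the others, the representative and a close point of the spanning set both graze rarely,
so their Birkhoff sums differ by a small multiple of n, and each point serves a bounded number of
elements. -/
theorem le_spanPressure (hQ : Q.FiniteHorizon) (hG : ∀ x, |g x| ≤ G) {P s : ℝ}
    (hs : ∀ x, g x ≤ s) (hsP : s < P)
    (hP : ∀ n : ℕ, expENN (n * P) ≤ Q.partitionSum g n)
    (hP' : ∀ δ > 0, ∀ᶠ n : ℕ in atTop, Q.partitionSum g n ≤ expENN (n * (P + δ))) {α : ℝ}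
    (hα : 0 < α) (hg : Q.IsPiecewiseHolder α g) : (P : EReal) ≤ Q.spanPressure g := by
  have hG0 : 0 ≤ G := (abs_nonneg _).trans (hG (Classical.arbitrary _))
  obtain ⟨ε₀, hε₀, hcell⟩ := exists_cell_eq_of_bowenDistance hQ
  obtain ⟨C, ε₁, hC, hε₁, hhol⟩ := hg.exists_uniform hQ
  have := (finite_range_cell hQ).to_subtype
  set K : ℝ≥0∞ := ((Nat.card (range Q.cell × range Q.cell) : ℕ) : ℝ≥0∞) with hK
  refine EReal.ge_of_forall_gt_iff_ge.1 fun z hz => ?_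
  have hz' : z < P := EReal.coe_lt_coe_iff.1 hz
  set θ := P - z with hθ
  have hθ0 : 0 < θ := by linarith
  obtain ⟨ε, hε, hεle, hετ⟩ : ∃ ε > 0, ε ≤ min ε₀ ε₁ ∧ C * ε ^ α ≤ θ / 2 := by
    have h1 : Tendsto (fun ε : ℝ => C * ε ^ α) (𝓝[>] 0) (𝓝 (C * 0)) :=
      ((Real.continuousAt_rpow_const 0 α (Or.inr hα.le)).tendsto.mono_left
        nhdsWithin_le_nhds |>.const_mul C).trans (by rw [Real.zero_rpow hα.ne'])
    rw [mul_zero] at h1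
    obtain ⟨ε, h2, h3⟩ := ((h1.eventually (gt_mem_nhds (half_pos hθ0))).and
      (Ioc_mem_nhdsGT (lt_min hε₀ hε₁))).exists
    exact ⟨ε, h3.1, h3.2, h2.le⟩
  -- The singular times cost 2 G (4 m + 8) with m ≤ η n + 1, that is at most 8 G η n + 24 G. One
  -- half of θ n pays for 8 G η n, the other for the Hölder errors.
  obtain ⟨η, hη, hηG⟩ : ∃ η > 0, 8 * G * η ≤ θ / 2 := by
    refine ⟨θ / (2 * (8 * G + 1)), by positivity, ?_⟩
    rw [mul_div_assoc', div_le_div_iff₀ (by positivity) two_pos]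
    nlinarith
  refine le_trans ?_ (le_iSup₂ (f := fun ε _ => Q.spanRate g ε) ε hε)
  refine le_limsup_log_div fun δ hδ => ?_
  have hC' : 4 * K * expENN (24 * G) ≠ ∞ := ENNReal.mul_ne_top
    (ENNReal.mul_ne_top ENNReal.ofNat_ne_top (ENNReal.natCast_ne_top _)) (expENN_ne_top _)
  filter_upwards [exists_eventually_tsum_grazingAtoms_le hQ hG hs hsP hP' hη,
    eventually_le_expENN hC' 0 hδ] with n hbad hn
  rw [pow_zero, mul_one] at hn
  refine le_iInf₂ fun F hF => ?_
  obtain ⟨r, hr, hZ⟩ := exists_representatives hG n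
  set m := ⌈η * n⌉₊ with hm
  have hm1 : η * n ≤ m := Nat.le_ceil _
  have hm2 : (m : ℝ) ≤ η * n + 1 := (Nat.ceil_lt_add_one (by positivity)).le
  have hb := hbad m hm1 r hr
  set S := ∑' x : F, Q.weight g n x with hS
  choose y hyF hy using hF
  have hgood : ∑' A : ((Q.grazingAtoms n m r)ᶜ : Set (Q.partition n)), Q.weight g n (r A) ≤
      K * (expENN (n * θ + 24 * G) * S) := by
    rw [hS, ← ENNReal.tsum_mul_left]
    refine tsum_le_card_mul_tsum
      (φ := fun A : ((Q.grazingAtoms n m r)ᶜ : Set (Q.partition n)) => (⟨y (r A), hyF (r A)⟩ : F))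
      (c := fun A => Q.endCells n (r A)) (fun A B h1 h2 => Subtype.ext ?_)
      (h := fun x : F => expENN (n * θ + 24 * G) * Q.weight g n x) fun A => ?_
    · refine eq_of_endCells hQ hr h2 fun i hi0 hi => ?_
      have h3 : y (r A) = y (r B) := congr_arg Subtype.val h1
      rw [(hcell n _ _ ((hy (r A)).trans (hεle.trans (min_le_left _ _)))).2 i hi0 hi,
        (hcell n _ _ ((hy (r B)).trans (hεle.trans (min_le_left _ _)))).2 i hi0 hi, h3]
    · have hc := hcell n _ _ ((hy (r A)).trans (hεle.trans (min_le_left _ _)))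
      -- The point of the spanning set may graze even if the representative does not. The bad
      -- elements are defined through arbitrary orbits with the same inner cells, so this bound
      -- covers both.
      have hfew : ∀ z, (∀ i, 0 < i → i < n → Q.cell (Q.T^[i] z) = Q.cell (Q.T^[i] (r A))) →
          (Q.grazingTimes n z).card ≤ m + 1 := by
        intro z hz
        by_contra hlt
        exact A.2 ⟨z, hz, by omega⟩
      have hd := bowenDistance_le_iff.1 (hy (r A))
      have hle := birkhoffSum_le_of_close hG hG0 (τ := C * ε ^ α) (by positivity) (n := n) (m := m)
        (x := r A) (y := y (r A)) (fun i hi hx hx' => by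
          refine (hhol _ _ ((hd i hi.le).trans (hεle.trans (min_le_right _ _))) hx hx'
            (hc.1 i hi)).trans ?_
          exact mul_le_mul_of_nonneg_left
            (Real.rpow_le_rpow (distance_nonneg _ _) (hd i hi.le) hα.le) hC)
        (hfew _ fun _ _ _ => rfl) (hfew _ fun i h0 hi => (hc.2 i h0 hi).symm)
      change expENN _ ≤ expENN _ * expENN _
      rw [← expENN_add]
      refine expENN_mono (hle.trans ?_)
      have h1 : (n : ℝ) * (C * ε ^ α) ≤ n * (θ / 2) :=
        mul_le_mul_of_nonneg_left hετ (Nat.cast_nonneg n)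
      have h2 : G * m ≤ G * (η * n + 1) := mul_le_mul_of_nonneg_left hm2 hG0
      have h3 : 8 * G * η * n ≤ θ / 2 * n := mul_le_mul_of_nonneg_right hηG (Nat.cast_nonneg n)
      nlinarith
  have hsplit : ∑' A, Q.weight g n (r A) =
      ∑' A : Q.grazingAtoms n m r, Q.weight g n (r A) +
        ∑' A : ((Q.grazingAtoms n m r)ᶜ : Set (Q.partition n)), Q.weight g n (r A) :=
    (ENNReal.summable.tsum_add_tsum_compl ENNReal.summable).symm
  have h1 : expENN (n * P) ≤ 4 * (K * (expENN (n * θ + 24 * G) * S)) := by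
    -- The factor 4 in the bound for the bad elements lets one of the two copies of exp(n P) absorb
    -- them.
    have h2 : expENN (n * P) + expENN (n * P) ≤
        expENN (n * P) + 4 * (K * (expENN (n * θ + 24 * G) * S)) := by
      have h3 := (hP n).trans hZ
      calc expENN (n * P) + expENN (n * P) = 2 * expENN (n * P) := (two_mul _).symm
        _ ≤ 2 * (2 * ∑' A, Q.weight g n (r A)) := mul_le_mul_right h3 2
        _ = 4 * ∑' A : Q.grazingAtoms n m r, Q.weight g n (r A) + 4 *
            ∑' A : ((Q.grazingAtoms n m r)ᶜ : Set (Q.partition n)), Q.weight g n (r A) := by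
            rw [hsplit]; ring
        _ ≤ _ := add_le_add hb (mul_le_mul_right hgood 4)
    exact (ENNReal.add_le_add_iff_left (expENN_ne_top _)).1 h2
  calc expENN (n * (z - δ)) = expENN (n * P) * expENN (-(n * (θ + δ))) := by
        rw [← expENN_add]; congr 1; rw [hθ]; ring
    _ ≤ 4 * (K * (expENN (n * θ + 24 * G) * S)) * expENN (-(n * (θ + δ))) := mul_le_mul_left h1 _
    _ = 4 * K * expENN (24 * G) * (expENN (n * θ) * expENN (-(n * (θ + δ)))) * S := by
        rw [expENN_add]; ring
    _ ≤ expENN (n * δ) * (expENN (n * θ) * expENN (-(n * (θ + δ)))) * S := by gcongr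
    _ = S := by
        rw [← expENN_add, ← expENN_add, show n * δ + (n * θ + -(n * (θ + δ))) = 0 by ring,
          expENN_zero, one_mul]

end SinaiTable

end

theorem mainTheorem4 (Q : SinaiTable) (hQ : Q.FiniteHorizon) (g : Q.PhaseSpace → ℝ)
    (hg : Q.IsPiecewiseContinuous g) :
    ∃ P : ℝ, Tendsto (Q.pressureSeq g) atTop (𝓝 (P : EReal)) ∧
      Q.spanPressure g ≤ (P : EReal) ∧
      Q.sepPressure g ≤ (P : EReal) ∧
      (0 < P - ⨆ x, g x →
        Q.sepPressure g = (P : EReal) ∧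
        ((∃ α ∈ Set.Ioo (0 : ℝ) 1, Q.IsPiecewiseHolder α g) →
          Q.spanPressure g = (P : EReal))) := by
  obtain ⟨⟨G, hG⟩, -⟩ := hg
  obtain ⟨P, hlim, hP, hP'⟩ := SinaiTable.exists_pressure hQ hG
  have hsep := SinaiTable.sepPressure_le hQ hG hP'
  have hspan := SinaiTable.spanPressure_le hQ hG hP'
  have hbdd : BddAbove (range g) := ⟨G, by
    rintro _ ⟨x, rfl⟩
    exact (abs_le.1 (hG x)).2⟩
  exact ⟨P, hlim, hspan, hsep, fun hlt =>
    ⟨le_antisymm hsep (SinaiTable.le_sepPressure hQ hG hP), fun ⟨α, hα, hhol⟩ =>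
      le_antisymm hspan (SinaiTable.le_spanPressure hQ hG (le_ciSup hbdd) (sub_pos.1 hlt) hP hP'
        hα.1 hhol)⟩⟩
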